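/- **Theorem (Graph connectivity).** Fix the pre-norm to be either standard layer-norm or RMS norm. There is a single $(17,2,1)$-universal (looped) transformer $T$ (17 initial layers, a block of 2 layers that is repeated, 1 final layer) with rational parameters, with both causal and unmasked averaging-hard attention heads, with masked pre-norm, with fixed number of heads, fixed model dimension $m$ and fixed feedforward width $w$, and without positional encodings, that solves $s$–$t$ connectivity on directed and on undirected graphs when its repeated block is unrolled $\lceil\log_2 n\rceil$ times. Precisely: for $n\ge 1$, a directed or undirected graph $G$ on $\{1,\dots,n\}$ with adjacency matrix $A\in\{0,1\}^{n\times n}$, and $s,t\in\{1,\dots,n\}$, let the input be the word $$\mathrm{BoS}\;A_{1,1}\cdots A_{1,n}\;A_{2,1}\cdots A_{2,n}\;\cdots\;A_{n,1}\cdots A_{n,n}\;\underbrace{\square\cdots\square}_{n^3}\;\underbrace{a\cdots a}_{s}\;\underbrace{b\cdots b}_{t}$$ and let $N$ be its length. The computation is carried out in a $p$-bit datatype $\mathbb D_p$ (a map from $\{0,1\}^p$ to $\mathbb R$): parameters, and the results of all the arithmetic operations (addition, multiplication, division, and, each as one operation, layer-norm and the summation over positions in an attention head), are rounded to the nearest value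 of $\mathbb D_p$, ties going to the higher value. Let $(\mathbb D_p)_{p}$ be any family of datatypes with $\Omega(p)$ correct bits, i.e. for some $\kappa>0$ and all large $p$, $0$ is represented exactly and every real $x$ with $|x|\le 2^{\kappa p}$ is within $2^{-\kappa p}$ of a value of $\mathbb D_p$. Then there is a constant $c>0$ such that for all $n$, $G$, $s$, $t$ as above and all $p\ge c\log_2 N$, the transformer $T$, unrolled $\lceil\log_2 n\rceil$ times, has a unique output token of maximum score at the last position, and this token is "accept" if and only if $G$ has a path (possibly of length $0$) from $s$ to $t$. The transformer $T$ depends neither on $n$, $G$, $s$, $t$ nor on the datatype. -/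

import Mathlib

noncomputable section

namespace LoopedTransformer

/-! ### Numerical datatypes -/

/-- A family of datatypes: for every number `p` of bits, a numerical value for each string
in `{0,1}^p`. -/
structure Datatype where
  /-- The number denoted by a bit string. -/
  val : (p : ℕ) → (Fin p → Bool) → ℝ

/-- `D.round p x` is the value of the `p`-bit datatype that is closest to `x`, ties being broken
in favor of the higher value. -/
def Datatype.round (D : Datatype) (p : ℕ) (x : ℝ) : ℝ :=
  sSup {v | v ∈ Set.range (D.val p) ∧ ∀ b, |v - x| ≤ |D.val p b - x|}

/-- The `p`-bit datatype has `Ω(p)` correct bits before and after the binary point: for a fixed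
`κ > 0` and all large `p`, zero is represented exactly, and all numbers of absolute value at most
`2 ^ (κ p)` are represented up to `2 ^ (-κ p)`. -/
def Datatype.IsPrecise (D : Datatype) : Prop :=
  ∃ κ : ℝ, 0 < κ ∧ ∀ᶠ p : ℕ in Filter.atTop,
    (∃ b, D.val p b = 0) ∧
      ∀ x : ℝ, |x| ≤ (2 : ℝ) ^ (κ * p) → ∃ b, |D.val p b - x| ≤ (2 : ℝ) ^ (-(κ * p))

/-! ### Rounded arithmetic

Everything below is evaluated with respect to a rounding map `rnd`, which will be
`D.round p`: the realization of an operation `f` sends `x₁, …, x_k` to `rnd (f x₁ … x_k)`.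
Rational parameters are rounded when they are used. -/

/-- Inner product, where each multiplication and each (binary) addition is rounded. -/
def dot (rnd : ℝ → ℝ) {k : ℕ} (x y : Fin k → ℝ) : ℝ :=
  Fin.foldl k (fun acc i => rnd (acc + rnd (x i * y i))) 0

/-- Application of a matrix of rational parameters. -/
def applyMat (rnd : ℝ → ℝ) {a k : ℕ} (M : Matrix (Fin a) (Fin k) ℚ) (x : Fin k → ℝ) :
    Fin a → ℝ :=
  fun r => dot rnd (fun j => rnd (M r j : ℝ)) x

/-- The two kinds of pre-norm. -/
inductive NormKind
  | layerNorm
  | rmsNorm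

/-- The average of the coordinates of a vector. -/
def mean {m : ℕ} (x : Fin m → ℝ) : ℝ := (∑ i, x i) / m

/-- Standard layer-norm and RMS norm, as exact operations `ℝ^m → ℝ^m` (with value `0` where the
denominator vanishes). -/
def NormKind.apply {m : ℕ} : NormKind → (Fin m → ℝ) → Fin m → ℝ
  | .layerNorm, x => fun i => (x i - mean x) / √(mean fun j => (x j - mean x) ^ 2)
  | .rmsNorm, x => fun i => x i / √(mean fun j => x j ^ 2)

/-- Masked pre-norm `layer_norm (mask ⊙ h)`; the norm is rounded as a single operation. -/
def maskedNorm (rnd : ℝ → ℝ) (ν : NormKind) {m : ℕ} (mask : Fin m → ℚ) (x : Fin m → ℝ) :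
    Fin m → ℝ :=
  fun i => rnd (ν.apply (fun j => rnd (rnd (mask j : ℝ) * x j)) i)

/-! ### Averaging-hard attention -/

/-- The positions of `V` at which the score is maximal. -/
def argmaxSet {ι : Type} (V : Finset ι) (score : ι → ℝ) : Finset ι :=
  V.filter fun j => ∀ j' ∈ V, score j' ≤ score j

open Classical in
/-- Averaging-hard attention weights: the weight is split uniformly across the positions of `V`
with maximal score. -/
def hardWeight {ι : Type} (V : Finset ι) (score : ι → ℝ) (j : ι) : ℝ :=
  if j ∈ argmaxSet V score then 1 / ((argmaxSet V score).card : ℝ) else 0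

/-- The hard attention weights are the limits of the softmax weights at temperature `τ → 0`. -/
theorem tendsto_softmax_hardWeight {ι : Type} (V : Finset ι) (score : ι → ℝ) {j : ι}
    (hj : j ∈ V) :
    Filter.Tendsto
      (fun τ : ℝ => Real.exp (1 / τ * score j) / ∑ k ∈ V, Real.exp (1 / τ * score k))
      (nhdsWithin 0 (Set.Ioi 0)) (nhds (hardWeight V score j)) := by
  classical
  obtain ⟨b, hb, hmax⟩ := V.exists_max_image score ⟨j, hj⟩
  have mem : ∀ k ∈ V, (k ∈ argmaxSet V score ↔ score k = score b) := by
    intro k hk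
    simp only [argmaxSet, Finset.mem_filter, hk, true_and]
    exact ⟨fun h => le_antisymm (hmax k hk) (h b hb), fun h k' hk' => h ▸ hmax k' hk'⟩
  have term : ∀ k ∈ V, Filter.Tendsto (fun τ : ℝ => Real.exp (1 / τ * (score k - score b)))
      (nhdsWithin 0 (Set.Ioi 0)) (nhds (if k ∈ argmaxSet V score then 1 else 0)) := by
    intro k hk
    by_cases h : score k = score b
    · simp [(mem k hk).2 h, h]
    · rw [if_neg (fun h' => h ((mem k hk).1 h'))]
      have hlt : score k - score b < 0 := sub_neg.2 (lt_of_le_of_ne (hmax k hk) h)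
      refine Real.tendsto_exp_atBot.comp ?_
      simp only [one_div]
      exact tendsto_inv_nhdsGT_zero.atTop_mul_const_of_neg hlt
  have sum := tendsto_finsetSum V term
  have hcard : (∑ k ∈ V, if k ∈ argmaxSet V score then (1 : ℝ) else 0)
      = ((argmaxSet V score).card : ℝ) := by
    rw [← Finset.sum_filter, Finset.sum_const, nsmul_eq_mul, mul_one]
    congr 2
    ext k
    simp only [Finset.mem_filter, argmaxSet]
    tauto
  rw [hcard] at sum
  have hpos : ((argmaxSet V score).card : ℝ) ≠ 0 :=
    Nat.cast_ne_zero.2 (Finset.card_ne_zero_of_mem ((mem b hb).2 rfl))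
  have key := (term j hj).div sum hpos
  have hval : (if j ∈ argmaxSet V score then (1 : ℝ) else 0) / ((argmaxSet V score).card : ℝ)
      = hardWeight V score j := by
    unfold hardWeight
    split_ifs <;> simp
  rw [hval] at key
  refine key.congr fun τ => ?_
  have e : ∀ k, Real.exp (1 / τ * score k)
      = Real.exp (1 / τ * (score k - score b)) * Real.exp (1 / τ * score b) := by
    intro k
    rw [← Real.exp_add]
    ring_nf
  rw [e j, Finset.sum_congr rfl fun k _ => e k, ← Finset.sum_mul,
    mul_div_mul_right _ _ (Real.exp_ne_zero _)]
  rfl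

/-- An attention head reading `ℝ^m` and producing `ℝ^d`, causally masked or unmasked. -/
structure AttentionHead (m d : ℕ) where
  causal : Bool
  Q : Matrix (Fin d) (Fin m) ℚ
  K : Matrix (Fin d) (Fin m) ℚ
  V : Matrix (Fin d) (Fin m) ℚ

/-- The positions that position `i` may attend to. -/
def AttentionHead.visible {m d : ℕ} (H : AttentionHead m d) {N : ℕ} (i : Fin N) :
    Finset (Fin N) :=
  Finset.univ.filter fun j => H.causal = true → j ≤ i

/-- The output of a head at position `i`. Scores, weights and weighted values are rounded, and the
sum over the positions is rounded as one operation of variable arity. -/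
def AttentionHead.eval (rnd : ℝ → ℝ) {m d : ℕ} (H : AttentionHead m d) {N : ℕ}
    (z : Fin N → Fin m → ℝ) (i : Fin N) : Fin d → ℝ :=
  let score : Fin N → ℝ := fun j => dot rnd (applyMat rnd H.Q (z i)) (applyMat rnd H.K (z j))
  fun c => rnd (∑ j ∈ H.visible i,
    rnd (rnd (hardWeight (H.visible i) score j) * applyMat rnd H.V (z j) c))

/-! ### Layers -/

/-- A self-attention sublayer with `h` heads and model dimension `h * d`. -/
structure AttentionSublayer (h d : ℕ) where
  mask : Fin (h * d) → ℚ
  head : Fin h → AttentionHead (h * d) d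
  W : Matrix (Fin (h * d)) (Fin (h * d)) ℚ

/-- The concatenation of the outputs of `h` heads. -/
def concatHeads {h d : ℕ} (a : Fin h → Fin d → ℝ) : Fin (h * d) → ℝ :=
  fun r => a (finProdFinEquiv.symm r).1 (finProdFinEquiv.symm r).2

/-- Update of the residual stream by a self-attention sublayer. -/
def AttentionSublayer.eval (rnd : ℝ → ℝ) (ν : NormKind) {h d : ℕ} (A : AttentionSublayer h d)
    {N : ℕ} (x : Fin N → Fin (h * d) → ℝ) : Fin N → Fin (h * d) → ℝ :=
  let z : Fin N → Fin (h * d) → ℝ := fun j => maskedNorm rnd ν A.mask (x j)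
  fun i c => rnd (x i c +
    applyMat rnd A.W (concatHeads fun k => (A.head k).eval rnd z i) c)

/-- A feedforward sublayer of width `w`. -/
structure FeedforwardSublayer (m w : ℕ) where
  mask : Fin m → ℚ
  W : Matrix (Fin w) (Fin m) ℚ
  U : Matrix (Fin m) (Fin w) ℚ

/-- Update of the residual stream by a feedforward sublayer: `δ = U · ReLU (W z)`. -/
def FeedforwardSublayer.eval (rnd : ℝ → ℝ) (ν : NormKind) {m w : ℕ}
    (F : FeedforwardSublayer m w) {N : ℕ} (x : Fin N → Fin m → ℝ) : Fin N → Fin m → ℝ :=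
  fun i c => rnd (x i c +
    applyMat rnd F.U
      (fun k => rnd (max 0 (applyMat rnd F.W (maskedNorm rnd ν F.mask (x i)) k))) c)

/-- A transformer layer: a self-attention sublayer followed by a feedforward sublayer. -/
structure Layer (h d w : ℕ) where
  attention : AttentionSublayer h d
  feedforward : FeedforwardSublayer (h * d) w

/-- Update of the residual stream by a layer. -/
def Layer.eval (rnd : ℝ → ℝ) (ν : NormKind) {h d w : ℕ} (L : Layer h d w) {N : ℕ}
    (x : Fin N → Fin (h * d) → ℝ) : Fin N → Fin (h * d) → ℝ :=
  L.feedforward.eval rnd ν (L.attention.eval rnd ν x)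

/-! ### Universal transformers -/

/-- An `(s, r, t)`-universal transformer over the alphabet `α` with `h` heads, model dimension
`h * d` and feedforward width `w`. -/
structure UniversalTransformer (α : Type) (s r t h d w : ℕ) where
  embed : α → Fin (h * d) → ℚ
  pos : ℕ → Fin (h * d) → ℚ
  initial : Fin s → Layer h d w
  repeated : Fin r → Layer h d w
  final : Fin t → Layer h d w
  unembed : α → Fin (h * d) → ℚ

namespace UniversalTransformer

variable {α : Type} {s r t h d w : ℕ}

/-- The layers in order, the repeated block being unrolled `D` times. -/
def layers (T : UniversalTransformer α s r t h d w) (D : ℕ) : List (Layer h d w) :=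
  List.ofFn T.initial ++ (List.replicate D (List.ofFn T.repeated)).flatten ++ List.ofFn T.final

/-- The initial residual stream; positions are numbered from `1`. -/
def start (rnd : ℝ → ℝ) (T : UniversalTransformer α s r t h d w) (u : List α) :
    Fin u.length → Fin (h * d) → ℝ :=
  fun i c => rnd (rnd (T.embed (u.get i) c : ℝ) + rnd (T.pos (i + 1) c : ℝ))

/-- The residual stream after the last layer. -/
def run (rnd : ℝ → ℝ) (ν : NormKind) (T : UniversalTransformer α s r t h d w) (D : ℕ)
    (u : List α) : Fin u.length → Fin (h * d) → ℝ :=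
  (T.layers D).foldl (fun x L => L.eval rnd ν x) (T.start rnd u)

/-- `y` is the token that `T`, unrolled `D` times, outputs on `u`: at the last position,
it has the maximum score, strictly above all the other tokens. -/
def Outputs (rnd : ℝ → ℝ) (ν : NormKind) (T : UniversalTransformer α s r t h d w) (D : ℕ)
    (u : List α) (y : α) : Prop :=
  ∃ i : Fin u.length, (i : ℕ) + 1 = u.length ∧ ∀ y' : α, y' ≠ y →
    dot rnd (T.run rnd ν D u i) (fun c => rnd (T.unembed y' c : ℝ)) <
      dot rnd (T.run rnd ν D u i) (fun c => rnd (T.unembed y c : ℝ))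

/-- `T` has a head with the given kind of masking (`true` for causal, `false` for unmasked). -/
def HasHead (T : UniversalTransformer α s r t h d w) (causal : Bool) : Prop :=
  ∃ L ∈ T.layers 1, ∃ k, (L.attention.head k).causal = causal

end UniversalTransformer

/-! ### The graph connectivity problem -/

/-- The alphabet: beginning of sequence, the two bits, padding, the unary marks `a` and `b` for
the source and the target, and the special output token `accept`. -/
inductive Token
  | bos
  | zero
  | one
  | pad
  | a
  | b
  | accept

open Classical in
/-- The input word: a beginning-of-sequence symbol, the adjacency matrix row by row, `n ^ 3`
padding tokens, and the source and the target in unary. The vertex `v : Fin n` has number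
`v + 1` in `{1, …, n}`. -/
def encode {n : ℕ} (adj : Fin n → Fin n → Prop) (s t : Fin n) : List Token :=
  Token.bos ::
    ((List.finRange n).flatMap (fun i =>
        (List.finRange n).map fun j => if adj i j then Token.one else Token.zero) ++
      List.replicate (n ^ 3) Token.pad ++
      List.replicate (s + 1) Token.a ++
      List.replicate (t + 1) Token.b)

/-- Evaluated on the encoded instance in the `p`-bit datatype, with the repeated layers unrolled
`⌈log₂ n⌉` times, `T` produces an output token, and this is `accept` exactly if `answer` holds. -/
def Decides (D : Datatype) (p : ℕ) (ν : NormKind) {s r t h d w : ℕ}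
    (T : UniversalTransformer Token s r t h d w) {n : ℕ} (adj : Fin n → Fin n → Prop)
    (src tgt : Fin n) (answer : Prop) : Prop :=
  ∃ y : Token, T.Outputs (D.round p) ν (Nat.clog 2 n) (encode adj src tgt) y ∧
    (y = Token.accept ↔ answer)

end LoopedTransformer

end

open LoopedTransformer

noncomputable section

namespace LoopedTransformer

/-! ### Rounding error of the elementary operations -/

/-! Reachability is computed by repeated squaring. The bit tokens hold a reflexive relation on the
vertices, initially the adjacency matrix with the diagonal added. The padding token with index `(a,
m, c)` looks up the bits `(a, m)` and `(m, c)`; then the bit `(a, c)` asks whether some padding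
token `(a, m, c)` found both of them set. One pass of the block thus turns "path of length at most
`k`" into "path of length at most `2k`" (`Inst.next_bitPos`, `Inst.iter_bitPos`), and `⌈log₂ n⌉`
passes suffice (`within_iff_reflTransGen`).

Addresses are compared without positional encodings. A number `x` is stored as its hash, the unit
vector in the direction `(x, 1)`. The norm computes it from `(r x, r)` for any `r > 0`, so averages,
which are counts divided by an unknown length, are good enough. Equal numbers have hashes with inner
product `1`; for the numbers that occur, unequal ones fall short of `1` by at least a multiple of
`N⁻⁶` (`hash_dot_le`). A head tests whether a match exists by making BoS the default: BoS scores
less than a match by `thr`, of order `N⁻⁸`, hence more than any mismatch, and the head reports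
whether it landed on BoS (`Inst.attends_exists`). Divisibility of `i - 1` by `n` and by `n ^ 2` is
tested in this way, comparing the hash of the rational quotient with the hashes of the positions.
Causal counts of these flags give quotients and remainders, hence all the addresses.

For the precision, every named value is stored with both signs, so that layer-norm and RMS norm
agree in exact arithmetic. An error is multiplied in each sublayer by at most a constant over a
lower bound `ρ` of the norm. Hard attention is discontinuous, but the exact scores have a margin of
`N⁻¹⁶` that small errors cannot bridge (`HeadSpec.eval_sub_le`). The initial layers are fixed in
number, with `ρ = N⁻⁶`; in the loop `ρ = 1`, so each pass costs a constant factor and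
logarithmically many passes cost a power of `N`. The total error is polynomial in `N` times the
rounding unit (`TransformerSpec.outputs_of_steps`), and `p ≥ c log N` makes the latter smaller than
any prescribed power of `N⁻¹` (`Datatype.IsPrecise.exists_isRounding`). -/

/-- `rnd` fixes `0` and moves the reals of absolute value at most `X` by at most `η`. -/
structure IsRounding (rnd : ℝ → ℝ) (η X : ℝ) : Prop where
  zero : rnd 0 = 0
  nonneg : 0 ≤ η
  le_one : η ≤ 1
  approx : ∀ x, |x| ≤ X → |rnd x - x| ≤ η

namespace IsRounding

variable {rnd : ℝ → ℝ} {η X : ℝ}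

theorem sub_le (h : IsRounding rnd η X) {x y δ : ℝ} (hx : |x| ≤ X) (hxy : |x - y| ≤ δ) :
    |rnd x - y| ≤ δ + η := by
  have := h.approx x hx
  have := abs_sub_le (rnd x) x y
  linarith

theorem abs_le (h : IsRounding rnd η X) {x A : ℝ} (hx : |x| ≤ X) (hA : |x| ≤ A) :
    |rnd x| ≤ A + 1 := by
  have := h.sub_le (y := 0) hx (by simpa using hA)
  rw [sub_zero] at this
  linarith [h.le_one]

/-- Each step rounds one product and one sum, which costs at most `2η`. The summand `2` in `k * (A +
2)` keeps the perturbed partial sums inside the range where rounding is accurate. -/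
theorem dot_sub_le (h : IsRounding rnd η X) : ∀ {k : ℕ} (x y : Fin k → ℝ) {A : ℝ},
    0 ≤ A → (∀ i, |x i * y i| ≤ A) → k * (A + 2) ≤ X →
    |dot rnd x y - ∑ i, x i * y i| ≤ 2 * k * η := by
  intro k
  induction k with
  | zero => intro x y A _ _ _; simp [dot]
  | succ k ih =>
    intro x y A hA hxy hX
    have hη := h.le_one
    have hη0 := h.nonneg
    push_cast at hX ⊢
    have hk : (0 : ℝ) ≤ k := Nat.cast_nonneg k
    have hkA : 0 ≤ (k : ℝ) * A := mul_nonneg hk hA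
    have ih' := ih (fun i => x i.castSucc) (fun i => y i.castSucc) hA (fun i => hxy _)
      (by nlinarith)
    rw [Fin.sum_univ_castSucc]
    have e : dot rnd x y = rnd (dot rnd (fun i => x i.castSucc) (fun i => y i.castSucc)
        + rnd (x (Fin.last k) * y (Fin.last k))) := by
      simp only [dot, Fin.foldl_succ_last]
    rw [e]
    have hs : |∑ i : Fin k, x i.castSucc * y i.castSucc| ≤ k * A := by
      refine (Finset.abs_sum_le_sum_abs _ _).trans ?_
      refine (Finset.sum_le_sum fun i _ => hxy i.castSucc).trans ?_
      simp
    have hl := hxy (Fin.last k)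
    have hr := h.approx _ (hl.trans (by nlinarith : A ≤ X))
    generalize dot rnd (fun i => x i.castSucc) (fun i => y i.castSucc) = d at *
    generalize ∑ i : Fin k, x i.castSucc * y i.castSucc = S at *
    generalize x (Fin.last k) * y (Fin.last k) = p at *
    generalize rnd p = q at *
    have hkη : (k : ℝ) * η ≤ k := by nlinarith
    have hb : |(d + q) - (S + p)| ≤ 2 * k * η + η := by
      have : (d + q) - (S + p) = (d - S) + (q - p) := by ring
      rw [this]
      exact (abs_add_le _ _).trans (add_le_add ih' hr)
    have hdq : |d + q| ≤ X := by
      have h1 := abs_add_le ((d + q) - (S + p)) (S + p)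
      have h2 := abs_add_le S p
      rw [sub_add_cancel] at h1
      nlinarith
    have := h.sub_le hdq hb
    linarith

end IsRounding

/-- The constant is fixed before the rounding map: it depends only on the matrix and the size of the
input. All the later error bounds have this uniformity, which makes the final threshold independent
of the instance. -/
theorem applyMat_sub_le {a k : ℕ} (M : Matrix (Fin a) (Fin k) ℚ) (A : ℝ) :
    ∃ C, 1 ≤ C ∧ ∀ {rnd : ℝ → ℝ} {η X : ℝ}, IsRounding rnd η X → C ≤ X →
      ∀ (x y : Fin k → ℝ) (δ : ℝ), 0 ≤ δ → (∀ i, |x i| ≤ A) → (∀ i, |x i - y i| ≤ δ) →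
        ∀ r, |applyMat rnd M x r - ∑ j, (M r j : ℝ) * y j| ≤ C * (δ + η) := by
  set S : ℝ := ∑ r, ∑ j, |(M r j : ℝ)| with hS
  have hS0 : 0 ≤ S := by positivity
  have hMS : ∀ r, ∑ j, |(M r j : ℝ)| ≤ S := fun r =>
    Finset.single_le_sum (f := fun r => ∑ j, |(M r j : ℝ)|) (fun _ _ => by positivity)
      (Finset.mem_univ r)
  have hM : ∀ r j, |(M r j : ℝ)| ≤ S := fun r j =>
    (Finset.single_le_sum (f := fun j => |(M r j : ℝ)|) (fun _ _ => by positivity)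
      (Finset.mem_univ j)).trans (hMS r)
  refine ⟨1 + 2 * k + k * |A| + S + k * ((S + 1) * |A| + 2), ?_, ?_⟩
  · have : 0 ≤ |A| := abs_nonneg A
    have : 0 ≤ 2 * (k : ℝ) + k * |A| + S + k * ((S + 1) * |A| + 2) := by positivity
    linarith
  intro rnd η X h hX x y δ hδ hx hxy r
  have hη := h.nonneg
  have hA0 : 0 ≤ |A| := abs_nonneg A
  have hp1 : 0 ≤ (k : ℝ) * |A| := by positivity
  have hp2 : 0 ≤ (k : ℝ) * ((S + 1) * |A| + 2) := by positivity
  have hk : (0 : ℝ) ≤ k := Nat.cast_nonneg k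
  have hx' : ∀ i, |x i| ≤ |A| := fun i => (hx i).trans (le_abs_self A)
  have hr : ∀ j, |rnd (M r j : ℝ) - M r j| ≤ η := fun j =>
    h.approx _ ((hM r j).trans (by linarith))
  have hr' : ∀ j, |rnd (M r j : ℝ)| ≤ S + 1 := fun j =>
    h.abs_le ((hM r j).trans (by linarith)) (hM r j)
  have hd := h.dot_sub_le (fun j => rnd (M r j : ℝ)) x (A := (S + 1) * |A|) (by positivity)
    (fun i => by rw [abs_mul]; exact mul_le_mul (hr' i) (hx' i) (abs_nonneg _) (by linarith))
    (by linarith)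
  have hs : |∑ j, rnd (M r j : ℝ) * x j - ∑ j, (M r j : ℝ) * y j| ≤ k * (η * |A|) + S * δ := by
    rw [← Finset.sum_sub_distrib]
    refine (Finset.abs_sum_le_sum_abs _ _).trans ?_
    have : ∀ j ∈ Finset.univ, |rnd (M r j : ℝ) * x j - (M r j : ℝ) * y j|
        ≤ η * |A| + |(M r j : ℝ)| * δ := by
      intro j _
      have e : rnd (M r j : ℝ) * x j - (M r j : ℝ) * y j
          = (rnd (M r j : ℝ) - M r j) * x j + (M r j : ℝ) * (x j - y j) := by ring
      rw [e]
      refine (abs_add_le _ _).trans ?_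
      rw [abs_mul, abs_mul]
      exact add_le_add (mul_le_mul (hr j) (hx' j) (abs_nonneg _) hη)
        (mul_le_mul_of_nonneg_left (hxy j) (abs_nonneg _))
    refine (Finset.sum_le_sum this).trans ?_
    rw [Finset.sum_add_distrib, Finset.sum_const, Finset.card_univ, Fintype.card_fin,
      nsmul_eq_mul, ← Finset.sum_mul]
    exact add_le_add le_rfl (mul_le_mul_of_nonneg_right (hMS r) hδ)
  have := abs_sub_le (applyMat rnd M x r) (∑ j, rnd (M r j : ℝ) * x j) (∑ j, (M r j : ℝ) * y j)
  have h2 : |applyMat rnd M x r - ∑ j, rnd (M r j : ℝ) * x j| ≤ 2 * k * η := hd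
  have : (1 + 2 * k + k * |A| + S + k * ((S + 1) * |A| + 2)) * (δ + η)
      = (2 * k * η + (k * (η * |A|) + S * δ)) + ((1 + k * ((S + 1) * |A| + 2)) * (δ + η)
        + 2 * k * δ + k * |A| * δ + S * η) := by ring
  have : 0 ≤ ((1 + k * ((S + 1) * |A| + 2)) * (δ + η)
        + 2 * k * δ + k * |A| * δ + S * η) := by positivity
  linarith

/-! ### Stability of the norms -/

theorem mean_sq_eq {m : ℕ} (x : Fin m → ℝ) :
    √(mean fun j => x j ^ 2) = ‖WithLp.toLp 2 x‖ / √m := by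
  rw [EuclideanSpace.norm_eq, mean, Real.sqrt_div' _ (Nat.cast_nonneg m)]
  simp

theorem abs_le_sqrt_mul_rms {m : ℕ} (x : Fin m → ℝ) (i : Fin m) :
    |x i| ≤ √m * √(mean fun j => x j ^ 2) := by
  have hm : (0 : ℝ) < m := Nat.cast_pos.2 (Fin.pos i)
  rw [mean_sq_eq, mul_div_cancel₀ _ (Real.sqrt_pos.2 hm).ne']
  simpa using PiLp.norm_apply_le (WithLp.toLp 2 x) i

theorem abs_rms_sub_le {m : ℕ} (x y : Fin m → ℝ) {δ : ℝ} (hδ : 0 ≤ δ)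
    (h : ∀ i, |x i - y i| ≤ δ) :
    |√(mean fun j => x j ^ 2) - √(mean fun j => y j ^ 2)| ≤ δ := by
  rw [mean_sq_eq, mean_sq_eq, ← sub_div, abs_div, abs_of_nonneg (Real.sqrt_nonneg _)]
  refine div_le_of_le_mul₀ (Real.sqrt_nonneg _) hδ ?_
  refine (abs_norm_sub_norm_le _ _).trans ?_
  rw [← WithLp.toLp_sub, EuclideanSpace.norm_eq]
  refine Real.sqrt_le_iff.2 ⟨by positivity, ?_⟩
  rw [mul_pow, Real.sq_sqrt (Nat.cast_nonneg m)]
  refine (Finset.sum_le_sum (g := fun _ => δ ^ 2) fun i _ => ?_).trans (by simp [mul_comm])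
  simp only [Pi.sub_apply, Real.norm_eq_abs]
  gcongr
  exact h i

/-- Only the norm `R` of the exact vector needs a lower bound: in `(x i / r - y i / R) * R = (x i -
y i) + x i / r * (R - r)` the quotient `x i / r` never exceeds `√m`. -/
theorem div_rms_sub_le {m : ℕ} (x y : Fin m → ℝ) {δ ρ : ℝ} (hδ : 0 ≤ δ) (hρ : 0 < ρ)
    (h : ∀ i, |x i - y i| ≤ δ) (hy : ρ ≤ √(mean fun j => y j ^ 2)) (i : Fin m) :
    |x i / √(mean fun j => x j ^ 2) - y i / √(mean fun j => y j ^ 2)| ≤ (1 + √m) * δ / ρ := by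
  have hd := abs_rms_sub_le x y hδ h
  have hxi := abs_le_sqrt_mul_rms x i
  have hr0 : 0 ≤ √(mean fun j => x j ^ 2) := Real.sqrt_nonneg _
  generalize √(mean fun j => x j ^ 2) = r at *
  generalize √(mean fun j => y j ^ 2) = R at *
  have hR : 0 < R := hρ.trans_le hy
  have key : |x i / r - y i / R| ≤ (1 + √m) * δ / R := by
    rw [le_div_iff₀ hR, ← abs_of_pos hR, ← abs_mul, abs_of_pos hR]
    have e : (x i / r - y i / R) * R = (x i - y i) + x i / r * (R - r) := by
      rcases hr0.eq_or_lt with h0 | h0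
      · subst h0
        have : x i = 0 := by simpa using hxi
        rw [this]; field_simp; ring
      · field_simp; ring
    rw [e]
    have hq : |x i / r| ≤ √m := by
      rw [abs_div, abs_of_nonneg hr0]
      exact div_le_of_le_mul₀ hr0 (Real.sqrt_nonneg _) hxi
    refine (abs_add_le _ _).trans ?_
    rw [abs_mul, add_mul, one_mul]
    refine add_le_add (h i) (mul_le_mul hq ?_ (abs_nonneg _) (Real.sqrt_nonneg _))
    rwa [abs_sub_comm]
  refine key.trans ?_
  gcongr

theorem abs_div_rms_le {m : ℕ} (x : Fin m → ℝ) (i : Fin m) :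
    |x i / √(mean fun j => x j ^ 2)| ≤ √m := by
  rw [abs_div, abs_of_nonneg (Real.sqrt_nonneg _)]
  exact div_le_of_le_mul₀ (Real.sqrt_nonneg _) (Real.sqrt_nonneg _) (abs_le_sqrt_mul_rms x i)

theorem NormKind.abs_apply_le (ν : NormKind) {m : ℕ} (x : Fin m → ℝ) (i : Fin m) :
    |ν.apply x i| ≤ √m := by
  cases ν
  · exact abs_div_rms_le (fun j => x j - mean x) i
  · exact abs_div_rms_le x i

theorem abs_mean_le {m : ℕ} (x : Fin m → ℝ) {δ : ℝ} (hδ : 0 ≤ δ) (h : ∀ i, |x i| ≤ δ) :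
    |mean x| ≤ δ := by
  rw [mean, abs_div, Nat.abs_cast]
  refine div_le_of_le_mul₀ (Nat.cast_nonneg m) hδ ((Finset.abs_sum_le_sum_abs _ _).trans ?_)
  refine (Finset.sum_le_sum fun i _ => h i).trans ?_
  simp [mul_comm]

/-- Both norms are close to the root-mean-square normalization of a nearby vector of mean `0`. -/
theorem NormKind.apply_sub_le (ν : NormKind) {m : ℕ} (x y : Fin m → ℝ) {δ ρ : ℝ} (hδ : 0 ≤ δ)
    (hρ : 0 < ρ) (h : ∀ i, |x i - y i| ≤ δ) (hy0 : ∑ i, y i = 0)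
    (hy : ρ ≤ √(mean fun j => y j ^ 2)) (i : Fin m) :
    |ν.apply x i - y i / √(mean fun j => y j ^ 2)| ≤ (1 + √m) * (2 * δ) / ρ := by
  cases ν
  · refine div_rms_sub_le (fun j => x j - mean x) y (by positivity) hρ (fun j => ?_) hy i
    -- Since `y` has mean zero, centering `x` moves it by at most `δ` more, which accounts for the
    -- factor `2 * δ`.
    have hm : |mean x| ≤ δ := by
      have : mean x = mean fun i => x i - y i := by
        simp [mean, Finset.sum_sub_distrib, hy0]
      rw [this]
      exact abs_mean_le _ hδ h
    have e : x j - mean x - y j = (x j - y j) - mean x := by ring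
    rw [e]
    exact (abs_sub _ _).trans (by linarith [h j])
  · refine (div_rms_sub_le x y hδ hρ h hy i).trans ?_
    gcongr
    linarith

/-! ### Named coordinates of the residual stream

Each named coordinate `c : κ` is stored twice, with both signs, so that all the vectors that are
normalized have mean zero. -/

/-- Sparse rational linear forms in the named coordinates. -/
abbrev Lin (κ : Type) := List (κ × ℚ)

namespace Lin

variable {κ : Type}

def eval (l : Lin κ) (z : κ → ℝ) : ℝ := (l.map fun p => (p.2 : ℝ) * z p.1).sum

@[simp] theorem eval_nil (z : κ → ℝ) : eval [] z = 0 := rfl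

@[simp] theorem eval_cons (p : κ × ℚ) (l : Lin κ) (z : κ → ℝ) :
    eval (p :: l) z = p.2 * z p.1 + eval l z := by simp [eval]

variable [DecidableEq κ]

def coef (l : Lin κ) (c : κ) : ℚ := (l.map fun p => if p.1 = c then p.2 else 0).sum

@[simp] theorem coef_nil (c : κ) : coef [] c = 0 := rfl

@[simp] theorem coef_cons (p : κ × ℚ) (l : Lin κ) (c : κ) :
    coef (p :: l) c = (if p.1 = c then p.2 else 0) + coef l c := by simp [coef]

theorem sum_coef_mul [Fintype κ] (l : Lin κ) (z : κ → ℝ) :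
    ∑ c, (coef l c : ℝ) * z c = eval l z := by
  induction l with
  | nil => simp
  | cons p l ih => simp [add_mul, Finset.sum_add_distrib, ih, apply_ite (Rat.cast : ℚ → ℝ)]

end Lin

section Coordinates

variable (κ : Type) [Fintype κ]

/-- The number of heads; it is chosen such that the model dimension is twice a square. -/
abbrev headCount : ℕ := Fintype.card κ

abbrev headDim : ℕ := Fintype.card (κ × Bool)

abbrev modelDim : ℕ := headCount κ * headDim κ

/-- The residual stream consists of `|κ|` blocks indexed by `κ × Bool`. Only block `0` holds data;
the others merely enlarge the dimension, and nothing is ever assumed about their contents. -/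
def coordEquiv : Fin (modelDim κ) ≃ Fin (headCount κ) × (κ × Bool) :=
  finProdFinEquiv.symm.trans (Equiv.prodCongr (Equiv.refl _) (Fintype.equivFin _).symm)

variable {κ}

def sign (b : Bool) : ℚ := if b then 1 else -1

/-- The residual vector with the given values of the named coordinates. -/
def lift (f : κ → ℝ) (r : Fin (modelDim κ)) : ℝ :=
  if ((coordEquiv κ r).1 : ℕ) = 0 then sign (coordEquiv κ r).2.2 * f (coordEquiv κ r).2.1 else 0

theorem abs_lift_le (f : κ → ℝ) {A : ℝ} (hf : ∀ c, |f c| ≤ A) (r : Fin (modelDim κ))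
    (hr : ((coordEquiv κ r).1 : ℕ) = 0) : |lift f r| ≤ A := by
  rw [lift, if_pos hr, abs_mul]
  have : |(sign (coordEquiv κ r).2.2 : ℝ)| = 1 := by
    unfold sign; split_ifs <;> simp
  rw [this, one_mul]
  exact hf _

theorem sum_ite_coord [Nonempty κ] (φ : κ × Bool → ℝ) :
    ∑ r, (if ((coordEquiv κ r).1 : ℕ) = 0 then φ (coordEquiv κ r).2 else 0) = ∑ p, φ p := by
  rw [(coordEquiv κ).sum_comp fun q => if (q.1 : ℕ) = 0 then φ q.2 else 0,
    Fintype.sum_prod_type, Finset.sum_eq_single ⟨0, Fintype.card_pos⟩]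
  · simp
  · intro b _ hb
    have : (b : ℕ) ≠ 0 := fun h => hb (Fin.ext h)
    simp [this]
  · simp

theorem sum_lift [Nonempty κ] (f : κ → ℝ) : ∑ r, lift f r = 0 := by
  have := sum_ite_coord (κ := κ) fun p => sign p.2 * f p.1
  simp only [lift]
  rw [this, Fintype.sum_prod_type]
  simp [sign]

/-- The mean square is `2‖f‖² / (2|κ|²)`. With the dimension twice a square, normalizing introduces
the rational factor `|κ|`, which the rational entries of `row` cancel. -/
theorem rms_lift [Nonempty κ] (f : κ → ℝ) :
    √(mean fun r => lift f r ^ 2) = √(∑ c, f c ^ 2) / Fintype.card κ := by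
  have hs : (0 : ℝ) < Fintype.card κ := Nat.cast_pos.2 Fintype.card_pos
  have h1 : ∑ r, lift f r ^ 2 = 2 * ∑ c, f c ^ 2 := by
    have := sum_ite_coord (κ := κ) fun p => (sign p.2 * f p.1) ^ 2
    simp only [lift, ite_pow, ne_eq, OfNat.ofNat_ne_zero, not_false_eq_true, zero_pow]
    rw [this, Fintype.sum_prod_type, Finset.mul_sum]
    simp [sign, two_mul]
  have h2 : (mean fun r => lift f r ^ 2) = (∑ c, f c ^ 2) / (Fintype.card κ : ℝ) ^ 2 := by
    rw [mean, h1]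
    simp only [modelDim, headCount, headDim, Fintype.card_prod, Fintype.card_bool]
    push_cast
    field_simp
  rw [h2, Real.sqrt_div' _ (by positivity), Real.sqrt_sq hs.le]

variable [DecidableEq κ]

/-- The row that evaluates the linear form `l / |κ|`. -/
def row (l : Lin κ) (r : Fin (modelDim κ)) : ℚ :=
  if ((coordEquiv κ r).1 : ℕ) = 0 then
    (if (coordEquiv κ r).2.2 then l.coef (coordEquiv κ r).2.1 / Fintype.card κ else 0) else 0

theorem sum_row_mul_lift [Nonempty κ] (l : Lin κ) (f : κ → ℝ) :
    ∑ r, (row l r : ℝ) * lift f r = l.eval f / Fintype.card κ := by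
  have := sum_ite_coord (κ := κ)
    fun p => (if p.2 then (l.coef p.1 : ℝ) / Fintype.card κ * f p.1 else 0)
  rw [Fintype.sum_prod_type] at this
  simp only [Fintype.sum_bool, if_true, Bool.false_eq_true, if_false, add_zero] at this
  rw [← Lin.sum_coef_mul, Finset.sum_div]
  refine (Finset.sum_congr rfl fun r _ => ?_).trans (this.trans ?_)
  · unfold row lift
    split_ifs with h1 h2 <;> simp_all [sign]
  · exact Finset.sum_congr rfl fun c _ => by ring

theorem sum_row_mul [Nonempty κ] (l : Lin κ) (f : κ → ℝ) :
    ∑ r, (row l r : ℝ) * (Fintype.card κ * lift f r) = l.eval f := by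
  have h := sum_row_mul_lift l f
  have hs : (Fintype.card κ : ℝ) ≠ 0 := Nat.cast_ne_zero.2 Fintype.card_ne_zero
  rw [eq_div_iff hs, Finset.sum_mul] at h
  rw [← h]
  exact Finset.sum_congr rfl fun j _ => by ring

/-- The column that adds multiples of the linear form `l` to the residual stream. -/
def column (l : Lin κ) (r : Fin (modelDim κ)) : ℚ :=
  if ((coordEquiv κ r).1 : ℕ) = 0 then sign (coordEquiv κ r).2.2 * l.coef (coordEquiv κ r).2.1
  else 0

def maskOf (S : List κ) (r : Fin (modelDim κ)) : ℚ :=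
  if ((coordEquiv κ r).1 : ℕ) = 0 ∧ (coordEquiv κ r).2.1 ∈ S then 1 else 0

/-- The Euclidean norm of the masked vector. -/
def nrm (S : List κ) (f : κ → ℝ) : ℝ := √((S.map fun c => f c ^ 2).sum)

/-- The masked vector, scaled to norm `1`. -/
def unit (S : List κ) (f : κ → ℝ) (c : κ) : ℝ := if c ∈ S then f c / nrm S f else 0

/-- The residual vector `x` holds the values `f`, up to an error of `ε`. -/
def Approx (ε : ℝ) (x : Fin (modelDim κ) → ℝ) (f : κ → ℝ) : Prop :=
  ∀ r, ((coordEquiv κ r).1 : ℕ) = 0 → |x r - lift f r| ≤ ε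

theorem sum_mask_sq {S : List κ} (hS : S.Nodup) (f : κ → ℝ) :
    √(∑ c, (if c ∈ S then f c else 0) ^ 2) = nrm S f := by
  rw [nrm]
  congr 1
  rw [← List.sum_toFinset _ hS, ← Finset.sum_filter_add_sum_filter_not _ (· ∈ S),
    Finset.sum_eq_zero (s := Finset.univ.filter (¬ · ∈ S)), add_zero]
  · refine Finset.sum_congr (by ext; simp) fun c hc => ?_
    rw [if_pos (by simpa using hc)]
  · intro c hc
    rw [if_neg (by simpa using hc)]
    simp

/-- The division by the norm amplifies the error by `1 / ρ`, whereas the bound on the output itself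
does not involve `ρ`: normalized vectors are bounded anyway. -/
theorem maskedNorm_sub_le [Nonempty κ] (A : ℝ) : ∃ C, 1 ≤ C ∧
    ∀ (ν : NormKind) {rnd : ℝ → ℝ} {η X : ℝ}, IsRounding rnd η X → C ≤ X →
      ∀ {S : List κ}, S.Nodup → ∀ (x : Fin (modelDim κ) → ℝ) (f : κ → ℝ) (ε ρ : ℝ), 0 ≤ ε → ε ≤ 1 →
        0 < ρ → ρ ≤ 1 → Approx ε x f → (∀ c, |f c| ≤ A) → ρ ≤ nrm S f → ∀ r,
        |maskedNorm rnd ν (maskOf S) x r| ≤ C ∧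
        |maskedNorm rnd ν (maskOf S) x r - Fintype.card κ * lift (unit S f) r|
          ≤ C * ((ε + η) / ρ) := by
  set m := modelDim κ
  have hs : (1 : ℝ) ≤ Fintype.card κ := Nat.one_le_cast.2 Fintype.card_pos
  set s : ℝ := (Fintype.card κ : ℝ) with hs_def
  refine ⟨(1 + √m) * (2 * (|A| + 4)) * s + √m + |A| + 6, ?_, ?_⟩
  · have : 0 ≤ (1 + √m) * (2 * (|A| + 4)) * s := by positivity
    have := abs_nonneg A
    have := Real.sqrt_nonneg m
    linarith
  intro ν rnd η X h hX S hS x f ε ρ hε hε1 hρ hρ1 hx hf hn r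
  have hη := h.nonneg
  have hη1 := h.le_one
  have hA := abs_nonneg A
  have hm := Real.sqrt_nonneg m
  have hsm : 0 ≤ (1 + √m) * (2 * (|A| + 4)) * s := by positivity
  set g : κ → ℝ := fun c => if c ∈ S then f c else 0 with hg
  have hlift : ∀ r, ((coordEquiv κ r).1 : ℕ) = 0 → |lift f r| ≤ |A| :=
    abs_lift_le f fun c => (hf c).trans (le_abs_self A)
  set y : Fin m → ℝ := fun r => rnd (rnd (maskOf S r : ℝ) * x r) with hy
  have h1 : ∀ r, |y r - lift g r| ≤ ε + η * (|A| + 3) := by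
    intro r
    by_cases hr : ((coordEquiv κ r).1 : ℕ) = 0 ∧ (coordEquiv κ r).2.1 ∈ S
    · have e1 : lift g r = lift f r := by simp [lift, hg, hr]
      have hx1 : |x r| ≤ |A| + 1 := by
        have h2 := abs_add_le (x r - lift f r) (lift f r)
        rw [sub_add_cancel] at h2
        linarith [hx r hr.1, hlift r hr.1]
      have h2 : |rnd 1 - 1| ≤ η := h.approx 1 (by rw [abs_one]; linarith)
      have h3 : |rnd 1 * x r - lift f r| ≤ ε + η * (|A| + 1) := by
        have e : rnd 1 * x r - lift f r = (x r - lift f r) + (rnd 1 - 1) * x r := by ring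
        rw [e]
        refine (abs_add_le _ _).trans (add_le_add (hx r hr.1) ?_)
        rw [abs_mul]
        exact mul_le_mul h2 hx1 (abs_nonneg _) hη
      have h4 : |rnd 1 * x r| ≤ X := by
        have h2 := abs_add_le (rnd 1 * x r - lift f r) (lift f r)
        rw [sub_add_cancel] at h2
        have : η * (|A| + 1) ≤ 1 * (|A| + 1) := by gcongr
        have : (1 + √m) * (2 * (|A| + 4)) * s ≥ 1 * (2 * (|A| + 4)) * 1 := by gcongr; linarith
        linarith [hlift r hr.1]
      have h5 := h.sub_le h4 h3
      simp only [hy, maskOf, if_pos hr, Rat.cast_one, e1]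
      linarith
    -- Masked coordinates vanish exactly, whatever `x r` is, because `0` is represented exactly.
    · have e1 : lift g r = 0 := by
        simp only [lift, hg]
        split_ifs <;> simp_all
      simp only [hy, maskOf, if_neg hr, Rat.cast_zero, h.zero, zero_mul, e1, sub_zero, abs_zero]
      positivity
  have hrms : √(mean fun r => lift g r ^ 2) = nrm S f / s := by
    rw [rms_lift, sum_mask_sq hS]
  have h2 := ν.apply_sub_le y (lift g) (δ := ε + η * (|A| + 3)) (ρ := ρ / s) (by positivity)
    (by positivity) h1 (sum_lift g) (by rw [hrms]; gcongr) r
  have e2 : lift g r / √(mean fun r => lift g r ^ 2) = s * lift (unit S f) r := by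
    rw [hrms]
    simp only [lift, unit, hg]
    split_ifs <;> first | simp | field_simp
  rw [e2] at h2
  have h3 := ν.abs_apply_le y r
  have e3 : maskedNorm rnd ν (maskOf S) x r = rnd (ν.apply y r) := rfl
  rw [e3]
  refine ⟨(h.abs_le (h3.trans (by linarith)) h3).trans (by linarith), ?_⟩
  refine (h.sub_le (h3.trans (by linarith)) h2).trans ?_
  have e4 : (1 + √m) * (2 * (ε + η * (|A| + 3))) / (ρ / s)
      = (1 + √m) * 2 * s * ((ε + η * (|A| + 3)) / ρ) := by field_simp
  rw [e4]
  have h5 : (ε + η * (|A| + 3)) / ρ ≤ (|A| + 4) * ((ε + η) / ρ) := by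
    rw [← mul_div_assoc]
    gcongr
    nlinarith
  have h6 : η ≤ (ε + η) / ρ := by
    rw [le_div_iff₀ hρ]
    nlinarith
  have h7 : 0 ≤ (ε + η) / ρ := by positivity
  calc _ ≤ (1 + √m) * 2 * s * ((|A| + 4) * ((ε + η) / ρ)) + 1 * ((ε + η) / ρ) := by
        rw [one_mul]; gcongr
    _ ≤ _ := by
        have : ((1 + √m) * (2 * (|A| + 4)) * s + √m + |A| + 6) * ((ε + η) / ρ)
          = (1 + √m) * 2 * s * ((|A| + 4) * ((ε + η) / ρ)) + 1 * ((ε + η) / ρ)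
            + (√m + |A| + 5) * ((ε + η) / ρ) := by ring
        rw [this]
        have : 0 ≤ (√m + |A| + 5) * ((ε + η) / ρ) := by positivity
        linarith

end Coordinates

theorem abs_unit_le {κ : Type} [DecidableEq κ] (S : List κ) (f : κ → ℝ) (c : κ) : |unit S f c| ≤ 1 := by
  unfold unit
  split_ifs with h
  · rw [abs_div, nrm, abs_of_nonneg (Real.sqrt_nonneg _)]
    refine div_le_of_le_mul₀ (Real.sqrt_nonneg _) zero_le_one ?_
    rw [one_mul]
    refine Real.abs_le_sqrt ?_
    exact List.single_le_sum (by simp; intro a _; positivity) _ (List.mem_map_of_mem h)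
  · simp

/-! ### Sublayers described in terms of named coordinates -/

namespace Lin

variable {κ : Type}

/-- The sum of the absolute values of the coefficients. -/
def size (l : Lin κ) : ℝ := (l.map fun p => |(p.2 : ℝ)|).sum

@[simp] theorem size_cons (p : κ × ℚ) (l : Lin κ) : size (p :: l) = |(p.2 : ℝ)| + size l := by
  simp [size]

theorem size_nonneg (l : Lin κ) : 0 ≤ l.size :=
  List.sum_nonneg (by simp only [List.mem_map]; rintro _ ⟨p, -, rfl⟩; positivity)

theorem abs_eval_le (l : Lin κ) {z : κ → ℝ} (hz : ∀ c, |z c| ≤ 1) : |l.eval z| ≤ l.size := by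
  induction l with
  | nil => simp [size]
  | cons p l ih =>
    rw [eval_cons, size_cons]
    refine (abs_add_le _ _).trans (add_le_add ?_ ih)
    rw [abs_mul]
    exact mul_le_of_le_one_right (abs_nonneg _) (hz _)

theorem abs_coef_le [DecidableEq κ] (l : Lin κ) (c : κ) : |(l.coef c : ℝ)| ≤ l.size := by
  induction l with
  | nil => simp [size]
  | cons p l ih =>
    rw [coef_cons, size_cons]
    push_cast
    refine (abs_add_le _ _).trans (add_le_add ?_ ih)
    split_ifs <;> simp

end Lin

theorem sum_getD {α : Type} (φ : α → ℝ) (d : α) (hd : φ d = 0) : ∀ (l : List α) {w : ℕ},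
    l.length ≤ w → ∑ k : Fin w, φ (l.getD k d) = (l.map φ).sum := by
  intro l
  induction l with
  | nil => intro w _; simp [hd]
  | cons a l ih =>
    intro w hw
    obtain ⟨w, rfl⟩ : ∃ v, w = v + 1 := ⟨w - 1, by simp at hw; omega⟩
    rw [Fin.sum_univ_succ]
    simp only [Fin.val_zero, List.getD_cons_zero, Fin.val_succ, List.getD_cons_succ, List.map_cons,
      List.sum_cons]
    rw [ih (by simpa using hw)]

/-- Exact zeros make the scores of a head without queries tie exactly, so that it averages over all
the visible positions. -/
theorem IsRounding.dot_eq_zero {rnd : ℝ → ℝ} {η X : ℝ} (h : IsRounding rnd η X) :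
    ∀ {k : ℕ} (x y : Fin k → ℝ), (∀ i, x i * y i = 0) → dot rnd x y = 0 := by
  intro k
  induction k with
  | zero => intro x y _; simp [dot]
  | succ k ih =>
    intro x y hxy
    have e : dot rnd x y = rnd (dot rnd (fun i => x i.castSucc) (fun i => y i.castSucc)
        + rnd (x (Fin.last k) * y (Fin.last k))) := by
      simp only [dot, Fin.foldl_succ_last]
    rw [e, ih _ _ fun i => hxy _, hxy, h.zero, add_zero, h.zero]

theorem applyMat_bound {a k : ℕ} (M : Matrix (Fin a) (Fin k) ℚ) (A : ℝ) :
    ∃ C, 1 ≤ C ∧ ∀ {rnd : ℝ → ℝ} {η X : ℝ}, IsRounding rnd η X → C ≤ X →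
      ∀ (x : Fin k → ℝ), (∀ i, |x i| ≤ A) → ∀ r, |applyMat rnd M x r| ≤ C ∧
        ∀ (y : Fin k → ℝ) (δ : ℝ), 0 ≤ δ → (∀ i, |x i - y i| ≤ δ) →
          |applyMat rnd M x r - ∑ j, (M r j : ℝ) * y j| ≤ C * (δ + η) := by
  obtain ⟨C, hC, H⟩ := applyMat_sub_le M A
  have hA := abs_nonneg A
  refine ⟨C * (|A| + 1), by nlinarith, fun {rnd η X} h hX x hx r => ?_⟩
  have hη1 := h.le_one
  have hη := h.nonneg
  have hX' : C ≤ _ := le_trans (by nlinarith) hX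
  refine ⟨?_, fun y δ hδ hxy => (H h hX' x y δ hδ hx hxy r).trans ?_⟩
  · have := H h hX' x (fun _ => 0) |A| (abs_nonneg A) hx
      (fun i => by simpa using (hx i).trans (le_abs_self A)) r
    simp only [mul_zero, Finset.sum_const_zero, sub_zero] at this
    refine this.trans ?_
    gcongr
  · have : 0 ≤ δ + η := by positivity
    gcongr
    nlinarith

structure FFSpec (κ : Type) where
  mask : List κ
  /-- Linear forms in the normalized vector, together with what they contribute to the output. -/
  neurons : List (Lin κ × Lin κ)

structure HeadSpec (κ : Type) where
  causal : Bool
  /-- The attention score is the sum of the products of the query and key forms. -/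
  qk : List (Lin κ × Lin κ)
  v : Lin κ
  out : Lin κ

structure AttSpec (κ : Type) where
  mask : List κ
  heads : List (HeadSpec κ)

section Specs

variable {κ : Type} [DecidableEq κ]

/-- The update of the named coordinates in exact arithmetic. -/
def FFSpec.ideal (F : FFSpec κ) (f : κ → ℝ) (c : κ) : ℝ :=
  f c + (F.neurons.map fun p => (p.2.coef c : ℝ) * max 0 (p.1.eval (unit F.mask f))).sum

/-- Normalized entries are at most `1`, so a sublayer adds an amount bounded in terms of its
specification alone. This is what lets the constants of successive sublayers be chosen in advance.
-/
theorem FFSpec.abs_ideal_le (F : FFSpec κ) {f : κ → ℝ} {A : ℝ} (hf : ∀ c, |f c| ≤ A) (c : κ) :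
    |F.ideal f c| ≤ A + (F.neurons.map fun p => p.2.size * p.1.size).sum := by
  refine (abs_add_le _ _).trans (add_le_add (hf c) ?_)
  induction F.neurons with
  | nil => simp
  | cons p l ih =>
    simp only [List.map_cons, List.sum_cons]
    refine (abs_add_le _ _).trans (add_le_add ?_ ih)
    rw [abs_mul]
    refine mul_le_mul (Lin.abs_coef_le _ _) ?_ (abs_nonneg _) (Lin.size_nonneg _)
    rw [abs_of_nonneg (le_max_left _ _)]
    exact max_le (Lin.size_nonneg _)
      ((le_abs_self _).trans (Lin.abs_eval_le _ (abs_unit_le _ _)))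

variable [Fintype κ]

def FFSpec.compile (F : FFSpec κ) (w : ℕ) : FeedforwardSublayer (modelDim κ) w where
  mask := maskOf F.mask
  W k := row (F.neurons.getD k ([], [])).1
  U r k := column (F.neurons.getD k ([], [])).2 r

/-- ReLU is `1`-Lipschitz and the matrices are fixed, so the norm is the only source of the factor
`1 / ρ`. -/
theorem FFSpec.eval_sub_le [Nonempty κ] (F : FFSpec κ) {w : ℕ} (hF : F.mask.Nodup)
    (hw : F.neurons.length ≤ w) (A : ℝ) :
    ∃ C, 1 ≤ C ∧ ∀ (ν : NormKind) {rnd : ℝ → ℝ} {η X : ℝ}, IsRounding rnd η X → C ≤ X →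
      ∀ {N : ℕ} (x : Fin N → Fin (modelDim κ) → ℝ) (f : Fin N → κ → ℝ) (ε ρ : ℝ), 0 ≤ ε → ε ≤ 1 →
        0 < ρ → ρ ≤ 1 → (∀ i, Approx ε (x i) (f i)) → (∀ i c, |f i c| ≤ A) →
        (∀ i, ρ ≤ nrm F.mask (f i)) → ∀ i,
          Approx (C * ((ε + η) / ρ)) ((F.compile w).eval rnd ν x i) (F.ideal (f i)) := by
  obtain ⟨C0, hC0, H0⟩ := maskedNorm_sub_le (κ := κ) A
  obtain ⟨C1, hC1, H1⟩ := applyMat_bound (F.compile w).W C0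
  obtain ⟨C2, hC2, H2⟩ := applyMat_bound (F.compile w).U (C1 + 1)
  have hA := abs_nonneg A
  refine ⟨C0 + C1 + C2 + |A| + 2 + (C2 * (C1 * (C0 + 1) + 2)), ?_, ?_⟩
  · have : 0 ≤ C2 * (C1 * (C0 + 1) + 2) := by positivity
    linarith
  intro ν rnd η X h hX N x f ε ρ hε hε1 hρ hρ1 hx hf hn i r hr
  have hη := h.nonneg
  have hη1 := h.le_one
  have hnn : 0 ≤ C2 * (C1 * (C0 + 1) + 2) := by positivity
  set q := (ε + η) / ρ with hq
  have hq0 : 0 ≤ q := by positivity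
  have hεq : ε + η ≤ q := by
    rw [hq, le_div_iff₀ hρ]; nlinarith
  have hz := H0 ν h (by linarith) hF (x i) (f i) ε ρ hε hε1 hρ hρ1 (hx i) (hf i) (hn i)
  set z := maskedNorm rnd ν (maskOf F.mask) (x i) with hzdef
  have hW : ∀ k, |applyMat rnd (F.compile w).W z k| ≤ C1 ∧
      |applyMat rnd (F.compile w).W z k - (F.neurons.getD k ([], [])).1.eval (unit F.mask (f i))|
        ≤ C1 * (C0 * q + η) := by
    intro k
    obtain ⟨hb, hd⟩ := H1 h (by linarith) z (fun j => (hz j).1) k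
    refine ⟨hb, ?_⟩
    have := hd _ (C0 * q) (by positivity) fun j => (hz j).2
    rwa [show ∑ j, ((F.compile w).W k j : ℝ) * (Fintype.card κ * lift (unit F.mask (f i)) j) = _
      from sum_row_mul _ _] at this
  set a : Fin w → ℝ := fun k => rnd (max 0 (applyMat rnd (F.compile w).W z k)) with ha
  have ha1 : ∀ k, |max 0 (applyMat rnd (F.compile w).W z k)| ≤ C1 := by
    intro k
    rw [abs_of_nonneg (le_max_left _ _)]
    exact max_le (by linarith) ((le_abs_self _).trans (hW k).1)
  have hab : ∀ k, |a k| ≤ C1 + 1 := fun k => h.abs_le ((ha1 k).trans (by linarith)) (ha1 k)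
  have had : ∀ k, |a k - max 0 ((F.neurons.getD k ([], [])).1.eval (unit F.mask (f i)))|
      ≤ C1 * (C0 * q + η) + η := by
    intro k
    refine h.sub_le ((ha1 k).trans (by linarith)) ?_
    refine (abs_max_sub_max_le_max _ _ _ _).trans ?_
    rw [sub_self, abs_zero]
    exact max_le (by positivity) (hW k).2
  obtain ⟨hb, hd⟩ := H2 h (by linarith) a hab r
  have hd := hd _ _ (by positivity) had
  have e : ∑ k : Fin w, ((F.compile w).U r k : ℝ) *
      max 0 ((F.neurons.getD k ([], [])).1.eval (unit F.mask (f i)))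
      = lift (F.ideal (f i)) r - lift (f i) r := by
    have := sum_getD (fun p : Lin κ × Lin κ => (p.2.coef (coordEquiv κ r).2.1 : ℝ) *
      max 0 (p.1.eval (unit F.mask (f i)))) ([], []) (by simp) F.neurons hw
    simp only [lift, if_pos hr, FFSpec.ideal]
    rw [← mul_sub, add_sub_cancel_left, ← this, Finset.mul_sum]
    refine Finset.sum_congr rfl fun k _ => ?_
    simp only [FFSpec.compile, column, if_pos hr]
    push_cast
    ring
  rw [e] at hd
  have hl : |lift (f i) r| ≤ |A| :=
    abs_lift_le _ (fun c => (hf i c).trans (le_abs_self A)) r hr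
  have hxr := hx i r hr
  have hxb : |x i r| ≤ |A| + 1 := by
    have h2 := abs_add_le (x i r - lift (f i) r) (lift (f i) r)
    rw [sub_add_cancel] at h2
    linarith
  have key : |x i r + applyMat rnd (F.compile w).U a r - lift (F.ideal (f i)) r|
      ≤ ε + C2 * (C1 * (C0 * q + η) + η + η) := by
    have e2 : x i r + applyMat rnd (F.compile w).U a r - lift (F.ideal (f i)) r
      = (x i r - lift (f i) r) + (applyMat rnd (F.compile w).U a r
        - (lift (F.ideal (f i)) r - lift (f i) r)) := by ring
    rw [e2]
    exact (abs_add_le _ _).trans (add_le_add hxr hd)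
  have hX' : |x i r + applyMat rnd (F.compile w).U a r| ≤ X :=
    (abs_add_le _ _).trans (by linarith)
  refine (h.sub_le hX' key).trans ?_
  have hηq : η ≤ q := by linarith
  have h1 : C2 * (C1 * (C0 * q + η) + η + η) ≤ C2 * (C1 * (C0 * q + q) + q + q) := by gcongr
  have h2 : C2 * (C1 * (C0 * q + q) + q + q) = (C2 * (C1 * (C0 + 1) + 2)) * q := by ring
  have h3 : 1 * q ≤ (C0 + C1 + C2 + |A| + 2) * q := by gcongr; linarith
  rw [add_mul]
  linarith

/-! ### Attention -/

namespace HeadSpec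

variable {κ : Type}

instance : Inhabited (HeadSpec κ) := ⟨⟨false, [], [], []⟩⟩

def visible (H : HeadSpec κ) {N : ℕ} (i : Fin N) : Finset (Fin N) :=
  Finset.univ.filter fun j => H.causal = true → j ≤ i

def score (H : HeadSpec κ) (g g' : κ → ℝ) : ℝ :=
  (H.qk.map fun p => p.1.eval g * p.2.eval g').sum

/-- In exact arithmetic, the head outputs `o` at position `i`, either as the average of the values
at all the visible positions, or as the common value at the visible positions whose scores are
maximal up to less than `γ`. -/
def Attends (H : HeadSpec κ) (γ : ℝ) {N : ℕ} (g : Fin N → κ → ℝ) (i : Fin N) (o : ℝ) : Prop :=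
  (H.qk = [] ∧ o = (∑ j ∈ H.visible i, H.v.eval (g j)) / (H.visible i).card) ∨
    ∃ j₀ ∈ H.visible i, H.v.eval (g j₀) = o ∧ ∀ j ∈ H.visible i,
      H.v.eval (g j) = o ∨ H.score (g i) (g j) + γ ≤ H.score (g i) (g j₀)

variable [DecidableEq κ] [Fintype κ]

/-- The `r`-th summand of the score occupies component `r` of query and key; the value occupies
component `0`. -/
def compile (H : HeadSpec κ) : AttentionHead (modelDim κ) (headDim κ) where
  causal := H.causal
  Q r := row (H.qk.getD r ([], [])).1
  K r := row (H.qk.getD r ([], [])).2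
  V r c := if (r : ℕ) = 0 then row H.v c else 0

end HeadSpec

theorem sum_hardWeight {ι : Type} {V : Finset ι} (hV : V.Nonempty) (score : ι → ℝ) :
    ∑ j ∈ V, hardWeight V score j = 1 := by
  classical
  obtain ⟨b, hb, hmax⟩ := V.exists_max_image score hV
  have hne : ((argmaxSet V score).card : ℝ) ≠ 0 :=
    Nat.cast_ne_zero.2 (Finset.card_ne_zero_of_mem (a := b) (by simpa [argmaxSet] using ⟨hb, hmax⟩))
  have hsub : argmaxSet V score ⊆ V := Finset.filter_subset _ _
  unfold hardWeight
  rw [← Finset.sum_filter, Finset.filter_mem_eq_inter, Finset.inter_eq_right.2 hsub,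
    Finset.sum_const, nsmul_eq_mul]
  field_simp

theorem hardWeight_nonneg {ι : Type} (V : Finset ι) (score : ι → ℝ) (j : ι) :
    0 ≤ hardWeight V score j := by
  unfold hardWeight
  split_ifs <;> positivity

/-- Positions with the same value as `j₀` may share or steal its weight without changing the output,
so ties and near-ties among them are harmless. -/
theorem sum_hardWeight_mul_eq {ι : Type} {V : Finset ι} {score : ι → ℝ} {v : ι → ℝ} {o : ℝ}
    {j₀ : ι} (hj₀ : j₀ ∈ V) (h : ∀ j ∈ V, v j = o ∨ score j < score j₀) :
    ∑ j ∈ V, hardWeight V score j * v j = o := by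
  have : ∀ j ∈ V, hardWeight V score j * v j = hardWeight V score j * o := by
    intro j hj
    rcases h j hj with h | h
    · rw [h]
    · have : j ∉ argmaxSet V score := by
        intro hm
        exact absurd ((Finset.mem_filter.1 hm).2 j₀ hj₀) (not_le.2 h)
      simp [hardWeight, this]
  rw [Finset.sum_congr rfl this, ← Finset.sum_mul, sum_hardWeight ⟨j₀, hj₀⟩, one_mul]

theorem sum_hardWeight_mul_const {ι : Type} {V : Finset ι} {score : ι → ℝ} (v : ι → ℝ)
    (h : ∀ j ∈ V, ∀ j' ∈ V, score j = score j') :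
    ∑ j ∈ V, hardWeight V score j * v j = (∑ j ∈ V, v j) / V.card := by
  have hV : argmaxSet V score = V :=
    Finset.filter_true_of_mem fun j hj j' hj' => (h j' hj' j hj).le
  rw [Finset.sum_div]
  refine Finset.sum_congr rfl fun j hj => ?_
  simp [hardWeight, hV, hj]
  ring

end Specs

/-- The weights sum to `1`, so the errors of the values do not accumulate. The rounding of up to `N`
weighted values does, and this is how `N * η` enters the error bounds. -/
theorem IsRounding.sum_hardWeight_sub_le {rnd : ℝ → ℝ} {η X : ℝ} (h : IsRounding rnd η X) {N : ℕ}
    {V : Finset (Fin N)} (hV : V.Nonempty) (hN : N * η ≤ 1) (sc a v : Fin N → ℝ) {B δ : ℝ}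
    (hB : 1 ≤ B) (hX : 4 * B + 4 ≤ X) (ha : ∀ j, |a j| ≤ B)
    (hav : ∀ j, |a j - v j| ≤ δ) :
    |rnd (∑ j ∈ V, rnd (rnd (hardWeight V sc j) * a j))| ≤ 2 * B + 3 ∧
    |rnd (∑ j ∈ V, rnd (rnd (hardWeight V sc j) * a j)) - ∑ j ∈ V, hardWeight V sc j * v j|
      ≤ δ + (B + 2) * (N * η) := by
  have hη := h.nonneg
  have hη1 := h.le_one
  set t := hardWeight V sc
  have ht0 : ∀ j, 0 ≤ t j := hardWeight_nonneg V sc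
  have ht : ∑ j ∈ V, t j = 1 := sum_hardWeight hV sc
  have ht1 : ∀ j ∈ V, t j ≤ 1 := fun j hj => ht ▸ Finset.single_le_sum (fun k _ => ht0 k) hj
  have hcard : (V.card : ℝ) ≤ N := by
    simpa using Nat.cast_le (α := ℝ).2 (Finset.card_le_univ V)
  have h1 : ∀ j ∈ V, |rnd (rnd (t j) * a j) - t j * a j| ≤ (B + 1) * η := by
    intro j hj
    have htj : |t j| ≤ 1 := by rw [abs_of_nonneg (ht0 j)]; exact ht1 j hj
    have e1 := h.approx (t j) (htj.trans (by linarith))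
    have e2 := h.abs_le (htj.trans (by linarith)) htj
    have e3 : |rnd (t j) * a j| ≤ X := by
      rw [abs_mul]
      exact (mul_le_mul e2 (ha j) (abs_nonneg _) (by norm_num)).trans (by linarith)
    have e4 : |rnd (t j) * a j - t j * a j| ≤ η * B := by
      rw [← sub_mul, abs_mul]
      exact mul_le_mul e1 (ha j) (abs_nonneg _) hη
    exact (h.sub_le e3 e4).trans (by linarith)
  have h2 : |∑ j ∈ V, rnd (rnd (t j) * a j) - ∑ j ∈ V, t j * a j| ≤ (B + 1) * (N * η) := by
    rw [← Finset.sum_sub_distrib]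
    refine (Finset.abs_sum_le_sum_abs _ _).trans ((Finset.sum_le_sum h1).trans ?_)
    rw [Finset.sum_const, nsmul_eq_mul]
    have : (V.card : ℝ) * ((B + 1) * η) ≤ N * ((B + 1) * η) := by gcongr
    linarith
  have h3 : |∑ j ∈ V, t j * a j| ≤ B := by
    refine (Finset.abs_sum_le_sum_abs _ _).trans ?_
    refine (Finset.sum_le_sum (g := fun j => t j * B) fun j _ => ?_).trans ?_
    · rw [abs_mul, abs_of_nonneg (ht0 j)]
      exact mul_le_mul_of_nonneg_left (ha j) (ht0 j)
    · rw [← Finset.sum_mul, ht, one_mul]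
  have h4 : |∑ j ∈ V, t j * a j - ∑ j ∈ V, t j * v j| ≤ δ := by
    rw [← Finset.sum_sub_distrib]
    refine (Finset.abs_sum_le_sum_abs _ _).trans ?_
    refine (Finset.sum_le_sum (g := fun j => t j * δ) fun j _ => ?_).trans ?_
    · rw [← mul_sub, abs_mul, abs_of_nonneg (ht0 j)]
      exact mul_le_mul_of_nonneg_left (hav j) (ht0 j)
    · rw [← Finset.sum_mul, ht, one_mul]
  generalize ∑ j ∈ V, rnd (rnd (t j) * a j) = s1 at *
  generalize ∑ j ∈ V, t j * a j = s2 at *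
  generalize ∑ j ∈ V, t j * v j = s3 at *
  have hN1 : (1 : ℝ) ≤ N := by
    obtain ⟨j, _⟩ := hV
    exact Nat.one_le_cast.2 (Fin.pos j)
  have h5 : |s1| ≤ 2 * B + 1 := by
    have := abs_add_le (s1 - s2) s2
    rw [sub_add_cancel] at this
    nlinarith
  refine ⟨(h.abs_le (h5.trans (by linarith)) h5).trans (by linarith), ?_⟩
  have h6 : |s1 - s3| ≤ (B + 1) * (N * η) + δ :=
    (abs_sub_le s1 s2 s3).trans (add_le_add h2 h4)
  refine (h.sub_le (h5.trans (by linarith)) h6).trans ?_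
  nlinarith

section Specs

variable {κ : Type} [DecidableEq κ] [Fintype κ] [Nonempty κ]

namespace HeadSpec

theorem score_sub_le (H : HeadSpec κ) (hH : H.qk.length ≤ headDim κ) (A : ℝ) :
    ∃ C, 1 ≤ C ∧ ∀ {rnd : ℝ → ℝ} {η X : ℝ}, IsRounding rnd η X → C ≤ X →
      ∀ (z z' : Fin (modelDim κ) → ℝ) (g g' : κ → ℝ) (δ : ℝ), 0 ≤ δ →
        (∀ r, |z r| ≤ A) → (∀ r, |z' r| ≤ A) → (∀ c, |g' c| ≤ 1) →
        (∀ r, |z r - Fintype.card κ * lift g r| ≤ δ) →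
        (∀ r, |z' r - Fintype.card κ * lift g' r| ≤ δ) →
        |dot rnd (applyMat rnd H.compile.Q z) (applyMat rnd H.compile.K z') - H.score g g'|
          ≤ C * (δ + η) := by
  obtain ⟨C1, hC1, H1⟩ := applyMat_bound H.compile.Q A
  obtain ⟨C2, hC2, H2⟩ := applyMat_bound H.compile.K A
  set S : ℝ := (H.qk.map fun p => p.2.size).sum with hS
  have hSn : ∀ x ∈ H.qk.map fun p => p.2.size, 0 ≤ x := by
    simp only [List.mem_map]
    rintro _ ⟨p, -, rfl⟩
    exact p.2.size_nonneg
  have hS0 : 0 ≤ S := List.sum_nonneg hSn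
  set d : ℝ := (headDim κ : ℝ) with hd
  have hd0 : 0 ≤ d := Nat.cast_nonneg _
  refine ⟨C1 + C2 + d * (C1 * C2 + 2) + 2 * d + d * (C1 * C2 + S * C1), ?_, ?_⟩
  · have : 0 ≤ d * (C1 * C2 + 2) + 2 * d + d * (C1 * C2 + S * C1) := by positivity
    linarith
  intro rnd η X h hX z z' g g' δ hδ hz hz' hg' hzg hzg'
  have hη := h.nonneg
  have hnn : 0 ≤ 2 * d + d * (C1 * C2 + S * C1) := by positivity
  have hnn2 : 0 ≤ d * (C1 * C2 + 2) := by positivity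
  have hQ := H1 h (by linarith) z hz
  have hK := H2 h (by linarith) z' hz'
  set a := applyMat rnd H.compile.Q z
  set b := applyMat rnd H.compile.K z'
  have hab : ∀ r, |a r * b r| ≤ C1 * C2 := fun r => by
    rw [abs_mul]; exact mul_le_mul (hQ r).1 (hK r).1 (abs_nonneg _) (by linarith)
  have h1 := h.dot_sub_le a b (by positivity) hab (by linarith)
  have h2 : |∑ r, a r * b r - H.score g g'| ≤ d * ((C1 * C2 + S * C1) * (δ + η)) := by
    have := sum_getD (fun p : Lin κ × Lin κ => p.1.eval g * p.2.eval g') ([], []) (by simp)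
      H.qk hH
    rw [score, ← this, ← Finset.sum_sub_distrib]
    refine (Finset.abs_sum_le_sum_abs _ _).trans ?_
    refine (Finset.sum_le_sum (g := fun _ => (C1 * C2 + S * C1) * (δ + η)) fun r _ => ?_).trans
      (by simp [hd])
    have e1 := (hQ r).2 _ δ hδ hzg
    have e2 := (hK r).2 _ δ hδ hzg'
    rw [show ∑ j, (H.compile.Q r j : ℝ) * (Fintype.card κ * lift g j) = _
      from sum_row_mul _ _] at e1
    rw [show ∑ j, (H.compile.K r j : ℝ) * (Fintype.card κ * lift g' j) = _
      from sum_row_mul _ _] at e2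
    have e3 : |(H.qk.getD r ([], [])).2.eval g'| ≤ S := by
      by_cases hr : (r : ℕ) < H.qk.length
      · refine (Lin.abs_eval_le _ hg').trans (List.single_le_sum hSn _ ?_)
        rw [List.getD_eq_getElem _ _ hr]
        exact List.mem_map_of_mem (List.getElem_mem hr)
      · rw [List.getD_eq_default _ _ (by omega)]
        simpa using hS0
    set p := (H.qk.getD r ([], [])).1.eval g
    set q := (H.qk.getD r ([], [])).2.eval g'
    have e4 : a r * b r - p * q = a r * (b r - q) + q * (a r - p) := by ring
    rw [e4]
    refine (abs_add_le _ _).trans ?_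
    rw [abs_mul, abs_mul]
    have e5 : |a r| * |b r - q| ≤ C1 * (C2 * (δ + η)) :=
      mul_le_mul (hQ r).1 e2 (abs_nonneg _) (by linarith)
    have e6 : |q| * |a r - p| ≤ S * (C1 * (δ + η)) :=
      mul_le_mul e3 e1 (abs_nonneg _) hS0
    linarith
  refine (abs_sub_le _ _ _).trans ((add_le_add h1 h2).trans ?_)
  have e : (C1 + C2 + d * (C1 * C2 + 2) + 2 * d + d * (C1 * C2 + S * C1)) * (δ + η)
      = 2 * d * η + d * ((C1 * C2 + S * C1) * (δ + η)) +
        ((C1 + C2 + d * (C1 * C2 + 2)) * (δ + η) + 2 * d * δ) := by ring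
  rw [e]
  have : 0 ≤ (C1 + C2 + d * (C1 * C2 + 2)) * (δ + η) + 2 * d * δ := by positivity
  exact le_add_of_nonneg_right this

/-- Computed scores differ from exact ones by less than `γ / 2`, so a position whose exact score is
`γ` below that of `j₀` cannot become maximal. If there are no queries, all computed scores are
exactly `0`. -/
theorem eval_sub_le (H : HeadSpec κ) (hH : H.qk.length ≤ headDim κ) (A : ℝ) :
    ∃ C, 1 ≤ C ∧ ∀ {rnd : ℝ → ℝ} {η X : ℝ}, IsRounding rnd η X → C ≤ X →
      ∀ {N : ℕ} (z : Fin N → Fin (modelDim κ) → ℝ) (g : Fin N → κ → ℝ) (δ γ : ℝ), 0 ≤ δ →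
        N * η ≤ 1 → (∀ j r, |z j r| ≤ A) → (∀ j c, |g j c| ≤ 1) →
        (∀ j r, |z j r - Fintype.card κ * lift (g j) r| ≤ δ) → C * (δ + η) < γ →
        ∀ i o, H.Attends γ g i o → ∀ r, |H.compile.eval rnd z i r| ≤ C ∧
          ((r : ℕ) = 0 → |H.compile.eval rnd z i r - o| ≤ C * (δ + N * η)) := by
  obtain ⟨C1, hC1, H1⟩ := H.score_sub_le hH A
  obtain ⟨C2, hC2, H2⟩ := applyMat_bound H.compile.V A
  refine ⟨2 * C1 + 4 * C2 + 4, by linarith, ?_⟩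
  intro rnd η X h hX N z g δ γ hδ hN hz hg hzg hγ i o ho r
  have hη := h.nonneg
  have hi : i ∈ H.visible i := by simp [visible]
  have hN1 : (1 : ℝ) ≤ N := Nat.one_le_cast.2 (Fin.pos i)
  have hV := fun j => H2 h (by linarith) (z j) (hz j) r
  set sc : Fin N → ℝ := fun j => dot rnd (applyMat rnd H.compile.Q (z i))
    (applyMat rnd H.compile.K (z j)) with hsc
  have e : H.compile.eval rnd z i r = rnd (∑ j ∈ H.visible i,
    rnd (rnd (hardWeight (H.visible i) sc j) * applyMat rnd H.compile.V (z j) r)) := rfl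
  obtain ⟨b1, b2⟩ := h.sum_hardWeight_sub_le ⟨i, hi⟩ hN sc _
    (fun j => ∑ c, (H.compile.V r c : ℝ) * (Fintype.card κ * lift (g j) c)) hC2 (by linarith)
    (δ := C2 * (δ + η))
    (fun j => (hV j).1) (fun j => (hV j).2 _ δ hδ (hzg j))
  rw [e]
  refine ⟨b1.trans (by linarith), fun hr => ?_⟩
  have e1 : ∀ j, ∑ c, (H.compile.V r c : ℝ) * (Fintype.card κ * lift (g j) c)
      = H.v.eval (g j) := fun j => by
    simp only [compile, if_pos hr]
    exact sum_row_mul _ _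
  simp only [e1] at b2
  have e2 : ∑ j ∈ H.visible i, hardWeight (H.visible i) sc j * H.v.eval (g j) = o := by
    rcases ho with ⟨hq, rfl⟩ | ⟨j₀, hj₀, hv, hj⟩
    · refine sum_hardWeight_mul_const _ fun j _ j' _ => ?_
      have hz0 : applyMat rnd H.compile.Q (z i) = fun _ => 0 := by
        funext r
        refine h.dot_eq_zero _ _ fun c => ?_
        simp [compile, hq, row, h.zero]
      simp only [hsc, hz0]
      rw [h.dot_eq_zero _ _ (by simp), h.dot_eq_zero _ _ (by simp)]
    · refine sum_hardWeight_mul_eq hj₀ fun j hjv => (hj j hjv).imp_right fun hlt => ?_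
      have s1 := abs_le.1 (H1 h (by linarith) (z i) (z j) (g i) (g j) δ hδ (hz i) (hz j) (hg j)
        (hzg i) (hzg j))
      have s2 := abs_le.1 (H1 h (by linarith) (z i) (z j₀) (g i) (g j₀) δ hδ (hz i) (hz j₀) (hg j₀)
        (hzg i) (hzg j₀))
      have : 0 ≤ (4 * C2 + 4) * (δ + η) := by positivity
      have : (2 * C1 + 4 * C2 + 4) * (δ + η) = 2 * (C1 * (δ + η)) + (4 * C2 + 4) * (δ + η) := by
        ring
      simp only [hsc]
      linarith [s1.2, s2.1]
  rw [e2] at b2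
  refine b2.trans ?_
  have : η ≤ N * η := by nlinarith
  have : C2 * (δ + η) ≤ C2 * (δ + N * η) := by gcongr
  have h3 : (C2 + 2) * (N * η) ≤ (C2 + 2) * (δ + N * η) := by gcongr; linarith
  have : 0 ≤ (2 * C1 + 2 * C2 + 2) * (δ + N * η) := by positivity
  linarith

end HeadSpec

namespace AttSpec

def compile (S : AttSpec κ) : AttentionSublayer (headCount κ) (headDim κ) where
  mask := maskOf S.mask
  head k := (S.heads.getD k default).compile
  W r c := if ((finProdFinEquiv.symm c).2 : ℕ) = 0 then
    column (S.heads.getD (finProdFinEquiv.symm c).1 default).out r else 0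

/-- `f'` is the update of the values `f` in exact arithmetic, for hard attention with a margin of
`γ` and with norms bounded from below by `ρ`. -/
def Ideal (S : AttSpec κ) (ρ γ : ℝ) {N : ℕ} (f f' : Fin N → κ → ℝ) : Prop :=
  (∀ i, ρ ≤ nrm S.mask (f i)) ∧ ∃ l : List (HeadSpec κ × (Fin N → ℝ)),
    l.map Prod.fst = S.heads ∧
    (∀ p ∈ l, ∀ i, p.1.Attends γ (fun j => unit S.mask (f j)) i (p.2 i)) ∧
    ∀ i c, f' i c = f i c + (l.map fun p => (p.1.out.coef c : ℝ) * p.2 i).sum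

end AttSpec
end Specs

theorem HeadSpec.Attends.abs_le {κ : Type} {H : HeadSpec κ} {γ : ℝ} {N : ℕ} {g : Fin N → κ → ℝ}
    {i : Fin N} {o : ℝ} (h : H.Attends γ g i o) (hg : ∀ j c, |g j c| ≤ 1) : |o| ≤ H.v.size := by
  rcases h with ⟨-, rfl⟩ | ⟨j, -, rfl, -⟩
  · rw [abs_div, Nat.abs_cast]
    refine div_le_of_le_mul₀ (Nat.cast_nonneg _) H.v.size_nonneg ?_
    refine (Finset.abs_sum_le_sum_abs _ _).trans ?_
    refine (Finset.sum_le_sum fun j _ => H.v.abs_eval_le (hg j)).trans ?_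
    simp [mul_comm]
  · exact H.v.abs_eval_le (hg j)

namespace AttSpec

variable {κ : Type} [DecidableEq κ]

theorem Ideal.abs_le {S : AttSpec κ} {ρ γ : ℝ} {N : ℕ} {f f' : Fin N → κ → ℝ}
    (h : S.Ideal ρ γ f f') {A : ℝ} (hf : ∀ i c, |f i c| ≤ A) (i : Fin N) (c : κ) :
    |f' i c| ≤ A + (S.heads.map fun H => H.out.size * H.v.size).sum := by
  obtain ⟨-, l, hl, ho, hf'⟩ := h
  rw [hf', ← hl, List.map_map]
  refine (abs_add_le _ _).trans (add_le_add (hf i c) ?_)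
  clear hf' hl
  induction l with
  | nil => simp
  | cons p l ih =>
    simp only [List.map_cons, List.sum_cons]
    refine (abs_add_le _ _).trans (add_le_add ?_ (ih fun q hq => ho q (List.mem_cons_of_mem _ hq)))
    rw [abs_mul]
    exact mul_le_mul (Lin.abs_coef_le _ _)
      ((ho p List.mem_cons_self i).abs_le fun j c => abs_unit_le _ _ _) (abs_nonneg _)
      (Lin.size_nonneg _)

variable [Fintype κ] [Nonempty κ]

theorem eval_sub_le (S : AttSpec κ) (hS : S.mask.Nodup) (hh : S.heads.length ≤ headCount κ)
    (hq : ∀ H ∈ S.heads, H.qk.length ≤ headDim κ) (A : ℝ) :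
    ∃ C, 1 ≤ C ∧ ∀ (ν : NormKind) {rnd : ℝ → ℝ} {η X : ℝ}, IsRounding rnd η X → C ≤ X →
      ∀ {N : ℕ} (x : Fin N → Fin (modelDim κ) → ℝ) (f f' : Fin N → κ → ℝ) (ε ρ γ : ℝ), 0 ≤ ε →
        ε ≤ 1 → N * η ≤ 1 → 0 < ρ → ρ ≤ 1 → (∀ i, Approx ε (x i) (f i)) → (∀ i c, |f i c| ≤ A) →
        S.Ideal ρ γ f f' → C * ((ε + N * η) / ρ) < γ → ∀ i,
          Approx (C * ((ε + N * η) / ρ)) (S.compile.eval rnd ν x i) (f' i) := by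
  obtain ⟨C0, hC0, H0⟩ := maskedNorm_sub_le (κ := κ) A
  have hqk : ∀ k : Fin (headCount κ), (S.heads.getD k default).qk.length ≤ headDim κ := by
    intro k
    by_cases hk : (k : ℕ) < S.heads.length
    · rw [List.getD_eq_getElem _ _ hk]
      exact hq _ (List.getElem_mem hk)
    · rw [List.getD_eq_default _ _ (by omega)]
      exact Nat.zero_le _
  choose D hD1 hD using fun k => HeadSpec.eval_sub_le _ (hqk k) C0
  set C1 : ℝ := 1 + ∑ k, D k with hC1
  have hDC : ∀ k, D k ≤ C1 := fun k => by
    have := Finset.single_le_sum (f := D) (fun k _ => by linarith [hD1 k]) (Finset.mem_univ k)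
    linarith
  have hC1' : 1 ≤ C1 := by
    have := Finset.sum_nonneg (s := Finset.univ) (f := D) fun k _ => (by linarith [hD1 k] : 0 ≤ D k)
    linarith
  obtain ⟨C2, hC2, H2⟩ := applyMat_bound S.compile.W C1
  have hA := abs_nonneg A
  refine ⟨C0 + C1 + C2 + |A| + 2 + (C2 * (C1 * (C0 + 1) + 1)) + C1 * (C0 + 1), ?_, ?_⟩
  · have : 0 ≤ C2 * (C1 * (C0 + 1) + 1) := by positivity
    have : 0 ≤ C1 * (C0 + 1) := by positivity
    linarith
  intro ν rnd η X h hX N x f f' ε ρ γ hε hε1 hN hρ hρ1 hx hf hI hγ i r hr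
  have hη := h.nonneg
  have hη1 := h.le_one
  have hN1 : (1 : ℝ) ≤ N := Nat.one_le_cast.2 (Fin.pos i)
  have hηN : η ≤ N * η := by nlinarith
  have hnn : 0 ≤ C2 * (C1 * (C0 + 1) + 1) := by positivity
  have hnn2 : 0 ≤ C1 * (C0 + 1) := by positivity
  obtain ⟨hn, l, hl, ho, hf'⟩ := hI
  set q := (ε + N * η) / ρ with hqdef
  have hq0 : 0 ≤ q := by positivity
  have hεq : ε + N * η ≤ q := by
    have : 0 ≤ ε + N * η := by positivity
    rw [hqdef, le_div_iff₀ hρ]; nlinarith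
  have hz := fun j => H0 ν h (by linarith) hS (x j) (f j) ε ρ hε hε1 hρ hρ1 (hx j) (hf j) (hn j)
  have hqq : (ε + η) / ρ ≤ q := by rw [hqdef]; gcongr
  have hdist : ∀ j r, |maskedNorm rnd ν (maskOf S.mask) (x j) r
      - Fintype.card κ * lift (unit S.mask (f j)) r| ≤ C0 * q := fun j r =>
    (hz j r).2.trans (by gcongr)
  have hkey : C1 * (C0 * q + N * η) ≤ C1 * (C0 + 1) * q := by
    have : C1 * (C0 * q + N * η) ≤ C1 * (C0 * q + q) := by gcongr; linarith
    linarith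
  have hout : ∀ k : Fin (headCount κ), ∀ r, _ := fun k => by
    refine hD k h (by linarith [hDC k]) (fun j => maskedNorm rnd ν (maskOf S.mask) (x j))
      (fun j => unit S.mask (f j)) (C0 * q) γ (by positivity) hN (fun j r => (hz j r).1)
      (fun j c => abs_unit_le _ _ _) hdist ?_ i
      ((l.getD k (default, fun _ => 0)).2 i) ?_
    · refine lt_of_le_of_lt ?_ hγ
      have : D k * (C0 * q + η) ≤ C1 * (C0 * q + N * η) := by
        gcongr
        exact hDC k
      have : 0 ≤ (C0 + C1 + C2 + |A| + 2 + (C2 * (C1 * (C0 + 1) + 1))) * q := by positivity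
      linarith
    · have e : S.heads.getD k default = (l.getD k (default, fun _ => 0)).1 := by
        rw [← hl]; exact List.getD_map l (default, fun _ => 0) Prod.fst
      rw [e]
      by_cases hk : (k : ℕ) < l.length
      · rw [List.getD_eq_getElem _ _ hk]
        exact ho _ (List.getElem_mem hk) i
      · rw [List.getD_eq_default _ _ (by omega)]
        left
        simp [default]
  set a : Fin (headCount κ) → Fin (headDim κ) → ℝ := fun k => (S.compile.head k).eval rnd
    (fun j => maskedNorm rnd ν (maskOf S.mask) (x j)) i with ha
  have hab : ∀ c, |concatHeads a c| ≤ C1 := fun c => ((hout _ _).1).trans (hDC _)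
  obtain ⟨hb, hd⟩ := H2 h (by linarith) (concatHeads a) hab r
  -- Only component `0` of a head is controlled. In the other components the comparison vector is
  -- the computed one, since `W` is zero there.
  set y : Fin (headCount κ * headDim κ) → ℝ := fun c =>
    if ((finProdFinEquiv.symm c).2 : ℕ) = 0 then
      (l.getD (finProdFinEquiv.symm c).1 (default, fun _ => 0)).2 i else concatHeads a c with hy
  have hay : ∀ c, |concatHeads a c - y c| ≤ C1 * (C0 + 1) * q := by
    intro c
    simp only [hy]
    split_ifs with hc
    · refine ((hout _ _).2 hc).trans (le_trans ?_ hkey)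
      gcongr
      exact hDC _
    · rw [sub_self, abs_zero]; positivity
  have hd := hd _ _ (by positivity) hay
  have e : ∑ c, (S.compile.W r c : ℝ) * y c = lift (f' i) r - lift (f i) r := by
    have h1 := sum_getD (fun p : HeadSpec κ × (Fin N → ℝ) =>
      (p.1.out.coef (coordEquiv κ r).2.1 : ℝ) * p.2 i) (default, fun _ => 0) (by simp [default])
      l (w := headCount κ) (by rw [← List.length_map (f := Prod.fst), hl]; exact hh)
    simp only [lift, if_pos hr, hf']
    rw [← mul_sub, add_sub_cancel_left, ← h1, Finset.mul_sum,
      ← finProdFinEquiv.sum_comp, Fintype.sum_prod_type]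
    refine Finset.sum_congr rfl fun k _ => ?_
    have hd0 : 0 < headDim κ := Fintype.card_pos
    rw [Finset.sum_eq_single ⟨0, hd0⟩]
    · simp only [compile, hy, Equiv.symm_apply_apply, if_true, column, if_pos hr]
      have e : S.heads.getD k default = (l.getD k (default, fun _ => 0)).1 := by
        rw [← hl]; exact List.getD_map l (default, fun _ => 0) Prod.fst
      rw [e]
      push_cast
      ring
    · intro b _ hb
      have : (b : ℕ) ≠ 0 := fun h => hb (Fin.ext h)
      simp only [compile, Equiv.symm_apply_apply, this, if_false, Rat.cast_zero, zero_mul]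
    · simp
  rw [e] at hd
  have hl' : |lift (f i) r| ≤ |A| :=
    abs_lift_le _ (fun c => (hf i c).trans (le_abs_self A)) r hr
  have hxr := hx i r hr
  have hxb : |x i r| ≤ |A| + 1 := by
    have h2 := abs_add_le (x i r - lift (f i) r) (lift (f i) r)
    rw [sub_add_cancel] at h2
    linarith
  have key : |x i r + applyMat rnd S.compile.W (concatHeads a) r - lift (f' i) r|
      ≤ ε + C2 * (C1 * (C0 + 1) * q + η) := by
    have e2 : x i r + applyMat rnd S.compile.W (concatHeads a) r - lift (f' i) r
      = (x i r - lift (f i) r) + (applyMat rnd S.compile.W (concatHeads a) r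
        - (lift (f' i) r - lift (f i) r)) := by ring
    rw [e2]
    exact (abs_add_le _ _).trans (add_le_add hxr hd)
  have hX' : |x i r + applyMat rnd S.compile.W (concatHeads a) r| ≤ X :=
    (abs_add_le _ _).trans (by linarith)
  refine (h.sub_le hX' key).trans ?_
  have hηq : η ≤ q := by linarith
  have h1 : C2 * (C1 * (C0 + 1) * q + η) ≤ C2 * (C1 * (C0 + 1) * q + q) := by gcongr
  have h3 : 1 * q ≤ (C0 + C1 + C2 + |A| + 2 + C1 * (C0 + 1)) * q := by gcongr; linarith
  linarith

end AttSpec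

/-! ### Layers and stacks of layers -/

structure LayerSpec (κ : Type) where
  att : AttSpec κ
  ff : FFSpec κ

namespace LayerSpec

variable {κ : Type} [DecidableEq κ]

/-- The specification fits into a layer of feedforward width `w`. -/
structure Fits [Fintype κ] (L : LayerSpec κ) (w : ℕ) : Prop where
  att_nodup : L.att.mask.Nodup
  heads_le : L.att.heads.length ≤ headCount κ
  qk_le : ∀ H ∈ L.att.heads, H.qk.length ≤ headDim κ
  ff_nodup : L.ff.mask.Nodup
  neurons_le : L.ff.neurons.length ≤ w

def Step (L : LayerSpec κ) (ρ γ : ℝ) {N : ℕ} (f f'' : Fin N → κ → ℝ) : Prop :=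
  ∃ f' : Fin N → κ → ℝ, L.att.Ideal ρ γ f f' ∧ (∀ i, ρ ≤ nrm L.ff.mask (f' i)) ∧
    ∀ i c, f'' i c = L.ff.ideal (f' i) c

def Steps (ρ γ : ℝ) {N : ℕ} : List (LayerSpec κ) → (Fin N → κ → ℝ) → (Fin N → κ → ℝ) → Prop
  | [], f, f' => f = f'
  | L :: Ls, f, f' => ∃ g, L.Step ρ γ f g ∧ Steps ρ γ Ls g f'

variable [Fintype κ] [Nonempty κ]

def compile (L : LayerSpec κ) (w : ℕ) : Layer (headCount κ) (headDim κ) w where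
  attention := L.att.compile
  feedforward := L.ff.compile w

/-- A layer normalizes twice, hence `ρ ^ 2`. -/
theorem eval_sub_le (L : LayerSpec κ) {w : ℕ} (hL : L.Fits w) (A : ℝ) :
    ∃ C A', 1 ≤ C ∧ ∀ (ν : NormKind) {rnd : ℝ → ℝ} {η X : ℝ}, IsRounding rnd η X → C ≤ X →
      ∀ {N : ℕ} (x : Fin N → Fin (modelDim κ) → ℝ) (f f' : Fin N → κ → ℝ) (ε ρ γ : ℝ), 0 ≤ ε →
        ε ≤ 1 → N * η ≤ 1 → 0 < ρ → ρ ≤ 1 → γ ≤ 1 → (∀ i, Approx ε (x i) (f i)) →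
        (∀ i c, |f i c| ≤ A) → L.Step ρ γ f f' → C * ((ε + N * η) / ρ ^ 2) < γ →
          (∀ i, Approx (C * ((ε + N * η) / ρ ^ 2)) ((L.compile w).eval rnd ν x i) (f' i)) ∧
          ∀ i c, |f' i c| ≤ A' := by
  obtain ⟨C1, hC1, H1⟩ := L.att.eval_sub_le hL.att_nodup hL.heads_le hL.qk_le A
  set A1 := A + (L.att.heads.map fun H => H.out.size * H.v.size).sum with hA1
  obtain ⟨C2, hC2, H2⟩ := L.ff.eval_sub_le hL.ff_nodup hL.neurons_le A1
  refine ⟨C2 * (C1 + 1), A1 + (L.ff.neurons.map fun p => p.2.size * p.1.size).sum,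
    by nlinarith, ?_⟩
  intro ν rnd η X h hX N x f f' ε ρ γ hε hε1 hN hρ hρ1 hγ1 hx hf ⟨g, hg, hgρ, hf'⟩ hγ
  have hη := h.nonneg
  have hgb : ∀ i c, |g i c| ≤ A1 := fun i c => hg.abs_le hf i c
  refine ⟨fun i => ?_, fun i c => by rw [hf']; exact L.ff.abs_ideal_le (hgb i) c⟩
  have hN1 : (1 : ℝ) ≤ N := Nat.one_le_cast.2 (Fin.pos i)
  have hηN : η ≤ N * η := by nlinarith
  set e := ε + N * η with he
  have he0 : 0 ≤ e := by positivity
  have hρ2 : ρ ^ 2 ≤ ρ := by nlinarith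
  have h1 : e / ρ ≤ e / ρ ^ 2 := by gcongr
  have hq0 : 0 ≤ e / ρ ^ 2 := by positivity
  have h2 : C1 * (e / ρ) ≤ C2 * (C1 + 1) * (e / ρ ^ 2) :=
    mul_le_mul (by nlinarith) h1 (by positivity) (by positivity)
  have h3 := H1 ν h (by nlinarith) x f g ε ρ γ hε hε1 hN hρ hρ1 hx hf hg (h2.trans_lt hγ)
  have h4 := H2 ν h (by nlinarith) _ g (C1 * (e / ρ)) ρ (by positivity)
    (h2.trans (hγ.le.trans hγ1)) hρ hρ1 h3 hgb hgρ i
  intro r hr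
  have h5 := h4 r hr
  rw [show f' i = L.ff.ideal (g i) from funext (hf' i)]
  refine h5.trans ?_
  have h6 : (C1 * (e / ρ) + η) / ρ ≤ (C1 + 1) * (e / ρ ^ 2) := by
    have e1 : (C1 + 1) * (e / ρ ^ 2) = (C1 * (e / ρ) + e / ρ) / ρ := by field_simp
    rw [e1]
    have : e ≤ e / ρ := by rw [le_div_iff₀ hρ]; nlinarith
    gcongr
    linarith
  rw [mul_assoc]
  gcongr

/-- For a fixed list with `ρ` a power of `N⁻¹`, the error grows by a power of `N`; with `ρ = 1`, by
a constant factor. -/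
theorem foldl_sub_le : ∀ (Ls : List (LayerSpec κ)) {w : ℕ} (_ : ∀ L ∈ Ls, L.Fits w) (A : ℝ),
    ∃ C A', 1 ≤ C ∧ ∀ (ν : NormKind) {rnd : ℝ → ℝ} {η X : ℝ}, IsRounding rnd η X → C ≤ X →
      ∀ {N : ℕ} (x : Fin N → Fin (modelDim κ) → ℝ) (f f' : Fin N → κ → ℝ) (ε ρ γ : ℝ), 0 ≤ ε →
        N * η ≤ 1 → 0 < ρ → ρ ≤ 1 → γ ≤ 1 → (∀ i, Approx ε (x i) (f i)) →
        (∀ i c, |f i c| ≤ A) → Steps ρ γ Ls f f' →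
        C * ((ε + N * η) / ρ ^ (2 * Ls.length)) < γ →
          (∀ i, Approx (C * ((ε + N * η) / ρ ^ (2 * Ls.length)))
            ((Ls.map fun L => L.compile w).foldl (fun x L => L.eval rnd ν x) x i) (f' i)) ∧
          ∀ i c, |f' i c| ≤ A' := by
  intro Ls w
  induction Ls with
  | nil =>
    intro _ A
    refine ⟨1, A, le_rfl, ?_⟩
    intro ν rnd η X h hX N x f f' ε ρ γ hε hN hρ hρ1 hγ1 hx hf hff' hγ
    obtain rfl : f = f' := hff'
    refine ⟨fun i r hr => (hx i r hr).trans ?_, hf⟩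
    have : 0 ≤ N * η := mul_nonneg (Nat.cast_nonneg _) h.nonneg
    simpa using this
  | cons L Ls ih =>
    intro hL A
    obtain ⟨C1, A1, hC1, H1⟩ := L.eval_sub_le (hL L List.mem_cons_self) A
    obtain ⟨C2, A2, hC2, H2⟩ := ih (fun M hM => hL M (List.mem_cons_of_mem _ hM)) A1
    refine ⟨C2 * (C1 + 1), A2, by nlinarith, ?_⟩
    intro ν rnd η X h hX N x f f' ε ρ γ hε hN hρ hρ1 hγ1 hx hf ⟨g, hfg, hgf'⟩ hγ
    have hNη : 0 ≤ N * η := mul_nonneg (Nat.cast_nonneg _) h.nonneg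
    set e := ε + N * η with he
    have he0 : 0 ≤ e := by positivity
    have hlen : 2 * (L :: Ls).length = 2 * Ls.length + 2 := by simp; ring
    rw [hlen] at hγ ⊢
    have hρn : ρ ^ (2 * Ls.length) ≤ 1 := pow_le_one₀ hρ.le hρ1
    have hρn0 : 0 < ρ ^ (2 * Ls.length) := by positivity
    have h1 : C1 * (e / ρ ^ 2) ≤ C2 * (C1 + 1) * (e / ρ ^ (2 * Ls.length + 2)) := by
      refine mul_le_mul (by nlinarith) ?_ (by positivity) (by positivity)
      rw [pow_add]
      gcongr
      exact mul_le_of_le_one_left (by positivity) hρn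
    have hεe : ε ≤ C1 * (e / ρ ^ 2) := by
      have : ρ ^ 2 ≤ 1 := pow_le_one₀ hρ.le hρ1
      have h2 : e ≤ e / ρ ^ 2 := by rw [le_div_iff₀ (by positivity)]; nlinarith
      nlinarith
    obtain ⟨h3, h4⟩ := H1 ν h (by nlinarith) x f g ε ρ γ hε
      (hεe.trans (h1.trans (hγ.le.trans hγ1))) hN hρ hρ1 hγ1 hx hf hfg (h1.trans_lt hγ)
    have h5 : C2 * ((C1 * (e / ρ ^ 2) + N * η) / ρ ^ (2 * Ls.length))
        ≤ C2 * (C1 + 1) * (e / ρ ^ (2 * Ls.length + 2)) := by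
      have e1 : C2 * (C1 + 1) * (e / ρ ^ (2 * Ls.length + 2))
          = C2 * ((C1 * (e / ρ ^ 2) + e / ρ ^ 2) / ρ ^ (2 * Ls.length)) := by
        rw [pow_add]; field_simp
      rw [e1]
      have : ρ ^ 2 ≤ 1 := pow_le_one₀ hρ.le hρ1
      have h2 : e ≤ e / ρ ^ 2 := by rw [le_div_iff₀ (by positivity)]; nlinarith
      gcongr
      linarith
    obtain ⟨h6, h7⟩ := H2 ν h (by nlinarith) _ g f' _ ρ γ (by positivity) hN hρ hρ1 hγ1 h3 h4 hgf'
      (h5.trans_lt hγ)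
    exact ⟨fun i r hr => (h6 i r hr).trans h5, h7⟩

end LayerSpec

/-- Unembedding is not preceded by a norm, so the factor `1 / |κ|` of `row` remains. It scales all
the token scores alike. -/
theorem readout_sub_le {κ : Type} [DecidableEq κ] [Fintype κ] [Nonempty κ] (l : Lin κ) (A : ℝ) :
    ∃ C, 1 ≤ C ∧ ∀ {rnd : ℝ → ℝ} {η X : ℝ}, IsRounding rnd η X → C ≤ X →
      ∀ (x : Fin (modelDim κ) → ℝ) (f : κ → ℝ) (ε : ℝ), 0 ≤ ε → ε ≤ 1 → Approx ε x f →
        (∀ c, |f c| ≤ A) →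
          |dot rnd x (fun r => rnd (row l r : ℝ)) - l.eval f / Fintype.card κ| ≤ C * (ε + η) := by
  set R : ℝ := ∑ r, |(row l r : ℝ)| with hR
  have hrow : ∀ r, |(row l r : ℝ)| ≤ R := fun r =>
    Finset.single_le_sum (f := fun r => |(row l r : ℝ)|) (fun _ _ => abs_nonneg _)
      (Finset.mem_univ r)
  have hR0 : 0 ≤ R := Finset.sum_nonneg fun _ _ => abs_nonneg _
  set m : ℝ := (modelDim κ : ℝ) with hm
  have hm0 : 0 ≤ m := Nat.cast_nonneg _
  have hA := abs_nonneg A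
  refine ⟨1 + R + m * ((R + 1) * (|A| + 1) + 2) + 2 * m + m * (R + |A| + 1), ?_, ?_⟩
  · have : 0 ≤ R + m * ((R + 1) * (|A| + 1) + 2) + 2 * m + m * (R + |A| + 1) := by positivity
    linarith
  intro rnd η X h hX x f ε hε hε1 hx hf
  have hη := h.nonneg
  have hη1 := h.le_one
  have hp1 : 0 ≤ m * ((R + 1) * (|A| + 1) + 2) := by positivity
  have hp2 : 0 ≤ m * (R + |A| + 1) := by positivity
  have hxb : ∀ r, ((coordEquiv κ r).1 : ℕ) = 0 → |x r| ≤ |A| + 1 := by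
    intro r hr
    have h2 := abs_add_le (x r - lift f r) (lift f r)
    rw [sub_add_cancel] at h2
    linarith [hx r hr, abs_lift_le f (fun c => (hf c).trans (le_abs_self A)) r hr]
  have hb : ∀ r, |rnd (row l r : ℝ)| ≤ R + 1 := fun r =>
    h.abs_le ((hrow r).trans (by linarith)) (hrow r)
  have hzero : ∀ r, ((coordEquiv κ r).1 : ℕ) ≠ 0 → (row l r : ℝ) = 0 := fun r hr => by
    simp [row, hr]
  have h1 := h.dot_sub_le x (fun r => rnd (row l r : ℝ)) (A := (R + 1) * (|A| + 1)) (by positivity)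
    (fun r => by
      by_cases hr : ((coordEquiv κ r).1 : ℕ) = 0
      · rw [abs_mul, mul_comm]
        exact mul_le_mul (hb r) (hxb r hr) (abs_nonneg _) (by positivity)
      · rw [hzero r hr, h.zero, mul_zero, abs_zero]
        positivity) (by linarith)
  have h2 : |∑ r, x r * rnd (row l r : ℝ) - l.eval f / Fintype.card κ|
      ≤ m * ((R + |A| + 1) * (ε + η)) := by
    rw [← sum_row_mul_lift, ← Finset.sum_sub_distrib]
    refine (Finset.abs_sum_le_sum_abs _ _).trans ?_
    refine (Finset.sum_le_sum (g := fun _ => (R + |A| + 1) * (ε + η)) fun r _ => ?_).trans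
      (by simp [hm])
    by_cases hr : ((coordEquiv κ r).1 : ℕ) = 0
    · have e : x r * rnd (row l r : ℝ) - row l r * lift f r
          = x r * (rnd (row l r : ℝ) - row l r) + row l r * (x r - lift f r) := by ring
      rw [e]
      refine (abs_add_le _ _).trans ?_
      rw [abs_mul, abs_mul]
      have e1 : |x r| * |rnd (row l r : ℝ) - row l r| ≤ (|A| + 1) * η :=
        mul_le_mul (hxb r hr) (h.approx _ ((hrow r).trans (by linarith))) (abs_nonneg _)
          (by positivity)
      have e2 : |(row l r : ℝ)| * |x r - lift f r| ≤ R * ε :=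
        mul_le_mul (hrow r) (hx r hr) (abs_nonneg _) hR0
      have : 0 ≤ R * η + (|A| + 1) * ε := by positivity
      linarith
    · rw [hzero r hr, h.zero]
      simp only [mul_zero, zero_mul, sub_zero, abs_zero]
      positivity
  refine (abs_sub_le _ _ _).trans ((add_le_add h1 h2).trans ?_)
  have : 0 ≤ (1 + R + m * ((R + 1) * (|A| + 1) + 2)) * (ε + η) + 2 * m * ε := by positivity
  linarith

/-! ### Universal transformers -/

structure TransformerSpec (κ α : Type) where
  embed : α → κ → ℚ
  initial : List (LayerSpec κ)
  repeated : List (LayerSpec κ)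
  final : List (LayerSpec κ)
  unembed : α → Lin κ

namespace TransformerSpec

variable {κ α : Type} [DecidableEq κ] [Fintype κ] [Nonempty κ]

def compile (T : TransformerSpec κ α) (w : ℕ) : UniversalTransformer α T.initial.length
    T.repeated.length T.final.length (headCount κ) (headDim κ) w where
  embed a r := if ((coordEquiv κ r).1 : ℕ) = 0 then
    sign (coordEquiv κ r).2.2 * T.embed a (coordEquiv κ r).2.1 else 0
  pos _ _ := 0
  initial i := (T.initial.get i).compile w
  repeated i := (T.repeated.get i).compile w
  final i := (T.final.get i).compile w
  unembed a := row (T.unembed a)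

theorem layers_compile (T : TransformerSpec κ α) (w D : ℕ) :
    (T.compile w).layers D = T.initial.map (fun L => L.compile w) ++
      (List.replicate D (T.repeated.map fun L => L.compile w)).flatten ++
      T.final.map fun L => L.compile w := by
  have h : ∀ l : List (LayerSpec κ), List.ofFn (fun i => (l.get i).compile w)
      = l.map fun L => L.compile w := fun l => by
    conv_rhs => rw [← List.ofFn_get l, List.map_ofFn]
    rfl
  simp only [UniversalTransformer.layers, compile, h]

theorem start_sub_le (T : TransformerSpec κ α) (w : ℕ) {A : ℝ} (hA : ∀ a c, |(T.embed a c : ℝ)| ≤ A)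
    {rnd : ℝ → ℝ} {η X : ℝ} (h : IsRounding rnd η X) (hX : A + 1 ≤ X) (u : List α)
    (i : Fin u.length) :
    Approx (2 * η) ((T.compile w).start rnd u i) (fun c => T.embed (u.get i) c) := by
  intro r hr
  have e : (((T.compile w).embed (u.get i) r : ℚ) : ℝ)
      = lift (fun c => (T.embed (u.get i) c : ℝ)) r := by
    simp only [compile, lift, if_pos hr]
    push_cast
    rfl
  have e2 : (((T.compile w).pos (i + 1) r : ℚ) : ℝ) = 0 := by simp [compile]
  have hl : |lift (fun c => (T.embed (u.get i) c : ℝ)) r| ≤ A := abs_lift_le _ (hA _) r hr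
  simp only [UniversalTransformer.start, e, e2, h.zero, add_zero]
  set y := lift (fun c => (T.embed (u.get i) c : ℝ)) r
  have h1 := h.approx y (by linarith)
  have h2 : |rnd y| ≤ X := (h.abs_le (by linarith) hl).trans hX
  have := h.sub_le h2 h1
  linarith

end TransformerSpec

-- The bound `max 1 |f 0 i c|` on the exact stream keeps it of constant size during the loop, so one
-- constant `C2` serves all the repetitions.
set_option maxHeartbeats 1000000 in
theorem TransformerSpec.outputs_of_steps {κ α : Type} [DecidableEq κ] [Fintype κ] [Nonempty κ]
    [Finite α] (T : TransformerSpec κ α) {w : ℕ} (h1 : ∀ L ∈ T.initial, L.Fits w)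
    (h2 : ∀ L ∈ T.repeated, L.Fits w) (h3 : ∀ L ∈ T.final, L.Fits w) (r₁ r₂ : ℕ) :
    ∃ (a : ℕ) (X₀ : ℝ), ∀ (ν : NormKind) {rnd : ℝ → ℝ} {η X : ℝ}, IsRounding rnd η X → X₀ ≤ X →
      ∀ u : List α, 2 ≤ u.length → η * (u.length : ℝ) ^ a ≤ 1 → ∀ D, 2 ^ D ≤ u.length ^ 2 →
        ∀ (f : ℕ → Fin u.length → κ → ℝ) (f' : Fin u.length → κ → ℝ),
          LayerSpec.Steps (1 / (u.length : ℝ) ^ r₁) (1 / (u.length : ℝ) ^ r₂) T.initial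
            (fun i c => (T.embed (u.get i) c : ℝ)) (f 0) →
          (∀ l < D, LayerSpec.Steps 1 (1 / (u.length : ℝ) ^ r₂) T.repeated (f l) (f (l + 1))) →
          (∀ l i c, |f l i c| ≤ max 1 |f 0 i c|) →
          LayerSpec.Steps 1 (1 / (u.length : ℝ) ^ r₂) T.final (f D) f' →
          ∀ (i : Fin u.length) (y : α), (i : ℕ) + 1 = u.length →
            (∀ y', y' ≠ y → (T.unembed y').eval (f' i) + 1 ≤ (T.unembed y).eval (f' i)) →
            (T.compile w).Outputs rnd ν D u y := by
  obtain ⟨A0', hA0'⟩ := Finite.exists_le fun q : α × κ => |(T.embed q.1 q.2 : ℝ)|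
  set A0 := |A0'|
  have hA0 : ∀ a c, |(T.embed a c : ℝ)| ≤ A0 := fun a c => (hA0' (a, c)).trans (le_abs_self _)
  obtain ⟨C1, A1, hC1, H1⟩ := LayerSpec.foldl_sub_le T.initial h1 A0
  obtain ⟨C2, A2, hC2, H2⟩ := LayerSpec.foldl_sub_le T.repeated h2 (max 1 A1)
  obtain ⟨C3, A3, hC3, H3⟩ := LayerSpec.foldl_sub_le T.final h3 (max 1 A1)
  choose C4' hC4' H4' using fun y => readout_sub_le (T.unembed y) A3
  obtain ⟨C4'', hC4''⟩ := Finite.exists_le C4'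
  set C4 := max 1 C4''
  have hC4 : ∀ y, C4' y ≤ C4 := fun y => (hC4'' y).trans (le_max_right _ _)
  have hC41 : 1 ≤ C4 := le_max_left _ _
  have hs : (1 : ℝ) ≤ Fintype.card κ := Nat.one_le_cast.2 Fintype.card_pos
  set s : ℝ := (Fintype.card κ : ℝ)
  -- `(2 * C2) ^ D ≤ (2 ^ D) ^ b ≤ N ^ (2 * b)`, so a constant factor per repetition costs a power
  -- of `N`. Similarly `k` absorbs the fixed constants, because `N ≥ 2`.
  obtain ⟨b, hb⟩ := pow_unbounded_of_one_lt (2 * C2) (one_lt_two (α := ℝ))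
  set P : ℝ := 1 + C1 + C2 + C3 + 4 * s * C4 * (C3 + 1) with hP
  obtain ⟨k, hk⟩ := pow_unbounded_of_one_lt ((2 * C1 + 1) * P) (one_lt_two (α := ℝ))
  set M1 := r₁ * (2 * T.initial.length) with hM1
  refine ⟨k + (M1 + 1 + 2 * b) + r₂, A0 + 1 + C1 + C2 + C3 + C4, ?_⟩
  intro ν rnd η X h hX u hu hη D hD f f' s1 s2 hf s3 i y hi hy
  have hη0 := h.nonneg
  have hN : (2 : ℝ) ≤ u.length := by exact_mod_cast hu
  have hD' : (2 : ℝ) ^ D ≤ (u.length : ℝ) ^ 2 := by exact_mod_cast hD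
  set N : ℝ := (u.length : ℝ) with hNdef
  have hA00 : 0 ≤ A0 := abs_nonneg _
  set t := N ^ (M1 + 1 + 2 * b) * η with ht
  have ht0 : 0 ≤ t := by positivity
  set γ : ℝ := 1 / N ^ r₂ with hγ
  have hγ0 : 0 < γ := by positivity
  have hγ1 : γ ≤ 1 := by
    rw [hγ, div_le_one (by positivity)]
    exact one_le_pow₀ (by linarith)
  have htγ : 2 ^ k * t ≤ γ := by
    have e1 : (2 : ℝ) ^ k ≤ N ^ k := by gcongr
    have e2 : N ^ k * t ≤ γ := by
      rw [hγ, le_div_iff₀ (by positivity)]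
      calc N ^ k * t * N ^ r₂ = η * N ^ (k + (M1 + 1 + 2 * b) + r₂) := by
            rw [ht]; ring
        _ ≤ 1 := hη
    exact (mul_le_mul_of_nonneg_right e1 ht0).trans e2
  have hGt : (2 * C1 + 1) * P * t < γ := by
    rcases ht0.eq_or_lt with h0 | h0
    · rw [← h0, mul_zero]; exact hγ0
    · exact (mul_lt_mul_of_pos_right hk h0).trans_le htγ
  have hP1 : 1 ≤ P := by
    have : 0 ≤ 4 * s * C4 * (C3 + 1) := by positivity
    linarith
  have hbd : ∀ c, 0 ≤ c → c ≤ P → c * ((2 * C1 + 1) * t) < γ := fun c _ hc => by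
    refine lt_of_le_of_lt ?_ hGt
    have : c * ((2 * C1 + 1) * t) ≤ P * ((2 * C1 + 1) * t) := by gcongr
    linarith
  have h4s : 0 ≤ 4 * s * C4 * (C3 + 1) := by positivity
  have hNη : N * η ≤ t := by
    rw [ht]
    gcongr
    refine le_self_pow₀ (by linarith) (by omega)
  have hNη1 : N * η ≤ 1 := by
    have := hbd 1 zero_le_one hP1
    nlinarith
  -- the initial layers
  have hρ0 : 0 < 1 / N ^ r₁ := by positivity
  have hρ1 : 1 / N ^ r₁ ≤ 1 := by
    rw [div_le_one (by positivity)]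
    exact one_le_pow₀ (by linarith)
  set E := C1 * ((2 * η + N * η) / (1 / N ^ r₁) ^ (2 * T.initial.length)) with hE
  have hE0 : 0 ≤ E := by positivity
  have hE1 : E = C1 * (2 + N) * (N ^ M1 * η) := by
    rw [hE, hM1, one_div, inv_pow, ← pow_mul, div_inv_eq_mul]
    ring
  have hE2 : E ≤ 2 * C1 * (N ^ (M1 + 1) * η) := by
    have : C1 * (2 + N) * (N ^ M1 * η) ≤ C1 * (2 * N) * (N ^ M1 * η) := by gcongr; linarith
    rw [hE1]
    refine this.trans_eq ?_
    ring
  have hNη' : N * η ≤ N ^ (M1 + 1) * η := by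
    gcongr
    exact le_self_pow₀ (by linarith) (by omega)
  have hE3 : E + N * η ≤ (2 * C1 + 1) * (N ^ (M1 + 1) * η) := by linarith
  have htE : N ^ (M1 + 1) * η ≤ t := by
    exact mul_le_mul_of_nonneg_right (pow_le_pow_right₀ (by linarith) (by omega)) hη0
  have hEγ : E < γ := by
    refine lt_of_le_of_lt ?_ (hbd 1 zero_le_one hP1)
    have : (2 * C1 + 1) * (N ^ (M1 + 1) * η) ≤ (2 * C1 + 1) * t := by gcongr
    have : 0 ≤ N * η := by positivity
    linarith
  obtain ⟨a1, a2⟩ := H1 ν h (by linarith) _ _ (f 0) (2 * η) (1 / N ^ r₁) γ (by positivity) hNη1 hρ0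
    hρ1 hγ1 (fun i => T.start_sub_le w hA0 h (by linarith) u i) (fun i c => hA0 _ _) s1 hEγ
  -- the repeated layers
  set e : ℕ → ℝ := fun l => (2 * C2) ^ l * (E + N * η) with he
  have he0 : ∀ l, N * η ≤ e l := fun l => by
    have : 1 ≤ (2 * C2) ^ l := one_le_pow₀ (by linarith)
    have h0 : 0 ≤ N * η := by positivity
    simp only [he]
    nlinarith
  have het : ∀ l ≤ D, e l ≤ (2 * C1 + 1) * t := by
    intro l hl
    have q1 : (2 * C2) ^ l ≤ N ^ (2 * b) := by
      calc (2 * C2) ^ l ≤ (2 * C2) ^ D := pow_le_pow_right₀ (by linarith) hl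
        _ ≤ (2 ^ b) ^ D := by gcongr
        _ = (2 ^ D) ^ b := by rw [← pow_mul, ← pow_mul, mul_comm]
        _ ≤ (N ^ 2) ^ b := by
            gcongr
        _ = N ^ (2 * b) := by rw [pow_mul]
    calc e l ≤ N ^ (2 * b) * ((2 * C1 + 1) * (N ^ (M1 + 1) * η)) :=
          mul_le_mul q1 hE3 (by positivity) (by positivity)
      _ = (2 * C1 + 1) * t := by rw [ht, pow_add]; ring
  have hfb : ∀ l i c, |f l i c| ≤ max 1 A1 := fun l i c =>
    (hf l i c).trans (max_le_max le_rfl (a2 i c))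
  set x0 := (T.initial.map fun L => L.compile w).foldl (fun x L => L.eval rnd ν x)
    ((T.compile w).start rnd u) with hx0
  have hloop : ∀ l ≤ D, ∀ i, Approx (e l - N * η)
      ((List.replicate l (T.repeated.map fun L => L.compile w)).flatten.foldl
        (fun x L => L.eval rnd ν x) x0 i) (f l i) := by
    intro l
    induction l with
    | zero =>
      intro _ i
      have : e 0 - N * η = E := by simp [he]
      rw [this]
      exact a1 i
    | succ l ih =>
      intro hl i
      rw [List.replicate_succ', List.flatten_append, List.foldl_append, List.flatten_singleton]
      have q1 : C2 * ((e l - N * η + N * η) / 1 ^ (2 * T.repeated.length)) = C2 * e l := by simp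
      have q2 : C2 * e l < γ := by
        refine lt_of_le_of_lt ?_ (hbd C2 (by linarith) (by linarith))
        have := het l (by omega)
        gcongr
      have q3 := (H2 ν h (by linarith) _ (f l) (f (l + 1)) (e l - N * η) 1 γ (by linarith [he0 l])
        hNη1 one_pos le_rfl hγ1 (ih (by omega)) (hfb l) (s2 l (by omega))
        (by rw [q1]; exact q2)).1 i
      intro r hr
      refine (q3 r hr).trans ?_
      rw [q1]
      have : e (l + 1) = 2 * (C2 * e l) := by simp only [he]; ring
      have h0 : 0 ≤ N * η := by positivity
      have h1 : e l ≤ C2 * e l := le_mul_of_one_le_left (h0.trans (he0 l)) hC2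
      have h2 := he0 l
      linarith only [this, h0, h1, h2]
  -- the final layers and the output
  have q1 : C3 * ((e D - N * η + N * η) / 1 ^ (2 * T.final.length)) = C3 * e D := by simp
  have q2 : C3 * e D < γ := by
    refine lt_of_le_of_lt ?_ (hbd C3 (by linarith) (by linarith))
    have := het D le_rfl
    gcongr
  obtain ⟨b1, b2⟩ := H3 ν h (by linarith) _ (f D) f' (e D - N * η) 1 γ (by linarith [he0 D])
    hNη1 one_pos le_rfl hγ1 (hloop D le_rfl) (hfb D) s3 (by rw [q1]; exact q2)
  rw [q1] at b1
  have heD : 0 ≤ e D := le_trans (by positivity) (he0 D)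
  have hηe : η ≤ e D := by
    have := he0 D
    nlinarith
  have b3 : ∀ y', |dot rnd ((T.compile w).run rnd ν D u i)
      (fun r => rnd (((T.compile w).unembed y' r : ℚ) : ℝ)) - (T.unembed y').eval (f' i) / s|
      ≤ C4 * (C3 + 1) * e D := by
    intro y'
    have q3 := H4' y' h ((hC4 y').trans (by linarith)) _ (f' i) (C3 * e D) (by positivity)
      (q2.le.trans hγ1) (b1 i) (b2 i)
    have q4 : (T.compile w).run rnd ν D u = List.foldl (fun x L => L.eval rnd ν x)
        (List.foldl (fun x L => L.eval rnd ν x) x0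
          (List.replicate D (T.repeated.map fun L => L.compile w)).flatten)
        (T.final.map fun L => L.compile w) := by
      rw [UniversalTransformer.run, T.layers_compile, List.foldl_append, List.foldl_append]
    rw [q4]
    refine q3.trans ?_
    rw [mul_assoc]
    gcongr
    · exact hC4 y'
    · linarith
  have b4 : 4 * s * (C4 * (C3 + 1) * e D) < 1 := by
    refine lt_of_le_of_lt ?_ ((hbd _ h4s (by linarith)).trans_le hγ1)
    have := het D le_rfl
    calc 4 * s * (C4 * (C3 + 1) * e D) = 4 * s * C4 * (C3 + 1) * e D := by ring
      _ ≤ _ := by gcongr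
  refine ⟨i, hi, fun y' hy' => ?_⟩
  have c1 := (abs_le.1 (b3 y')).2
  have c2 := (abs_le.1 (b3 y)).1
  have c3 : (T.unembed y').eval (f' i) / s + 1 / s ≤ (T.unembed y).eval (f' i) / s := by
    rw [← add_div]
    have := hy y' hy'
    gcongr
  have c4 : 4 * (C4 * (C3 + 1) * e D) < 1 / s := by
    rw [lt_div_iff₀ (by linarith)]
    linarith
  have c5 : 0 ≤ C4 * (C3 + 1) * e D := by positivity
  linarith

/-! ### Rounding in a precise datatype -/

theorem Datatype.abs_round_sub_le (D : Datatype) (p : ℕ) (x : ℝ) (b : Fin p → Bool) :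
    |D.round p x - x| ≤ |D.val p b - x| := by
  set S := {v | v ∈ Set.range (D.val p) ∧ ∀ b, |v - x| ≤ |D.val p b - x|} with hS
  have hfin : S.Finite := (Set.finite_range (D.val p)).subset fun v hv => hv.1
  have hne : S.Nonempty := by
    obtain ⟨b₀, hb₀⟩ := Finite.exists_min fun b => |D.val p b - x|
    exact ⟨D.val p b₀, ⟨b₀, rfl⟩, hb₀⟩
  exact (hne.csSup_mem hfin).2 b

/-- Here `η = 2 ^ (-κ p)` and `X = 2 ^ (κ p)`. The constant exceeds both the `p₀` from which the
datatype is good enough (as `log₂ N ≥ 1`) and `a / κ`, which gives `N ^ a ≤ 2 ^ (κ p)`. -/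
theorem Datatype.IsPrecise.exists_isRounding {D : Datatype} (hD : D.IsPrecise) (a : ℕ) (X₀ : ℝ) :
    ∃ c : ℝ, 0 < c ∧ ∀ N p : ℕ, 2 ≤ N → c * Real.logb 2 N ≤ p →
      ∃ η X, IsRounding (D.round p) η X ∧ X₀ ≤ X ∧ η * (N : ℝ) ^ a ≤ 1 := by
  obtain ⟨κ, hκ, hev⟩ := hD
  have hX : ∀ᶠ p : ℕ in Filter.atTop, X₀ ≤ (2 : ℝ) ^ (κ * p) := by
    have : Filter.Tendsto (fun p : ℕ => ((2 : ℝ) ^ κ) ^ p) Filter.atTop Filter.atTop :=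
      tendsto_pow_atTop_atTop_of_one_lt (Real.one_lt_rpow one_lt_two hκ)
    filter_upwards [this.eventually_ge_atTop X₀] with p hp
    rwa [Real.rpow_mul zero_le_two, Real.rpow_natCast]
  obtain ⟨p₀, hp₀⟩ := Filter.eventually_atTop.1 (hev.and hX)
  refine ⟨max 1 (max (p₀ : ℝ) (a / κ)), by positivity, fun N p hN hp => ?_⟩
  have hN' : (2 : ℝ) ≤ N := by exact_mod_cast hN
  have hlog : 1 ≤ Real.logb 2 N := by
    rw [Real.le_logb_iff_rpow_le one_lt_two (by linarith)]
    simpa using hN'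
  have hpp : p₀ ≤ p := by
    have : (p₀ : ℝ) ≤ p := by
      refine le_trans ?_ hp
      have : (p₀ : ℝ) ≤ max 1 (max (p₀ : ℝ) (a / κ)) := (le_max_left _ _).trans (le_max_right _ _)
      nlinarith [Nat.cast_nonneg (α := ℝ) p₀]
    exact_mod_cast this
  have hap : a * Real.logb 2 N ≤ κ * p := by
    have h1 : a / κ ≤ max 1 (max (p₀ : ℝ) (a / κ)) := (le_max_right _ _).trans (le_max_right _ _)
    have h2 : a / κ * Real.logb 2 N ≤ p := (mul_le_mul_of_nonneg_right h1 (by linarith)).trans hp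
    rw [div_mul_eq_mul_div, div_le_iff₀ hκ] at h2
    linarith
  obtain ⟨⟨⟨b₀, hb₀⟩, hb⟩, hXp⟩ := hp₀ p hpp
  have hκp : 0 ≤ κ * p := by positivity
  refine ⟨(2 : ℝ) ^ (-(κ * p)), (2 : ℝ) ^ (κ * p), ⟨?_, by positivity, ?_, ?_⟩, hXp, ?_⟩
  · have := D.abs_round_sub_le p 0 b₀
    simpa [hb₀] using this
  · exact Real.rpow_le_one_of_one_le_of_nonpos one_le_two (by linarith)
  · intro x hx
    obtain ⟨b, hb⟩ := hb x hx
    exact (D.abs_round_sub_le p x b).trans hb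
  · have e : (N : ℝ) ^ a = (2 : ℝ) ^ (Real.logb 2 N * a) := by
      rw [Real.rpow_mul zero_le_two, Real.rpow_logb zero_lt_two (by norm_num) (by linarith),
        Real.rpow_natCast]
    rw [Real.rpow_neg zero_le_two, inv_mul_le_iff₀ (by positivity), mul_one, e]
    refine Real.rpow_le_rpow_of_exponent_le one_le_two ?_
    linarith

/-! ### The transformer for connectivity -/

/-- The named coordinates. -/
inductive Coord
  -- constants and token types
  | one | two | bos | bit | pad | ta | tb | edge | kc | kd
  -- counts, relative to the length of the word or of the prefix
  | ka | kb | v1 | v2 | v3 | va | vb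
  -- a unit vector very close to `(0, 1)`
  | t1 | t2 | b1 | b2
  -- the counts again, scaled, and with the sign of `bos`
  | d1 | d2 | d3 | g1 | g2 | g3
  -- hashes of the position and of its quotients by `n` and by `n ^ 2`
  | p1a | p1b | p2a | p2b | K1 | K2 | K3 | q1a | q1b | q2a | q2b
  -- divisibility flags, and summands for quotients and remainders
  | fl1 | fl2 | fp1 | fb1 | fp2 | b8 | o8 | y1 | y2 | m1 | m2 | c1 | c2 | c3
  -- quotients, remainders, and their hashes
  | e1a | eb | iba | ipa | ra | rb | e2a | e2b
  | E1a | E1b | E2a | E2b | R1 | R2 | IB1 | IB2 | IP1 | IP2 | S1 | S2 | T1 | T2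
  | IBk1 | IBk2 | IPk1 | IPk2 | Rk1 | Rk2
  -- diagonal flag, and the variables of the loop
  | dg | B | u | v | C | e | ans
  deriving DecidableEq

instance : Fintype Coord :=
  Fintype.ofEquiv (Fin 87) ⟨fun i => Coord.ofNat i, fun c => ⟨c.ctorIdx, by cases c <;> decide⟩,
    fun i => by revert i; decide, fun c => by cases c <;> rfl⟩

instance : Nonempty Coord := ⟨.one⟩

namespace Connectivity

open Coord

/-- The embedding of the tokens. -/
def embed (t : Token) : Coord → ℚ
  | one | t1 | t2 | ka => 1
  | two => 2
  | bos => match t with | .bos => 1 | _ => -1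
  | bit => match t with | .zero | .one => 1 | _ => -1
  | pad => match t with | .pad => 1 | _ => -1
  | ta => match t with | .a => 1 | _ => -1
  | tb => match t with | .b => 1 | _ => -1
  | edge => match t with | .one => 1 | _ => -1
  | kc | kd => match t with | .bos => 1 | _ => 0
  | kb => match t with | .bos => -1 | _ => 0
  | B => -1
  | _ => 0

/-- Adds `q` times the normalized coordinate `a` to the coordinate `c`. -/
def copy (a c : Coord) (q : ℚ) : List (Lin Coord × Lin Coord) :=
  [([(a, 1)], [(c, q)]), ([(a, -1)], [(c, -q)])]

def idleAtt : AttSpec Coord := ⟨[one], []⟩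

def idleFF : FFSpec Coord := ⟨[one], []⟩

/-- Writes the normalization of `(a, b)` to `(c, d)`. -/
def hashFF (a b c d : Coord) : FFSpec Coord := ⟨[a, b], copy a c 1 ++ copy b d 1⟩

/-- Five signs and the constant `2` have norm `3` at every position, so `3/2` times a sign plus
`3/4` times `two` is the indicator after normalization. The causal head yields `1 / (i + 1)`; the
others yield token frequencies. -/
def att0 : AttSpec Coord where
  mask := [bos, bit, pad, ta, tb, two]
  heads := [⟨true, [], [(bos, 3/2), (two, 3/4)], [(ka, -1), (kb, 1)]⟩,
    ⟨false, [], [(bos, 3/2), (two, 3/4)], [(v1, 1)]⟩,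
    ⟨false, [], [(bit, 3/2), (two, 3/4)], [(v2, 1)]⟩,
    ⟨false, [], [(pad, 3/2), (two, 3/4)], [(v3, 1)]⟩,
    ⟨false, [], [(ta, 3/2), (two, 3/4)], [(va, 1)]⟩,
    ⟨false, [], [(tb, 3/2), (two, 3/4)], [(vb, 1)]⟩]

/-- Starting from `1 / N`, each application of `x ↦ 1 - 1 / √(x² + 1)` roughly squares its argument.
Two of them here and in `ff1`, and a third one implicit in `b2`, give `b2 = 1 - thr` with `thr` of
order `N⁻⁸`. -/
def ff0 : FFSpec Coord := ⟨[v1, one], [([(one, 1)], [(t1, -1)])]⟩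

def ff1 : FFSpec Coord := ⟨[t1, one], [([(one, 1)], [(t2, -1)])]⟩

def ff2 : FFSpec Coord := ⟨[t2, one], [([(t2, 1)], [(b1, 1)]), ([(one, 1)], [(b2, 1)])]⟩

/-- `g` is `d` with the sign of `bos`: then `(g + d) / 2` selects BoS, while the norm of a vector
containing `g` and `d` is the same at all positions. -/
def ff3 : FFSpec Coord where
  mask := [v1, v2, v3, one, bos]
  neurons := [([(v1, 1)], [(d1, 1), (g1, -1)]), ([(v1, 1), (bos, 1), (one, -1)], [(g1, 2)]),
    ([(v2, 1)], [(d2, 1), (g2, -1)]), ([(v2, 1), (bos, 1), (one, -1)], [(g2, 2)]),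
    ([(v3, 1)], [(d3, 1), (g3, -1)]), ([(v3, 1), (bos, 1), (one, -1)], [(g3, 2)])]

/-- Averaging gives `1 - 2 / (i + 1) = (i - 1) / (i + 1)`. As the `d` are in the ratio `1 : n ^ 2 :
n ^ 3`, the pairs become positive multiples of `((i - 1) / n, 1)` and `((i - 1) / n ^ 2, 1)`. -/
def att4 : AttSpec Coord where
  mask := [g1, g2, g3, d1, d2, d3, one]
  heads := [⟨true, [], [(d1, 1)], [(p2a, 1)]⟩,
    ⟨true, [], [(d2, 1)], [(p1a, 1)]⟩,
    ⟨true, [], [(g1, 1/2), (d1, 1/2)], [(p2a, -2)]⟩,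
    ⟨true, [], [(g2, 1/2), (d2, 1/2)], [(p1a, -2), (p2b, 1)]⟩,
    ⟨true, [], [(g3, 1/2), (d3, 1/2)], [(p1b, 1)]⟩]

/-- The key is the hash of the position, except that BoS gets a direction `K3` of its own. The
inputs are nonnegative, so ReLU does not act. -/
def ff4 : FFSpec Coord where
  mask := [ka, kb, kc]
  neurons := [([(ka, 1)], [(K1, 1)]), ([(kb, 1)], [(K2, 1)]), ([(kc, 1)], [(K3, 1)])]

/-- A match scores `1` and BoS scores `b2 = 1 - thr`, before division by the norms. `b1` and `two`
are in the mask only to make the norm `3` everywhere; the value `-3 * bos` undoes this norm and is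
`1` off BoS. -/
def att7 : AttSpec Coord where
  mask := [K1, K2, K3, q1a, q1b, q2a, q2b, b1, b2, bos, two]
  heads := [
    ⟨false, [([(q1a, 1)], [(K1, 1)]), ([(q1b, 1)], [(K2, 1)]), ([(b2, 1)], [(K3, 1)])],
      [(bos, -3)], [(fl1, 1)]⟩,
    ⟨false, [([(q2a, 1)], [(K1, 1)]), ([(q2b, 1)], [(K2, 1)]), ([(b2, 1)], [(K3, 1)])],
      [(bos, -3)], [(fl2, 1)]⟩]

/-- Conjunctions of flags and products of flags with the `d`, all over a common norm. Again the
signed versions `y`, `m` are paired with unsigned `c` to keep the next norm independent of the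
position. -/
def ff7 : FFSpec Coord where
  mask := [fl1, fl2, bit, pad, bos, d1, d2, d3, one]
  neurons := [([(one, 1)], [(fp1, -1), (fb1, -1), (fp2, -1), (b8, -1), (o8, 1)]),
    ([(fl1, 1), (pad, 1), (one, -1)], [(fp1, 2)]),
    ([(fl1, 1), (bit, 1), (one, -1)], [(fb1, 2)]),
    ([(bos, 1)], [(fb1, 2), (b8, 2)]),
    ([(fl2, 1), (pad, 1), (one, -1)], [(fp2, 2)]),
    ([(d1, 1)], [(c1, 1), (m1, -1)]),
    ([(d2, 1)], [(c2, 1), (m2, -1), (y2, -1)]),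
    ([(d3, 1)], [(c3, 1), (y1, -1)]),
    ([(d3, 1), (fl1, 1), (one, -1)], [(y1, 2)]),
    ([(d2, 1), (fl2, 1), (one, -1)], [(y2, 2)]),
    ([(d1, 1), (bos, 1), (one, -1)], [(m1, 2)]),
    ([(d2, 1), (bos, 1), (one, -1)], [(m2, 2)])]

/-- Prefix averages are counts over `i + 1`, which is why each comes with a reference coordinate
holding the same factor. For the remainder modulo `n`, every position after BoS adds `d2` and every
multiple subtracts `d3 = n * d2`. -/
def att8 : AttSpec Coord where
  mask := [fp1, fb1, fp2, b8, o8, y1, y2, m1, m2, c1, c2, c3]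
  heads := [⟨true, [], [(fp1, 1/2), (o8, 1/2)], [(e1a, 1)]⟩,
    ⟨true, [], [(fb1, 1/2), (o8, 1/2)], [(iba, 1)]⟩,
    ⟨true, [], [(fp2, 1/2), (o8, 1/2)], [(ipa, 1)]⟩,
    ⟨true, [], [(b8, 1/2), (o8, 1/2)], [(eb, 1)]⟩,
    ⟨true, [], [(c2, 1/2), (m2, -1/2), (y1, -1/2), (c3, -1/2)], [(ra, 1)]⟩,
    ⟨true, [], [(c2, 1/2), (m2, 1/2)], [(rb, 1)]⟩,
    ⟨true, [], [(c1, 1/2), (m1, -1/2), (y2, -1/2), (c2, -1/2)], [(e2a, 1)]⟩,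
    ⟨true, [], [(c1, 1/2), (m1, 1/2)], [(e2b, 1)]⟩]

/-- Scores pair a query with a key, so row and column of the same position are compared through a
third number: both hashes must match the key `j`. A match scores `2`, BoS scores `1 + b2`. -/
def att15 : AttSpec Coord where
  mask := [K1, K2, K3, IB1, IB2, R1, R2, b1, b2, bos, two]
  heads := [⟨false, [([(IB1, 1), (R1, 1)], [(K1, 1)]), ([(IB2, 1), (R2, 1)], [(K2, 1)]),
    ([(two, 1/2), (b2, 1)], [(K3, 1)])], [(bos, -3)], [(dg, 1)]⟩]

/-- On bits the difference of the two ReLUs is `0` if neither flag holds and saturates at `2`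
otherwise; elsewhere the term `3 * bit` switches both neurons off. -/
def ff15 : FFSpec Coord where
  mask := [edge, dg, bit, one]
  neurons := [([(edge, 1), (dg, 1), (bit, 3), (one, -1)], [(B, 2)]),
    ([(edge, 1), (dg, 1), (bit, 3), (one, -3)], [(B, -2)])]

/-- Copies of the hashes that vanish at BoS, for use as keys: the score of BoS has to be a known
constant. Entries are at most `1`, so the neuron is off at BoS. -/
def ff16 : FFSpec Coord where
  mask := [IB1, IB2, IP1, IP2, R1, R2, bos, one, two]
  neurons := [([(IB1, 1), (bos, -1), (one, -1)], [(IBk1, 3)]),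
    ([(IB2, 1), (bos, -1), (one, -1)], [(IBk2, 3)]),
    ([(IP1, 1), (bos, -1), (one, -1)], [(IPk1, 3)]),
    ([(IP2, 1), (bos, -1), (one, -1)], [(IPk2, 3)]),
    ([(R1, 1), (bos, -1), (one, -1)], [(Rk1, 3)]),
    ([(R2, 1), (bos, -1), (one, -1)], [(Rk2, 3)])]

/-- A match scores `1 + 2`, and a lowered flag `B` costs `4`. BoS, where `B = -1`, scores `-2 + 4 +
b2 = 3 - thr`. `pad` and `bit` only fill the norm up to `3`. -/
def attA : AttSpec Coord where
  mask := [K1, K2, K3, E1a, E1b, E2a, E2b, b1, b2, B, bos, one, pad, bit]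
  heads := [
    ⟨false, [([(E1a, 1)], [(K1, 1)]), ([(E1b, 1)], [(K2, 1)]), ([(one, 2)], [(B, 1)]),
      ([(b2, 1), (one, 4)], [(K3, 1)])], [(bos, -3)], [(u, 1)]⟩,
    ⟨false, [([(E2a, 1)], [(K1, 1)]), ([(E2b, 1)], [(K2, 1)]), ([(one, 2)], [(B, 1)]),
      ([(b2, 1), (one, 4)], [(K3, 1)])], [(bos, -3)], [(v, 1)]⟩]

/-- The copies reset `u` and `v` to `0` for the next pass; their factor is minus the norm, which is
`2`. -/
def ffA : FFSpec Coord where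
  mask := [u, v, pad, one]
  neurons := [([(u, 1), (v, 1), (pad, 1), (one, -2)], [(C, 4)]), ([(one, 1)], [(C, -2)])] ++
    copy u u (-2) ++ copy v v (-2)

/-- Bits query padding tokens by first and last vertex. A match scores `1 + 1 + 3`; BoS scores `-3 +
7 + b2 = 5 - thr`. `kc` and `kd` replace the key hashes that vanish at BoS, keeping the norm at `3`.
-/
def attB : AttSpec Coord where
  mask := [IB1, IB2, R1, R2, IPk1, IPk2, kc, Rk1, Rk2, kd, b1, b2, C, bos, one, pad]
  heads := [⟨false, [([(IB1, 1)], [(IPk1, 1)]), ([(IB2, 1)], [(IPk2, 1)]), ([(R1, 1)], [(Rk1, 1)]),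
    ([(R2, 1)], [(Rk2, 1)]), ([(one, 3)], [(C, 1)]), ([(b2, 1), (one, 7)], [(kc, 1)])],
    [(bos, -3)], [(e, 1)]⟩]

def ffB : FFSpec Coord where
  mask := [e, bit, B, C, one, two]
  neurons := [([(e, 1), (bit, 1), (one, -1)], [(B, 6)]), ([(one, 1)], [(B, -3)])] ++
    copy B B (-3) ++ copy e e (-3) ++ copy C C (-3)

def attOut : AttSpec Coord where
  mask := [S1, S2, T1, T2, IBk1, IBk2, kc, Rk1, Rk2, kd, b1, b2, B, bos, one, pad]
  heads := [⟨false, [([(S1, 1)], [(IBk1, 1)]), ([(S2, 1)], [(IBk2, 1)]), ([(T1, 1)], [(Rk1, 1)]),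
    ([(T2, 1)], [(Rk2, 1)]), ([(one, 3)], [(B, 1)]), ([(b2, 1), (one, 7)], [(kc, 1)])],
    [(bos, -3)], [(ans, 1)]⟩]

def transformer : TransformerSpec Coord Token where
  embed := embed
  initial := [⟨att0, ff0⟩, ⟨idleAtt, ff1⟩, ⟨idleAtt, ff2⟩, ⟨idleAtt, ff3⟩, ⟨att4, ff4⟩,
    ⟨idleAtt, hashFF p1a p1b q1a q1b⟩, ⟨idleAtt, hashFF p2a p2b q2a q2b⟩, ⟨att7, ff7⟩,
    ⟨att8, hashFF e1a eb E1a E1b⟩, ⟨idleAtt, hashFF e2a e2b E2a E2b⟩,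
    ⟨idleAtt, hashFF ra rb R1 R2⟩, ⟨idleAtt, hashFF iba eb IB1 IB2⟩,
    ⟨idleAtt, hashFF ipa eb IP1 IP2⟩, ⟨idleAtt, hashFF va v1 S1 S2⟩,
    ⟨idleAtt, hashFF vb v1 T1 T2⟩, ⟨att15, ff15⟩, ⟨idleAtt, ff16⟩]
  repeated := [⟨attA, ffA⟩, ⟨attB, ffB⟩]
  final := [⟨attOut, idleFF⟩]
  -- `ans = ±1` competes with the score `0` of `bos`, and all the other tokens have `-2`, so the
  -- winner leads by at least `1`.
  unembed
    | .accept => [(ans, 1)]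
    | .bos => []
    | _ => [(one, -2)]

theorem fits {L : LayerSpec Coord} (h : L ∈ transformer.initial ++ transformer.repeated ++
    transformer.final) : L.Fits 12 := by
  have hc : headCount Coord = 87 := (Fintype.ofEquiv_card _).trans (Fintype.card_fin 87)
  have hd : headDim Coord = 174 := by
    rw [headDim, Fintype.card_prod, show Fintype.card Coord = 87 from hc, Fintype.card_bool]
  have key : ∀ L ∈ transformer.initial ++ transformer.repeated ++ transformer.final,
      L.att.mask.Nodup ∧ L.att.heads.length ≤ 87 ∧ (∀ H ∈ L.att.heads, H.qk.length ≤ 174) ∧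
      L.ff.mask.Nodup ∧ L.ff.neurons.length ≤ 12 := by
    simp only [transformer, List.cons_append, List.nil_append, List.forall_mem_cons]
    refine ⟨?_, ?_, ?_, ?_, ?_, ?_, ?_, ?_, ?_, ?_, ?_, ?_, ?_, ?_, ?_, ?_, ?_, ?_, ?_, ?_, ?_⟩
    iterate 20 exact ⟨by decide, by decide, by decide, by decide, by decide⟩
    simp
  obtain ⟨h1, h2, h3, h4, h5⟩ := key L h
  exact ⟨h1, by rw [hc]; exact h2, by rw [hd]; exact h3, h4, h5⟩

def T : UniversalTransformer Token 17 2 1 (headCount Coord) (headDim Coord) 12 :=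
  transformer.compile 12

end Connectivity

/-! ### Hashes -/

/-- With `hash₂`, the unit vector in the direction `(x, 1)`; it is unaffected by rescaling that
direction. -/
def hash₁ (x : ℝ) : ℝ := x / √(x ^ 2 + 1)

def hash₂ (x : ℝ) : ℝ := 1 / √(x ^ 2 + 1)

theorem sqrt_sq_add_one_pos (x : ℝ) : 0 < √(x ^ 2 + 1) := Real.sqrt_pos.2 (by positivity)

theorem hash_sq (x : ℝ) : hash₁ x ^ 2 + hash₂ x ^ 2 = 1 := by
  have h := sqrt_sq_add_one_pos x
  have h2 : √(x ^ 2 + 1) ^ 2 = x ^ 2 + 1 := Real.sq_sqrt (by positivity)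
  rw [hash₁, hash₂, div_pow, div_pow, h2]
  field_simp

theorem hash₁_nonneg {x : ℝ} (hx : 0 ≤ x) : 0 ≤ hash₁ x := div_nonneg hx (Real.sqrt_nonneg _)

theorem hash₂_pos (x : ℝ) : 0 < hash₂ x := div_pos one_pos (sqrt_sq_add_one_pos x)

theorem hash₁_le_one (x : ℝ) : hash₁ x ≤ 1 := by
  have := hash_sq x
  nlinarith [sq_nonneg (hash₂ x)]

theorem hash₂_le_one (x : ℝ) : hash₂ x ≤ 1 := by
  have := hash_sq x
  nlinarith [sq_nonneg (hash₁ x)]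

theorem hash_dot_self (x : ℝ) : hash₁ x * hash₁ x + hash₂ x * hash₂ x = 1 := by
  have := hash_sq x
  linarith

theorem hash_dot_le_one (x y : ℝ) : hash₁ x * hash₁ y + hash₂ x * hash₂ y ≤ 1 := by
  nlinarith [hash_sq x, hash_sq y, sq_nonneg (hash₁ x - hash₁ y), sq_nonneg (hash₂ x - hash₂ y)]

/-- With `a`, `b` the lengths of `(x, 1)` and `(y, 1)`, Lagrange's identity gives `(ab)² - (xy + 1)²
= (x - y)²`. Hence one minus the cosine is at least `(x - y)² / (2 (ab)²)`, where `ab ≤ 4 N²`. -/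
theorem hash_dot_le {x y N : ℝ} (hN : 0 < N) (hx : x ^ 2 + 1 ≤ (2 * N) ^ 2)
    (hy : y ^ 2 + 1 ≤ (2 * N) ^ 2) (hxy : 1 / N ≤ |x - y|) :
    hash₁ x * hash₁ y + hash₂ x * hash₂ y ≤ 1 - 1 / (32 * N ^ 6) := by
  have ha := sqrt_sq_add_one_pos x
  have hb := sqrt_sq_add_one_pos y
  have ha2 : √(x ^ 2 + 1) ^ 2 = x ^ 2 + 1 := Real.sq_sqrt (by positivity)
  have hb2 : √(y ^ 2 + 1) ^ 2 = y ^ 2 + 1 := Real.sq_sqrt (by positivity)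
  have h1 := hash_dot_le_one x y
  have e : hash₁ x * hash₁ y + hash₂ x * hash₂ y = (x * y + 1) / (√(x ^ 2 + 1) * √(y ^ 2 + 1)) := by
    rw [hash₁, hash₁, hash₂, hash₂]
    field_simp
  rw [e] at h1 ⊢
  generalize √(x ^ 2 + 1) = a at *
  generalize √(y ^ 2 + 1) = b at *
  have hab : 0 < a * b := mul_pos ha hb
  rw [div_le_one hab] at h1
  have h2 : (a * b) ^ 2 - (x * y + 1) ^ 2 = (x - y) ^ 2 := by
    rw [mul_pow, ha2, hb2]; ring
  have h3 : (1 / N) ^ 2 ≤ (x - y) ^ 2 := by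
    rw [← sq_abs (x - y)]
    gcongr
  have h4 : (a * b) ^ 2 ≤ (2 * N) ^ 2 * (2 * N) ^ 2 := by
    rw [mul_pow, ha2, hb2]
    exact mul_le_mul hx hy (by positivity) (by positivity)
  have h5 : (x - y) ^ 2 ≤ (a * b - (x * y + 1)) * (2 * (a * b)) := by
    rw [← h2]
    nlinarith
  rw [div_le_iff₀ hab]
  have h6 : 1 / (32 * N ^ 6) * (a * b) * (2 * (a * b)) ≤ (1 / N) ^ 2 := by
    have : 1 / (32 * N ^ 6) * (a * b) * (2 * (a * b)) = (a * b) ^ 2 / (16 * N ^ 6) := by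
      field_simp; norm_num
    rw [this, div_le_iff₀ (by positivity)]
    refine h4.trans_eq ?_
    field_simp
    norm_num
  have h7 : 1 / (32 * N ^ 6) * (a * b) * (2 * (a * b)) ≤ (a * b - (x * y + 1)) * (2 * (a * b)) :=
    h6.trans (h3.trans h5)
  have h8 := le_of_mul_le_mul_right h7 (by positivity)
  linarith

theorem one_sub_hash₂_le (x : ℝ) : 1 - hash₂ x ≤ x ^ 2 / 2 := by
  have hr := sqrt_sq_add_one_pos x
  have h2 : √(x ^ 2 + 1) ^ 2 = x ^ 2 + 1 := Real.sq_sqrt (by positivity)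
  rw [hash₂]
  generalize √(x ^ 2 + 1) = r at *
  have hr1 : 1 ≤ r := by nlinarith [sq_nonneg x]
  rw [sub_le_iff_le_add, ← sub_le_iff_le_add', le_div_iff₀ hr]
  have : x ^ 2 = r ^ 2 - 1 := by linarith
  rw [this]
  nlinarith [mul_nonneg (sub_nonneg.2 hr1) (sub_nonneg.2 hr1)]

theorem le_one_sub_hash₂ {x : ℝ} (h0 : 0 ≤ x) (h1 : x ≤ 1) : x ^ 2 / 4 ≤ 1 - hash₂ x := by
  have hr := sqrt_sq_add_one_pos x
  have h2 : √(x ^ 2 + 1) ^ 2 = x ^ 2 + 1 := Real.sq_sqrt (by positivity)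
  rw [hash₂]
  generalize √(x ^ 2 + 1) = r at *
  have hr1 : 1 ≤ r := by nlinarith [sq_nonneg x]
  have hr2 : r ≤ 3 / 2 := by nlinarith
  rw [le_sub_iff_add_le, ← le_sub_iff_add_le', div_le_iff₀ hr]
  have : x ^ 2 = r ^ 2 - 1 := by linarith
  rw [this]
  nlinarith [mul_nonneg (sub_nonneg.2 hr1) (sub_nonneg.2 hr2)]

/-- The real number `1` or `-1`, according to the truth of `p`. -/
def sgn (p : Prop) : ℝ := open Classical in if p then 1 else -1

theorem sgn_true {p : Prop} (h : p) : sgn p = 1 := by simp [sgn, h]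

theorem sgn_false {p : Prop} (h : ¬p) : sgn p = -1 := by simp [sgn, h]

@[simp] theorem sgn_sq (p : Prop) : sgn p ^ 2 = 1 := by
  by_cases h : p <;> simp [sgn, h]

namespace Connectivity

/-! ### Instances and the values of the coordinates -/

/-- A graph on `{0, …, n - 1}` with a source and a target. -/
structure Inst where
  n : ℕ
  s : ℕ
  t : ℕ
  adj : ℕ → ℕ → Prop
  hs : s < n
  ht : t < n

namespace Inst

variable (I : Inst)

/-- The length of the input word. -/
def N : ℕ := I.n ^ 2 + I.n ^ 3 + I.s + I.t + 3

def IsBit (i : ℕ) : Prop := 1 ≤ i ∧ i ≤ I.n ^ 2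

def IsPad (i : ℕ) : Prop := I.n ^ 2 < i ∧ i ≤ I.n ^ 2 + I.n ^ 3

def IsA (i : ℕ) : Prop := I.n ^ 2 + I.n ^ 3 < i ∧ i ≤ I.n ^ 2 + I.n ^ 3 + (I.s + 1)

def IsB (i : ℕ) : Prop := I.n ^ 2 + I.n ^ 3 + (I.s + 1) < i

def IsEdge (i : ℕ) : Prop := I.IsBit i ∧ I.adj ((i - 1) / I.n) ((i - 1) % I.n)

open Classical in
/-- The input word. -/
def tok (i : ℕ) : Token :=
  if i = 0 then .bos else if i ≤ I.n ^ 2 then (if I.IsEdge i then .one else .zero)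
  else if i ≤ I.n ^ 2 + I.n ^ 3 then .pad
  else if i ≤ I.n ^ 2 + I.n ^ 3 + (I.s + 1) then .a else .b

/-- The number of positions up to `i` at which `P` holds. -/
def cnt (P : ℕ → Prop) (i : ℕ) : ℕ := open Classical in ((Finset.range (i + 1)).filter P).card

/-- The quotient is recognized as a position `j > 0`, since `j = 0` is BoS. This excludes `i = 1`.
-/
def F1 (i : ℕ) : Prop := 1 < i ∧ I.n ∣ i - 1

def F2 (i : ℕ) : Prop := 1 < i ∧ I.n ^ 2 ∣ i - 1

/-- At the padding token for `(a, m, c)`, `e1` and `e2` are the positions of the bits `(a, m)` and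
`(m, c)`, and `ip` is `a + 1`. At the bit for `(a, c)`, `ib` is `a + 1`. At both, `kn` is `c + 1`.
-/
def e1 (i : ℕ) : ℕ := cnt (fun j => I.F1 j ∧ I.IsPad j) i

/-- BoS is counted in place of the first bit, at which `F1` fails. -/
def ib (i : ℕ) : ℕ := cnt (fun j => (I.F1 j ∧ I.IsBit j) ∨ j = 0) i

def ip (i : ℕ) : ℕ := cnt (fun j => I.F2 j ∧ I.IsPad j) i

def kn (i : ℕ) : ℕ := if i = 0 then 0 else (i - 1) % I.n + 1

def e2 (i : ℕ) : ℕ := if i = 0 then 0 else (i - 1) % I.n ^ 2 + 1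

def Dg (i : ℕ) : Prop := ∃ j, 0 < j ∧ j < I.N ∧ (i ≠ 0 ∧ I.ib i = j ∧ I.kn i = j)

def B0 (i : ℕ) : Prop := I.IsBit i ∧ (I.IsEdge i ∨ I.Dg i)

def w1 : ℝ := 1 / I.N
def w2 : ℝ := I.n ^ 2 / I.N
def w3 : ℝ := I.n ^ 3 / I.N
def θ1 : ℝ := 1 - hash₂ I.w1
def θ2 : ℝ := 1 - hash₂ I.θ1
def thr : ℝ := 1 - hash₂ I.θ2
-- The norms of the sublayers 7, 8, 15 and 16. None depends on the position, so averages over a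
-- prefix are exact counts up to a common factor.
def ρ3 : ℝ := √(I.w1 ^ 2 + I.w2 ^ 2 + I.w3 ^ 2 + 2)
def D1 : ℝ := I.w1 / I.ρ3
def D2 : ℝ := I.w2 / I.ρ3
def D3 : ℝ := I.w3 / I.ρ3
def ρ4 : ℝ := √(2 * (I.D1 ^ 2 + I.D2 ^ 2 + I.D3 ^ 2) + 1)
def ρ7 : ℝ := √(6 + I.D1 ^ 2 + I.D2 ^ 2 + I.D3 ^ 2)
def ρ8 : ℝ := √((5 + 2 * I.D1 ^ 2 + 3 * I.D2 ^ 2 + 2 * I.D3 ^ 2) / I.ρ7 ^ 2)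

end Inst

open Coord

/-- The sublayer that computes a coordinate; `100` for the coordinates that the initial layers do
not change. -/
def time : Coord → ℕ
  -- Layer `l`, counted from `0`, consists of the sublayers `2l` (attention) and `2l + 1`
  -- (feedforward). Within the initial layers each coordinate is written by one sublayer only.
  | ka | kb | v1 | v2 | v3 | va | vb => 0
  | t1 => 1
  | t2 => 3
  | b1 | b2 => 5
  | d1 | d2 | d3 | g1 | g2 | g3 => 7
  | p1a | p1b | p2a | p2b => 8
  | K1 | K2 | K3 => 9
  | q1a | q1b => 11
  | q2a | q2b => 13
  | fl1 | fl2 => 14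
  | fp1 | fb1 | fp2 | b8 | o8 | y1 | y2 | m1 | m2 | c1 | c2 | c3 => 15
  | e1a | eb | iba | ipa | ra | rb | e2a | e2b => 16
  | E1a | E1b => 17
  | E2a | E2b => 19
  | R1 | R2 => 21
  | IB1 | IB2 => 23
  | IP1 | IP2 => 25
  | S1 | S2 => 27
  | T1 | T2 => 29
  | dg => 30
  | B => 31
  | IBk1 | IBk2 | IPk1 | IPk2 | Rk1 | Rk2 => 33
  | _ => 100

/-- The values of the coordinates in the embedding. -/
def init (I : Inst) (i : ℕ) : Coord → ℝ
  | one | t1 | t2 | ka => 1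
  | two => 2
  | bos => sgn (i = 0)
  | bit => sgn (I.IsBit i)
  | pad => sgn (I.IsPad i)
  | ta => sgn (I.IsA i)
  | tb => sgn (I.IsB i)
  | edge => sgn (I.IsEdge i)
  | kc | kd => if i = 0 then 1 else 0
  | kb => if i = 0 then -1 else 0
  | B => -1
  | _ => 0

/-- The values of the coordinates after the initial layers. -/
def val (I : Inst) (i : ℕ) : Coord → ℝ
  | ka => i / (i + 1)
  | kb => if i = 0 then 0 else 1 / (i + 1)
  | v1 => I.w1
  | v2 => I.w2
  | v3 => I.w3
  | va => I.w1 * (I.s + 1 : ℕ)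
  | vb => I.w1 * (I.t + 1 : ℕ)
  | t1 => I.θ1
  | t2 => I.θ2
  | b1 => hash₁ I.θ2
  | b2 => hash₂ I.θ2
  | d1 => I.D1
  | d2 => I.D2
  | d3 => I.D3
  | g1 => sgn (i = 0) * I.D1
  | g2 => sgn (i = 0) * I.D2
  | g3 => sgn (i = 0) * I.D3
  | p1a => I.D3 / ((i + 1) * I.ρ4) * ((i - 1) / I.n)
  | p1b => I.D3 / ((i + 1) * I.ρ4)
  | p2a => I.D2 / ((i + 1) * I.ρ4) * ((i - 1) / I.n ^ 2)
  | p2b => I.D2 / ((i + 1) * I.ρ4)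
  | K1 => if i = 0 then 0 else hash₁ i
  | K2 => if i = 0 then 0 else hash₂ i
  | K3 => if i = 0 then 1 else 0
  | q1a => hash₁ ((i - 1) / I.n)
  | q1b => hash₂ ((i - 1) / I.n)
  | q2a => hash₁ ((i - 1) / I.n ^ 2)
  | q2b => hash₂ ((i - 1) / I.n ^ 2)
  | fl1 => sgn (I.F1 i)
  | fl2 => sgn (I.F2 i)
  | fp1 => sgn (I.F1 i ∧ I.IsPad i) / I.ρ7
  | fb1 => sgn ((I.F1 i ∧ I.IsBit i) ∨ i = 0) / I.ρ7
  | fp2 => sgn (I.F2 i ∧ I.IsPad i) / I.ρ7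
  | b8 => sgn (i = 0) / I.ρ7
  | o8 => 1 / I.ρ7
  | y1 => sgn (I.F1 i) * I.D3 / I.ρ7
  | y2 => sgn (I.F2 i) * I.D2 / I.ρ7
  | m1 => sgn (i = 0) * I.D1 / I.ρ7
  | m2 => sgn (i = 0) * I.D2 / I.ρ7
  | c1 => I.D1 / I.ρ7
  | c2 => I.D2 / I.ρ7
  | c3 => I.D3 / I.ρ7
  | e1a => 1 / (I.ρ7 * I.ρ8 * (i + 1)) * I.e1 i
  | iba => 1 / (I.ρ7 * I.ρ8 * (i + 1)) * I.ib i
  | ipa => 1 / (I.ρ7 * I.ρ8 * (i + 1)) * I.ip i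
  | eb => 1 / (I.ρ7 * I.ρ8 * (i + 1))
  | ra => I.D2 / (I.ρ7 * I.ρ8 * (i + 1)) * I.kn i
  | rb => I.D2 / (I.ρ7 * I.ρ8 * (i + 1))
  | e2a => I.D1 / (I.ρ7 * I.ρ8 * (i + 1)) * I.e2 i
  | e2b => I.D1 / (I.ρ7 * I.ρ8 * (i + 1))
  | E1a => hash₁ (I.e1 i)
  | E1b => hash₂ (I.e1 i)
  | E2a => hash₁ (I.e2 i)
  | E2b => hash₂ (I.e2 i)
  | R1 => hash₁ (I.kn i)
  | R2 => hash₂ (I.kn i)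
  | IB1 => hash₁ (I.ib i)
  | IB2 => hash₂ (I.ib i)
  | IP1 => hash₁ (I.ip i)
  | IP2 => hash₂ (I.ip i)
  | S1 => hash₁ (I.s + 1 : ℕ)
  | S2 => hash₂ (I.s + 1 : ℕ)
  | T1 => hash₁ (I.t + 1 : ℕ)
  | T2 => hash₂ (I.t + 1 : ℕ)
  | dg => sgn (I.Dg i)
  | B => sgn (I.B0 i)
  | IBk1 => if i = 0 then 0 else hash₁ (I.ib i)
  | IBk2 => if i = 0 then 0 else hash₂ (I.ib i)
  | IPk1 => if i = 0 then 0 else hash₁ (I.ip i)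
  | IPk2 => if i = 0 then 0 else hash₂ (I.ip i)
  | Rk1 => if i = 0 then 0 else hash₁ (I.kn i)
  | Rk2 => if i = 0 then 0 else hash₂ (I.kn i)
  | c => init I i c

/-- The values of the coordinates after the first `k` sublayers. -/
def st (I : Inst) (k i : ℕ) (c : Coord) : ℝ :=
  if time c < k then val I i c else init I i c

/-! ### Estimates for norms, thresholds and margins -/

namespace Inst

variable (I : Inst)

theorem n_pos : 0 < I.n := I.hs.pos

theorem N_ge : 5 ≤ I.N := by
  have h1 := Nat.pow_pos (n := 2) I.n_pos
  have h2 := Nat.pow_pos (n := 3) I.n_pos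
  unfold N
  omega

theorem N_real_ge : (5 : ℝ) ≤ I.N := by exact_mod_cast I.N_ge

theorem sq_lt_N : I.n ^ 2 < I.N := by unfold N; omega

theorem cube_lt_N : I.n ^ 3 < I.N := by unfold N; omega

theorem w1_pos : 0 < I.w1 := by
  have := I.N_real_ge
  unfold w1; positivity

theorem w2_pos : 0 < I.w2 := by
  have := I.N_real_ge
  have : (0 : ℝ) < I.n := Nat.cast_pos.2 I.n_pos
  unfold w2; positivity

theorem w3_pos : 0 < I.w3 := by
  have := I.N_real_ge
  have : (0 : ℝ) < I.n := Nat.cast_pos.2 I.n_pos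
  unfold w3; positivity

theorem w1_le : I.w1 ≤ 1 := by
  have := I.N_real_ge
  unfold w1
  rw [div_le_one (by linarith)]; linarith

theorem w2_le : I.w2 ≤ 1 := by
  have := I.N_real_ge
  unfold w2
  rw [div_le_one (by linarith)]
  exact_mod_cast I.sq_lt_N.le

theorem w3_le : I.w3 ≤ 1 := by
  have := I.N_real_ge
  unfold w3
  rw [div_le_one (by linarith)]
  exact_mod_cast I.cube_lt_N.le

theorem ρ3_sq : I.ρ3 ^ 2 = I.w1 ^ 2 + I.w2 ^ 2 + I.w3 ^ 2 + 2 := Real.sq_sqrt (by positivity)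

theorem one_le_ρ3 : 1 ≤ I.ρ3 := by
  unfold ρ3
  rw [Real.one_le_sqrt]
  nlinarith [sq_nonneg I.w1, sq_nonneg I.w2, sq_nonneg I.w3]

theorem ρ3_le : I.ρ3 ≤ 3 := by
  refine Real.sqrt_le_iff.2 ⟨by norm_num, ?_⟩
  nlinarith [I.w1_le, I.w2_le, I.w3_le, I.w1_pos, I.w2_pos, I.w3_pos]

theorem D_bound {w : ℝ} (h0 : 0 < w) (h1 : w ≤ 1) : 0 < w / I.ρ3 ∧ w / I.ρ3 ≤ 1 := by
  have := I.one_le_ρ3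
  exact ⟨by positivity, by rw [div_le_one (by linarith)]; linarith⟩

theorem D1_pos : 0 < I.D1 := (I.D_bound I.w1_pos I.w1_le).1
theorem D2_pos : 0 < I.D2 := (I.D_bound I.w2_pos I.w2_le).1
theorem D3_pos : 0 < I.D3 := (I.D_bound I.w3_pos I.w3_le).1
theorem D1_le : I.D1 ≤ 1 := (I.D_bound I.w1_pos I.w1_le).2
theorem D2_le : I.D2 ≤ 1 := (I.D_bound I.w2_pos I.w2_le).2
theorem D3_le : I.D3 ≤ 1 := (I.D_bound I.w3_pos I.w3_le).2

theorem D1_mul : I.D1 * (I.n : ℝ) ^ 2 = I.D2 := by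
  simp only [D1, D2, w1, w2]; ring

theorem D2_mul : I.D2 * (I.n : ℝ) = I.D3 := by
  simp only [D3, D2, w3, w2]; ring

theorem D1_ge : 1 / (3 * I.N) ≤ I.D1 := by
  have := I.N_real_ge
  have h1 := I.one_le_ρ3
  have h2 := I.ρ3_le
  rw [D1, w1, div_div, mul_comm 3]
  gcongr

theorem D2_ge : 1 / (3 * I.N) ≤ I.D2 := by
  refine I.D1_ge.trans ?_
  have : (1 : ℝ) ≤ I.n := Nat.one_le_cast.2 I.n_pos
  rw [← I.D1_mul]
  exact le_mul_of_one_le_right I.D1_pos.le (one_le_pow₀ this)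

theorem D3_ge : 1 / (3 * I.N) ≤ I.D3 := by
  refine I.D2_ge.trans ?_
  have : (1 : ℝ) ≤ I.n := Nat.one_le_cast.2 I.n_pos
  rw [← I.D2_mul]
  exact le_mul_of_one_le_right I.D2_pos.le this

theorem ρ4_sq : I.ρ4 ^ 2 = 2 * (I.D1 ^ 2 + I.D2 ^ 2 + I.D3 ^ 2) + 1 := Real.sq_sqrt (by positivity)

theorem one_le_ρ4 : 1 ≤ I.ρ4 := by
  unfold ρ4
  rw [Real.one_le_sqrt]
  nlinarith [sq_nonneg I.D1, sq_nonneg I.D2, sq_nonneg I.D3]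

theorem ρ4_le : I.ρ4 ≤ 3 := by
  refine Real.sqrt_le_iff.2 ⟨by norm_num, ?_⟩
  nlinarith [I.D1_le, I.D2_le, I.D3_le, I.D1_pos, I.D2_pos, I.D3_pos]

theorem ρ7_sq : I.ρ7 ^ 2 = 6 + I.D1 ^ 2 + I.D2 ^ 2 + I.D3 ^ 2 := Real.sq_sqrt (by positivity)

theorem one_le_ρ7 : 1 ≤ I.ρ7 := by
  unfold ρ7
  rw [Real.one_le_sqrt]
  nlinarith [sq_nonneg I.D1, sq_nonneg I.D2, sq_nonneg I.D3]

theorem ρ7_le : I.ρ7 ≤ 3 := by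
  refine Real.sqrt_le_iff.2 ⟨by norm_num, ?_⟩
  nlinarith [I.D1_le, I.D2_le, I.D3_le, I.D1_pos, I.D2_pos, I.D3_pos]

theorem ρ8_sq : I.ρ8 ^ 2 = (5 + 2 * I.D1 ^ 2 + 3 * I.D2 ^ 2 + 2 * I.D3 ^ 2) / I.ρ7 ^ 2 :=
  Real.sq_sqrt (by positivity)

theorem ρ8_pos : 0 < I.ρ8 := by
  have := I.one_le_ρ7
  exact Real.sqrt_pos.2 (by positivity)

theorem ρ8_le : I.ρ8 ≤ 3 := by
  have := I.one_le_ρ7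
  refine Real.sqrt_le_iff.2 ⟨by norm_num, ?_⟩
  rw [I.ρ7_sq, div_le_iff₀ (by positivity)]
  nlinarith [sq_nonneg I.D1, sq_nonneg I.D2, sq_nonneg I.D3]

theorem ρ8_ge : 1 / 3 ≤ I.ρ8 := by
  have h1 := I.one_le_ρ7
  have h2 := I.ρ7_le
  refine Real.le_sqrt_of_sq_le ?_
  rw [le_div_iff₀ (by positivity)]
  nlinarith [sq_nonneg I.D1, sq_nonneg I.D2, sq_nonneg I.D3]

theorem θ1_bounds : 1 / (4 * (I.N : ℝ) ^ 2) ≤ I.θ1 ∧ I.θ1 ≤ 1 / (2 * (I.N : ℝ) ^ 2) := by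
  have := I.N_real_ge
  have h1 := le_one_sub_hash₂ I.w1_pos.le I.w1_le
  have h2 := one_sub_hash₂_le I.w1
  have e : I.w1 ^ 2 = 1 / (I.N : ℝ) ^ 2 := by rw [w1, div_pow, one_pow]
  rw [e, div_div, mul_comm] at h1 h2
  exact ⟨h1, h2⟩

theorem θ2_bounds : 1 / (64 * (I.N : ℝ) ^ 4) ≤ I.θ2 ∧ I.θ2 ≤ 1 / (8 * (I.N : ℝ) ^ 4) := by
  have hN := I.N_real_ge
  obtain ⟨h1, h2⟩ := I.θ1_bounds
  have h0 : 0 ≤ I.θ1 := le_trans (by positivity) h1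
  have h3 : I.θ1 ≤ 1 := h2.trans (by rw [div_le_one (by positivity)]; nlinarith)
  refine ⟨le_trans ?_ (le_one_sub_hash₂ h0 h3), (one_sub_hash₂_le I.θ1).trans ?_⟩
  · calc _ = (1 / (4 * (I.N : ℝ) ^ 2)) ^ 2 / 4 := by field_simp; norm_num
      _ ≤ _ := by gcongr
  · calc _ ≤ (1 / (2 * (I.N : ℝ) ^ 2)) ^ 2 / 2 := by gcongr
      _ = _ := by field_simp; norm_num

theorem thr_bounds : 1 / (16384 * (I.N : ℝ) ^ 8) ≤ I.thr ∧ I.thr ≤ 1 / (128 * (I.N : ℝ) ^ 8) := by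
  have hN := I.N_real_ge
  obtain ⟨h1, h2⟩ := I.θ2_bounds
  have h0 : 0 ≤ I.θ2 := le_trans (by positivity) h1
  have h4 : (1 : ℝ) ≤ (I.N : ℝ) ^ 4 := one_le_pow₀ (by linarith)
  have h3 : I.θ2 ≤ 1 := h2.trans (by rw [div_le_one (by positivity)]; linarith)
  refine ⟨le_trans ?_ (le_one_sub_hash₂ h0 h3), (one_sub_hash₂_le I.θ2).trans ?_⟩
  · calc _ = (1 / (64 * (I.N : ℝ) ^ 4)) ^ 2 / 4 := by field_simp; norm_num
      _ ≤ _ := by gcongr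
  · calc _ ≤ (1 / (8 * (I.N : ℝ) ^ 4)) ^ 2 / 2 := by gcongr
      _ = _ := by field_simp; norm_num

theorem θ2_nonneg : 0 ≤ I.θ2 := sub_nonneg.2 (hash₂_le_one _)

/-- The margin of the attention heads. -/
def γ : ℝ := 1 / (I.N : ℝ) ^ 16

/-- Scores are divided by `9`, the product of two norms `3`. This lemma puts BoS at least `γ` below
a match, and the next one puts it at least `γ` above a mismatch. -/
theorem γ_le_thr : I.γ ≤ I.thr / 9 := by
  have hN := I.N_real_ge
  have h := I.thr_bounds.1
  have h2 : I.γ ≤ 1 / (16384 * (I.N : ℝ) ^ 8) / 9 := by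
    rw [γ, div_div]
    apply one_div_le_one_div_of_le (by positivity)
    have : (5 : ℝ) ^ 8 ≤ (I.N : ℝ) ^ 8 := by gcongr
    have e : (I.N : ℝ) ^ 16 = (I.N : ℝ) ^ 8 * (I.N : ℝ) ^ 8 := by ring
    rw [e]
    have : 0 < (I.N : ℝ) ^ 8 := by positivity
    nlinarith
  linarith

theorem γ_add_thr_le : I.γ + I.thr / 9 ≤ 1 / (32 * (I.N : ℝ) ^ 6) / 9 := by
  have hN := I.N_real_ge
  have h := I.thr_bounds.2
  have h1 := I.γ_le_thr
  have h2 : 2 * (1 / (128 * (I.N : ℝ) ^ 8)) ≤ 1 / (32 * (I.N : ℝ) ^ 6) := by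
    have e : 2 * (1 / (128 * (I.N : ℝ) ^ 8)) = 1 / (64 * (I.N : ℝ) ^ 8) := by
      field_simp; norm_num
    rw [e]
    apply one_div_le_one_div_of_le (by positivity)
    have e2 : (I.N : ℝ) ^ 8 = (I.N : ℝ) ^ 6 * (I.N : ℝ) ^ 2 := by ring
    rw [e2]
    have : 1 ≤ (I.N : ℝ) ^ 2 := one_le_pow₀ (by linarith)
    have : 0 < (I.N : ℝ) ^ 6 := by positivity
    nlinarith
  linarith

end Inst

end Connectivity

/-! ### Verification of sublayers -/

section Sublayers


theorem nrm_eq {κ : Type} {S : List κ} {f : κ → ℝ} {R : ℝ} (hR : 0 < R)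
    (h : (S.map fun c => f c ^ 2).sum = R ^ 2) : nrm S f = R := by
  rw [nrm, h, Real.sqrt_sq hR.le]

theorem abs_le_nrm {κ : Type} {S : List κ} {f : κ → ℝ} {c : κ} (hc : c ∈ S) : |f c| ≤ nrm S f := by
  rw [nrm, ← Real.sqrt_sq_eq_abs]
  refine Real.sqrt_le_sqrt (List.single_le_sum ?_ _ (List.mem_map_of_mem hc))
  simp only [List.mem_map]
  rintro _ ⟨c, -, rfl⟩
  positivity

theorem Lin.eval_congr {κ : Type} {l : Lin κ} {f g : κ → ℝ} (h : ∀ q ∈ l, f q.1 = g q.1) :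
    l.eval f = l.eval g := by
  rw [Lin.eval, Lin.eval]
  exact congrArg List.sum (List.map_congr_left fun q hq => by rw [h q hq])

theorem Lin.eval_unit {κ : Type} [DecidableEq κ]
    {l : Lin κ} {S : List κ} {f : κ → ℝ} (h : ∀ q ∈ l, q.1 ∈ S) :
    l.eval (unit S f) = l.eval f / nrm S f := by
  rw [Lin.eval_congr (g := fun c => (nrm S f)⁻¹ * f c)
    fun q hq => by rw [unit, if_pos (h q hq), div_eq_inv_mul]]
  rw [Lin.eval, Lin.eval, div_eq_inv_mul, ← List.sum_map_mul_left]
  exact congrArg List.sum (List.map_congr_left fun q _ => by ring)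

theorem Lin.coef_eq_zero {κ : Type} [DecidableEq κ]
    {l : Lin κ} {c : κ} (h : ∀ q ∈ l, q.1 ≠ c) : l.coef c = 0 := by
  rw [Lin.coef]
  refine List.sum_eq_zero fun x hx => ?_
  obtain ⟨q, hq, rfl⟩ := List.mem_map.1 hx
  rw [if_neg (h q hq)]

/-- Which coordinates a sublayer reads and writes is decidable syntactically, so that numerical
checks remain only for the coordinates in `outs`. -/
theorem FFSpec.eq_ideal {κ : Type} [DecidableEq κ]
    {F : FFSpec κ} {f f' : κ → ℝ} (outs : List κ) {R : ℝ}
    (hn : nrm F.mask f = R) (hm : ∀ p ∈ F.neurons, ∀ q ∈ p.1, q.1 ∈ F.mask)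
    (hout : ∀ p ∈ F.neurons, ∀ q ∈ p.2, q.1 ∈ outs) (hsame : ∀ c, c ∉ outs → f' c = f c)
    (h : ∀ c ∈ outs, f' c = f c +
      (F.neurons.map fun p => (p.2.coef c : ℝ) * max 0 (p.1.eval f / R)).sum) (c : κ) :
    f' c = F.ideal f c := by
  rw [FFSpec.ideal]
  by_cases hc : c ∈ outs
  · rw [h c hc]
    congr 2
    refine List.map_congr_left fun p hp => ?_
    rw [Lin.eval_unit (hm p hp), hn]
  · rw [hsame c hc, List.sum_eq_zero, add_zero]
    intro x hx
    obtain ⟨p, hp, rfl⟩ := List.mem_map.1 hx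
    rw [Lin.coef_eq_zero fun q hq h => hc (h.subst (hout p hp q hq)), Rat.cast_zero, zero_mul]

theorem AttSpec.ideal_of_forall {κ : Type} [DecidableEq κ]
    {S : AttSpec κ} {ρ γ : ℝ} {N : ℕ} {f f' : Fin N → κ → ℝ}
    (outs : List κ) (l : List (HeadSpec κ × (Fin N → ℝ))) (hn : ∀ i, ρ ≤ nrm S.mask (f i))
    (hl : l.map Prod.fst = S.heads)
    (hout : ∀ H ∈ S.heads, ∀ q ∈ H.out, q.1 ∈ outs) (hsame : ∀ i c, c ∉ outs → f' i c = f i c)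
    (hatt : ∀ p ∈ l, ∀ i, p.1.Attends γ (fun j => unit S.mask (f j)) i (p.2 i))
    (h : ∀ i, ∀ c ∈ outs, f' i c = f i c + (l.map fun p => (p.1.out.coef c : ℝ) * p.2 i).sum) :
    S.Ideal ρ γ f f' := by
  refine ⟨hn, l, hl, hatt, fun i c => ?_⟩
  by_cases hc : c ∈ outs
  · exact h i c hc
  · rw [hsame i c hc, List.sum_eq_zero, add_zero]
    intro x hx
    obtain ⟨p, hp, rfl⟩ := List.mem_map.1 hx
    have hH : p.1 ∈ S.heads := hl ▸ List.mem_map_of_mem hp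
    rw [Lin.coef_eq_zero fun q hq h => hc (h.subst (hout p.1 hH q hq)), Rat.cast_zero, zero_mul]

theorem AttSpec.ideal_of_heads_eq_nil {κ : Type} [DecidableEq κ]
    {S : AttSpec κ} {ρ γ : ℝ} {N : ℕ} {f : Fin N → κ → ℝ}
    (hS : S.heads = []) (hn : ∀ i, ρ ≤ nrm S.mask (f i)) : S.Ideal ρ γ f f :=
  S.ideal_of_forall [] [] hn hS.symm (by simp [hS]) (by simp) (by simp) (by simp)

theorem HeadSpec.score_unit {κ : Type} [DecidableEq κ]
    {H : HeadSpec κ} {S : List κ} {f g : κ → ℝ}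
    (h : ∀ p ∈ H.qk, (∀ q ∈ p.1, q.1 ∈ S) ∧ ∀ q ∈ p.2, q.1 ∈ S) :
    H.score (unit S f) (unit S g) = H.score f g / (nrm S f * nrm S g) := by
  rw [HeadSpec.score, HeadSpec.score, div_eq_inv_mul, ← List.sum_map_mul_left]
  refine congrArg List.sum (List.map_congr_left fun p hp => ?_)
  rw [Lin.eval_unit (h p hp).1, Lin.eval_unit (h p hp).2]
  ring

theorem HeadSpec.attends_causal {κ : Type} [DecidableEq κ]
    {H : HeadSpec κ} {γ : ℝ} {N : ℕ} {S : List κ} {f : Fin N → κ → ℝ}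
    (φ : ℕ → ℝ) (hc : H.causal = true) (hqk : H.qk = []) (hv : ∀ q ∈ H.v, q.1 ∈ S)
    (hφ : ∀ j : Fin N, H.v.eval (f j) / nrm S (f j) = φ j) (i : Fin N) :
    H.Attends γ (fun j => unit S (f j)) i ((∑ j ∈ Finset.range (i + 1), φ j) / (i + 1)) := by
  refine Or.inl ⟨hqk, ?_⟩
  have e : Finset.range (i + 1) = (H.visible i).map Fin.valEmbedding := by
    ext j
    simp only [HeadSpec.visible, hc, Finset.mem_range, Finset.mem_map, Finset.mem_filter,
      Finset.mem_univ, true_and, forall_const, Fin.valEmbedding_apply]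
    constructor
    · exact fun h => ⟨⟨j, by omega⟩, Fin.mk_le_of_le_val (by omega), rfl⟩
    · rintro ⟨j, hj, rfl⟩
      exact Nat.lt_succ_of_le hj
  have e2 : ((H.visible i).card : ℝ) = i + 1 := by
    rw [← Finset.card_map Fin.valEmbedding, ← e, Finset.card_range]; push_cast; rfl
  rw [e2, e, Finset.sum_map]
  congr 1
  refine Finset.sum_congr rfl fun j _ => ?_
  rw [Lin.eval_unit hv, hφ]
  rfl

theorem HeadSpec.attends_uniform {κ : Type} [DecidableEq κ]
    {H : HeadSpec κ} {γ : ℝ} {N : ℕ} {S : List κ} {f : Fin N → κ → ℝ}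
    (φ : ℕ → ℝ) (hc : H.causal = false) (hqk : H.qk = []) (hv : ∀ q ∈ H.v, q.1 ∈ S)
    (hφ : ∀ j : Fin N, H.v.eval (f j) / nrm S (f j) = φ j) (i : Fin N) :
    H.Attends γ (fun j => unit S (f j)) i ((∑ j ∈ Finset.range N, φ j) / N) := by
  refine Or.inl ⟨hqk, ?_⟩
  have e : H.visible i = Finset.univ := by simp [HeadSpec.visible, hc]
  rw [e, Finset.card_univ, Fintype.card_fin, ← Fin.sum_univ_eq_sum_range]
  congr 1
  refine Finset.sum_congr rfl fun j _ => ?_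
  rw [Lin.eval_unit hv, hφ]

end Sublayers

/-! ### Existence tests by attention, and tools for following the named values -/

namespace Connectivity

open Coord

/-- A head that finds out whether there is a position after the first one with property `P`. -/
theorem Inst.attends_exists {I : Inst} {H : HeadSpec Coord} {S : List Coord}
    {f : Fin I.N → Coord → ℝ} {i : Fin I.N} (P : ℕ → Prop) (M : ℝ) (hc : H.causal = false)
    (hv : H.v = [(bos, -3)]) (hb : bos ∈ S)
    (hqk : ∀ p ∈ H.qk, (∀ q ∈ p.1, q.1 ∈ S) ∧ ∀ q ∈ p.2, q.1 ∈ S)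
    (hn : ∀ j, nrm S (f j) = 3) (hbos : ∀ j, f j bos = sgn ((j : ℕ) = 0))
    (h0 : ∀ j : Fin I.N, (j : ℕ) = 0 → H.score (f i) (f j) = M - I.thr)
    (h1 : ∀ j : Fin I.N, 0 < (j : ℕ) → P j → M ≤ H.score (f i) (f j))
    (h2 : ∀ j : Fin I.N, 0 < (j : ℕ) → ¬P j → H.score (f i) (f j) ≤ M - 1 / (32 * (I.N : ℝ) ^ 6)) :
    H.Attends I.γ (fun j => unit S (f j)) i (sgn (∃ j, 0 < j ∧ j < I.N ∧ P j)) := by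
  have hval : ∀ j, H.v.eval (unit S (f j)) = - sgn ((j : ℕ) = 0) := by
    intro j
    rw [Lin.eval_unit (by simp [hv, hb]), hv, hn]
    simp [hbos]
    ring
  have hs : ∀ j, H.score (unit S (f i)) (unit S (f j)) = H.score (f i) (f j) / 9 := by
    intro j
    rw [H.score_unit hqk, hn, hn]
    norm_num
  have hvis : H.visible i = Finset.univ := by simp [HeadSpec.visible, hc]
  have g1 := I.γ_le_thr
  have g2 := I.γ_add_thr_le
  refine Or.inr ?_
  simp only [hvis, Finset.mem_univ, true_and, forall_const, hval, hs]
  -- The value separates BoS from all other positions. If there is a match, only BoS has to be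
  -- beaten, mismatches having the right value too; if there is none, BoS has to beat everything.
  by_cases hP : ∃ j, 0 < j ∧ j < I.N ∧ P j
  · obtain ⟨j₀, hj, hj', hPj⟩ := hP
    rw [sgn_true ⟨j₀, hj, hj', hPj⟩]
    refine ⟨⟨j₀, hj'⟩, ?_, fun j => ?_⟩
    · rw [sgn_false (by simpa using hj.ne')]; simp
    · have h := h1 ⟨j₀, hj'⟩ hj hPj
      by_cases hj0 : (j : ℕ) = 0
      · right
        rw [h0 j hj0]
        linarith
      · left
        rw [sgn_false hj0]; simp
  · rw [sgn_false hP]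
    have hN : 0 < I.N := i.pos
    refine ⟨⟨0, hN⟩, ?_, fun j => ?_⟩
    · rw [sgn_true rfl]
    · by_cases hj0 : (j : ℕ) = 0
      · left
        rw [sgn_true hj0]
      · right
        have h := h2 j (Nat.pos_of_ne_zero hj0) fun h => hP ⟨j, Nat.pos_of_ne_zero hj0, j.2, h⟩
        rw [h0 ⟨0, hN⟩ rfl]
        linarith

theorem st_succ_of_ne {I : Inst} {k i : ℕ} {c : Coord} (h : time c ≠ k) :
    st I (k + 1) i c = st I k i c := by
  unfold st
  by_cases h1 : time c < k
  · rw [if_pos h1, if_pos (by omega)]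
  · rw [if_neg h1, if_neg (by omega)]

/-- The feedforward sublayer `F` computes the coordinates in `outs`. -/
theorem st_ff {I : Inst} {F : FFSpec Coord} {k i : ℕ} (outs : List Coord) {R : ℝ}
    (ht : ∀ c, time c = k → c ∈ outs) (hm : ∀ p ∈ F.neurons, ∀ q ∈ p.1, q.1 ∈ F.mask)
    (hout : ∀ p ∈ F.neurons, ∀ q ∈ p.2, q.1 ∈ outs) (hn : nrm F.mask (st I k i) = R)
    (h : ∀ c ∈ outs, st I (k + 1) i c = st I k i c +
      (F.neurons.map fun p => (p.2.coef c : ℝ) * max 0 (p.1.eval (st I k i) / R)).sum) (c : Coord) :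
    st I (k + 1) i c = F.ideal (st I k i) c :=
  F.eq_ideal outs hn hm hout (fun c hc => st_succ_of_ne fun h => hc (ht c h)) h c

theorem st_att {I : Inst} {A : AttSpec Coord} {k : ℕ} {ρ γ : ℝ} (outs : List Coord)
    (l : List (HeadSpec Coord × (Fin I.N → ℝ))) (ht : ∀ c, time c = k → c ∈ outs)
    (hout : ∀ H ∈ A.heads, ∀ q ∈ H.out, q.1 ∈ outs) (hl : l.map Prod.fst = A.heads)
    (hn : ∀ i : Fin I.N, ρ ≤ nrm A.mask (st I k i))
    (hatt : ∀ p ∈ l, ∀ i, p.1.Attends γ (fun j => unit A.mask (st I k j)) i (p.2 i))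
    (h : ∀ i : Fin I.N, ∀ c ∈ outs, st I (k + 1) i c = st I k i c +
      (l.map fun p => (p.1.out.coef c : ℝ) * p.2 i).sum) :
    A.Ideal ρ γ (fun i : Fin I.N => st I k i) (fun i => st I (k + 1) i) :=
  A.ideal_of_forall outs l hn hl hout (fun _ c hc => st_succ_of_ne fun h => hc (ht c h)) hatt h

theorem st_idle {I : Inst} {k : ℕ} {γ : ℝ} (ht : ∀ c, time c ≠ k) :
    idleAtt.Ideal 1 γ (fun i : Fin I.N => st I k i) (fun i => st I (k + 1) i) := by
  have e : (fun i : Fin I.N => st I (k + 1) i) = fun i : Fin I.N => st I k i := by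
    ext i c
    exact st_succ_of_ne (ht c)
  rw [e]
  refine AttSpec.ideal_of_heads_eq_nil rfl fun _ => ?_
  refine le_trans ?_ (abs_le_nrm (c := one) (by simp [idleAtt]))
  simp [st, val, init]

/-- `(x, 1)` is normalized. -/
theorem st_hash {I : Inst} {a b c d : Coord} {k i : ℕ} {x r : ℝ} (hr : 0 < r)
    (ht : ∀ c', time c' = k → c' ∈ [c, d]) (hcd : c ≠ d) (ha : st I k i a = r * x)
    (hb : st I k i b = r) (hc : st I k i c = 0) (hd : st I k i d = 0)
    (hc' : st I (k + 1) i c = hash₁ x) (hd' : st I (k + 1) i d = hash₂ x) :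
    nrm [a, b] (st I k i) = r * √(x ^ 2 + 1) ∧
      ∀ c', st I (k + 1) i c' = (hashFF a b c d).ideal (st I k i) c' := by
  have h := sqrt_sq_add_one_pos x
  have hn : nrm [a, b] (st I k i) = r * √(x ^ 2 + 1) := by
    refine nrm_eq (by positivity) ?_
    simp only [List.map_cons, List.map_nil, List.sum_cons, List.sum_nil, ha, hb, mul_pow]
    rw [Real.sq_sqrt (by positivity)]
    ring
  refine ⟨hn, st_ff [c, d] ht (by simp [hashFF, copy]) (by simp [hashFF, copy]) hn ?_⟩
  have e1 : r * x / (r * √(x ^ 2 + 1)) = hash₁ x := by rw [hash₁]; field_simp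
  have e2 : r / (r * √(x ^ 2 + 1)) = hash₂ x := by rw [hash₂]; field_simp
  have e1' : -(r * x) / (r * √(x ^ 2 + 1)) = - hash₁ x := by rw [← e1]; ring
  have e2' : -r / (r * √(x ^ 2 + 1)) = - hash₂ x := by rw [← e2]; ring
  have m : ∀ y : ℝ, max 0 y - max 0 (-y) = y := by
    intro y
    rcases le_total 0 y with hy | hy
    · rw [max_eq_right hy, max_eq_left (by linarith)]; ring
    · rw [max_eq_left hy, max_eq_right (by linarith)]; ring
  have m1 := m (hash₁ x)
  have m2 := m (hash₂ x)
  simp [hashFF, copy, hcd, hcd.symm, ha, hb, hc, hd, hc', hd', e1, e2, e1', e2']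
  constructor <;> linarith

end Connectivity

namespace Connectivity

open Coord

variable (I : Inst) (k i : ℕ)

theorem Inst.isBit_cases (i : ℕ) : i = 0 ∨ I.IsBit i ∨ I.IsPad i ∨ I.IsA i ∨ I.IsB i := by
  unfold IsBit IsPad IsA IsB
  omega

theorem Inst.tok_zero : I.tok 0 = .bos := by simp [tok]

theorem Inst.tok_of_isBit {i : ℕ} (h : I.IsBit i) :
    (I.IsEdge i ∧ I.tok i = .one) ∨ (¬I.IsEdge i ∧ I.tok i = .zero) := by
  have h1 : i ≠ 0 := by have := h.1; omega
  by_cases he : I.IsEdge i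
  · exact Or.inl ⟨he, by simp [tok, h1, h.2, he]⟩
  · exact Or.inr ⟨he, by simp [tok, h1, h.2, he]⟩

theorem Inst.tok_of_isPad {i : ℕ} (h : I.IsPad i) : I.tok i = .pad := by
  have h1 : i ≠ 0 := by have := h.1; omega
  have h2 : ¬ i ≤ I.n ^ 2 := by have := h.1; omega
  simp [tok, h1, h2, h.2]

theorem Inst.tok_of_isA {i : ℕ} (h : I.IsA i) : I.tok i = .a := by
  unfold IsA at h
  have h1 : i ≠ 0 := by omega
  have h2 : ¬ i ≤ I.n ^ 2 := by omega
  have h3 : ¬ i ≤ I.n ^ 2 + I.n ^ 3 := by omega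
  simp [tok, h1, h2, h3, h.2]

theorem Inst.tok_of_isB {i : ℕ} (h : I.IsB i) : I.tok i = .b := by
  simp only [Inst.IsB] at h
  have h1 : i ≠ 0 := by omega
  have h2 : ¬ i ≤ I.n ^ 2 := by omega
  have h3 : ¬ i ≤ I.n ^ 2 + I.n ^ 3 := by omega
  have h4 : ¬ i ≤ I.n ^ 2 + I.n ^ 3 + (I.s + 1) := by omega
  simp [tok, h1, h2, h3, h4]

theorem embed_tok (i : ℕ) (c : Coord) : (embed (I.tok i) c : ℝ) = init I i c := by
  rcases I.isBit_cases i with rfl | h | h | h | h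
  · have he : ¬ I.IsEdge 0 := fun h => absurd h.1.1 (by omega)
    rw [I.tok_zero]
    cases c <;> simp [embed, init, Inst.IsBit, Inst.IsPad, Inst.IsA, Inst.IsB, sgn, he]
  · have h0 : i ≠ 0 := by have := h.1; omega
    have hP : ¬ I.IsPad i := fun h' => absurd h.2 (by have := h'.1; omega)
    have hA : ¬ I.IsA i := fun h' => absurd h.2 (by have := h'.1; omega)
    have hB : ¬ I.IsB i := fun h' => absurd h.2 (by simp only [Inst.IsB] at h'; omega)
    rcases I.tok_of_isBit h with ⟨he, e⟩ | ⟨he, e⟩ <;> rw [e] <;>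
      cases c <;> simp [embed, init, sgn, he, h, hP, hA, hB, h0]
  all_goals
    have h0 : i ≠ 0 := by simp only [Inst.IsPad, Inst.IsA, Inst.IsB] at h; omega
    have hb : ¬ I.IsBit i := by simp only [Inst.IsPad, Inst.IsA, Inst.IsB, Inst.IsBit] at h ⊢; omega
    have he : ¬ I.IsEdge i := fun h' => hb h'.1
  · have hA : ¬ I.IsA i := by simp only [Inst.IsPad, Inst.IsA] at *; omega
    have hB : ¬ I.IsB i := by simp only [Inst.IsPad, Inst.IsB] at *; omega
    rw [I.tok_of_isPad h]
    cases c <;> simp [embed, init, sgn, he, h, hA, hB, h0, hb]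
  · have hA : ¬ I.IsPad i := by simp only [Inst.IsPad, Inst.IsA] at *; omega
    have hB : ¬ I.IsB i := by simp only [Inst.IsA, Inst.IsB] at *; omega
    rw [I.tok_of_isA h]
    cases c <;> simp [embed, init, sgn, he, h, hA, hB, h0, hb]
  · have hA : ¬ I.IsPad i := by simp only [Inst.IsPad, Inst.IsB] at *; omega
    have hB : ¬ I.IsA i := by simp only [Inst.IsA, Inst.IsB] at *; omega
    rw [I.tok_of_isB h]
    cases c <;> simp [embed, init, sgn, he, h, hA, hB, h0, hb]

theorem one_le_nrm_st {S : List Coord} (h : one ∈ S) : 1 ≤ nrm S (st I k i) := by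
  refine le_trans ?_ (abs_le_nrm h)
  simp [st, val, init]

variable {I k}

theorem sum_ind (P : ℕ → Prop) (m : ℕ) : ∑ j ∈ Finset.range m, (sgn (P j) + 1) / 2 =
    open Classical in (((Finset.range m).filter P).card : ℝ) := by
  classical
  rw [Finset.card_filter, Nat.cast_sum]
  refine Finset.sum_congr rfl fun j _ => ?_
  by_cases h : P j <;> simp [sgn, h]

theorem sum_ind_Ioc (P : ℕ → Prop) {a b m : ℕ} (hab : a ≤ b) (hb : b < m)
    (hP : ∀ j < m, P j ↔ a < j ∧ j ≤ b) :
    ∑ j ∈ Finset.range m, (sgn (P j) + 1) / 2 = (b : ℝ) - a := by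
  classical
  rw [sum_ind, ← Nat.cast_sub hab, ← Nat.card_Ioc]
  congr 2
  ext j
  simp only [Finset.mem_filter, Finset.mem_range, Finset.mem_Ioc]
  constructor
  · rintro ⟨h1, h2⟩; exact (hP j h1).1 h2
  · rintro h; exact ⟨by omega, (hP j (by omega)).2 h⟩

theorem sum_ind_zero {m : ℕ} (hm : 0 < m) : ∑ j ∈ Finset.range m, (sgn (j = 0) + 1) / 2 = 1 := by
  classical
  rw [Finset.sum_eq_single_of_mem 0 (Finset.mem_range.2 hm)]
  · simp [sgn]
  · intro j _ hj
    simp [sgn, hj]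

/-! ### The first sublayers -/

theorem att0_ideal : att0.Ideal 1 I.γ (fun i : Fin I.N => st I 0 i) (fun i => st I 1 i) := by
  have hn : ∀ i : ℕ, nrm att0.mask (st I 0 i) = 3 := fun i =>
    nrm_eq (by norm_num) (by simp [att0, st, time, init]; norm_num)
  have hN := I.N_real_ge
  have sN : ∑ j ∈ Finset.range I.N, (sgn (j = 0) + 1) / 2 = 1 := sum_ind_zero (by have := I.N_ge; omega)
  have s2 := sum_ind_Ioc I.IsBit (Nat.zero_le _) I.sq_lt_N fun j _ => by unfold Inst.IsBit; omega
  have s3 := sum_ind_Ioc I.IsPad (a := I.n ^ 2) (b := I.n ^ 2 + I.n ^ 3) (m := I.N) (by omega)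
    (by unfold Inst.N; omega) fun j _ => Iff.rfl
  have s4 := sum_ind_Ioc I.IsA (a := I.n ^ 2 + I.n ^ 3) (b := I.n ^ 2 + I.n ^ 3 + (I.s + 1))
    (m := I.N) (by omega) (by unfold Inst.N; omega) fun j _ => Iff.rfl
  have s5 := sum_ind_Ioc I.IsB (a := I.n ^ 2 + I.n ^ 3 + (I.s + 1)) (b := I.N - 1)
    (m := I.N) (by unfold Inst.N; omega) (by unfold Inst.N; omega) fun j _ => by
      unfold Inst.N Inst.IsB at *; omega
  have e5 : ((I.N - 1 : ℕ) : ℝ) = I.n ^ 2 + I.n ^ 3 + (I.s + 1) + (I.t + 1) := by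
    have : I.N - 1 = I.n ^ 2 + I.n ^ 3 + (I.s + 1) + (I.t + 1) := by unfold Inst.N; omega
    rw [this]; push_cast; ring
  refine st_att [ka, kb, v1, v2, v3, va, vb]
    [(_, fun i => (∑ j ∈ Finset.range (i + 1), (sgn (j = 0) + 1) / 2) / ((i : ℕ) + 1)),
      (_, fun _ => (∑ j ∈ Finset.range I.N, (sgn (j = 0) + 1) / 2) / I.N),
      (_, fun _ => (∑ j ∈ Finset.range I.N, (sgn (I.IsBit j) + 1) / 2) / I.N),
      (_, fun _ => (∑ j ∈ Finset.range I.N, (sgn (I.IsPad j) + 1) / 2) / I.N),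
      (_, fun _ => (∑ j ∈ Finset.range I.N, (sgn (I.IsA j) + 1) / 2) / I.N),
      (_, fun _ => (∑ j ∈ Finset.range I.N, (sgn (I.IsB j) + 1) / 2) / I.N)]
    (by decide) (by decide) rfl (fun i => by rw [hn]; norm_num) ?_ ?_
  · simp only [List.forall_mem_cons]
    refine ⟨HeadSpec.attends_causal _ rfl rfl (by decide) fun j => ?_,
      HeadSpec.attends_uniform _ rfl rfl (by decide) fun j => ?_,
      HeadSpec.attends_uniform _ rfl rfl (by decide) fun j => ?_,
      HeadSpec.attends_uniform _ rfl rfl (by decide) fun j => ?_,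
      HeadSpec.attends_uniform _ rfl rfl (by decide) fun j => ?_,
      HeadSpec.attends_uniform _ rfl rfl (by decide) fun j => ?_, by simp⟩
    all_goals
      rw [hn]
      simp [st, time, init]
      ring
  · intro i
    have hi : ((i : ℕ) : ℝ) + 1 ≠ 0 := by positivity
    have hN' : (I.N : ℝ) ≠ 0 := by positivity
    rw [sN, s2, s3, s4, s5, e5]
    simp [sum_ind_zero, st, init, time, val, Inst.w1, Inst.w2, Inst.w3]
    refine ⟨?_, ?_, ?_, ?_⟩
    · field_simp
      ring
    · split_ifs <;> simp_all
    · ring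
    · ring

theorem ff0_ideal (i : ℕ) : ∀ c, st I 2 i c = ff0.ideal (st I 1 i) c := by
  have h := sqrt_sq_add_one_pos I.w1
  have hn : nrm ff0.mask (st I 1 i) = √(I.w1 ^ 2 + 1) := by
    simp [nrm, ff0, st, time, val, init]
  refine st_ff [t1] (by decide) (by decide) (by decide) hn ?_
  simp [ff0, st, time, val, init, Inst.θ1, hash₂]
  ring

theorem ff1_ideal (i : ℕ) : ∀ c, st I 4 i c = ff1.ideal (st I 3 i) c := by
  have h := sqrt_sq_add_one_pos I.θ1
  have hn : nrm ff1.mask (st I 3 i) = √(I.θ1 ^ 2 + 1) := by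
    simp [nrm, ff1, st, time, val, init]
  refine st_ff [t2] (by decide) (by decide) (by decide) hn ?_
  simp [ff1, st, time, val, init, Inst.θ2, hash₂]
  ring

theorem ff2_ideal (i : ℕ) : ∀ c, st I 6 i c = ff2.ideal (st I 5 i) c := by
  have h := sqrt_sq_add_one_pos I.θ2
  have hn : nrm ff2.mask (st I 5 i) = √(I.θ2 ^ 2 + 1) := by
    simp [nrm, ff2, st, time, val, init]
  refine st_ff [b1, b2] (by decide) (by decide) (by decide) hn ?_
  have h1 := hash₁_nonneg I.θ2_nonneg
  rw [hash₁] at h1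
  simp [ff2, st, time, val, init, hash₂, hash₁, h1]

/-- A ReLU multiplies a number in `[0, 1]` by a sign: if the sign is negative, the shift by `-2`
switches the neuron off. -/
theorem relu_gate {P : Prop} {x r : ℝ} (hr : 0 < r) (h0 : 0 ≤ x) (h1 : x ≤ 1) :
    - (x / r) + 2 * max 0 ((x + (sgn P + -1)) / r) = sgn P * (x / r) := by
  by_cases h : P
  · rw [sgn_true h, max_eq_right (div_nonneg (by linarith) hr.le)]
    ring
  · rw [sgn_false h, max_eq_left (div_nonpos_of_nonpos_of_nonneg (by linarith) hr.le)]
    ring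

theorem ff4_ideal (i : ℕ) : 1 / ((i : ℝ) + 1) ≤ nrm ff4.mask (st I 9 i) ∧
    ∀ c, st I 10 i c = ff4.ideal (st I 9 i) c := by
  have hi : (0 : ℝ) < (i : ℝ) + 1 := by positivity
  by_cases h0 : i = 0
  · subst h0
    have hn : nrm ff4.mask (st I 9 0) = 1 :=
      nrm_eq one_pos (by simp [ff4, st, time, val, init])
    refine ⟨by rw [hn]; simp, st_ff [K1, K2, K3] (by decide) (by decide) (by decide) hn ?_⟩
    simp [ff4, st, time, val, init]
  · have hs := sqrt_sq_add_one_pos i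
    have hn : nrm ff4.mask (st I 9 i) = √((i : ℝ) ^ 2 + 1) / (i + 1) := by
      refine nrm_eq (by positivity) ?_
      rw [div_pow, Real.sq_sqrt (by positivity)]
      simp [ff4, st, time, val, init, h0]
      field_simp
    refine ⟨?_, st_ff [K1, K2, K3] (by decide) (by decide) (by decide) hn ?_⟩
    · rw [hn]
      gcongr
      rw [Real.one_le_sqrt]
      nlinarith
    have e1 : (i : ℝ) / (i + 1) / (√((i : ℝ) ^ 2 + 1) / (i + 1)) = hash₁ i := by
      rw [hash₁]; field_simp
    have e2 : ((i : ℝ) + 1)⁻¹ / (√((i : ℝ) ^ 2 + 1) / (i + 1)) = hash₂ i := by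
      rw [hash₂]; field_simp
    simp [ff4, st, time, val, init, h0, e1, e2, hash₁_nonneg, (hash₂_pos _).le]

end Connectivity

namespace Connectivity

open Coord

variable {I : Inst}

theorem ff3_ideal (i : ℕ) : ∀ c, st I 8 i c = ff3.ideal (st I 7 i) c := by
  have h : 0 < I.ρ3 := by have := I.one_le_ρ3; linarith
  have hn : nrm ff3.mask (st I 7 i) = I.ρ3 := by
    refine nrm_eq h ?_
    simp [ff3, st, time, val, init, I.ρ3_sq]
    ring
  refine st_ff [d1, d2, d3, g1, g2, g3] (by decide) (by decide) (by decide) hn ?_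
  have h1 := relu_gate (P := i = 0) h I.w1_pos.le I.w1_le
  have h2 := relu_gate (P := i = 0) h I.w2_pos.le I.w2_le
  have h3 := relu_gate (P := i = 0) h I.w3_pos.le I.w3_le
  have e1 := max_eq_right (div_pos I.w1_pos h).le
  have e2 := max_eq_right (div_pos I.w2_pos h).le
  have e3 := max_eq_right (div_pos I.w3_pos h).le
  simp [ff3, st, time, val, init, e1, e2, e3, h1, h2, h3, Inst.D1, Inst.D2, Inst.D3]

theorem att4_ideal : att4.Ideal 1 I.γ (fun i : Fin I.N => st I 8 i) (fun i => st I 9 i) := by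
  have h := I.one_le_ρ4
  have hn : ∀ i : ℕ, nrm att4.mask (st I 8 i) = I.ρ4 := fun i =>
    nrm_eq (by linarith) (by simp [att4, st, time, val, init, mul_pow, I.ρ4_sq]; ring)
  refine st_att [p1a, p1b, p2a, p2b]
    [(_, fun i => (∑ j ∈ Finset.range (i + 1), I.D1 / I.ρ4) / ((i : ℕ) + 1)),
      (_, fun i => (∑ j ∈ Finset.range (i + 1), I.D2 / I.ρ4) / ((i : ℕ) + 1)),
      (_, fun i => (∑ j ∈ Finset.range (i + 1), (sgn (j = 0) + 1) / 2 * (I.D1 / I.ρ4))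
        / ((i : ℕ) + 1)),
      (_, fun i => (∑ j ∈ Finset.range (i + 1), (sgn (j = 0) + 1) / 2 * (I.D2 / I.ρ4))
        / ((i : ℕ) + 1)),
      (_, fun i => (∑ j ∈ Finset.range (i + 1), (sgn (j = 0) + 1) / 2 * (I.D3 / I.ρ4))
        / ((i : ℕ) + 1))]
    (by decide) (by decide) rfl (fun i => by rw [hn]; exact h) ?_ ?_
  · simp only [List.forall_mem_cons]
    refine ⟨HeadSpec.attends_causal _ rfl rfl (by decide) fun j => ?_,
      HeadSpec.attends_causal _ rfl rfl (by decide) fun j => ?_,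
      HeadSpec.attends_causal _ rfl rfl (by decide) fun j => ?_,
      HeadSpec.attends_causal _ rfl rfl (by decide) fun j => ?_,
      HeadSpec.attends_causal _ rfl rfl (by decide) fun j => ?_, by simp⟩
    all_goals
      rw [hn]
      simp [st, time, val]
      try ring
  · intro i
    have hi : ((i : ℕ) : ℝ) + 1 ≠ 0 := by positivity
    have hn' : (I.n : ℝ) ≠ 0 := Nat.cast_ne_zero.2 I.n_pos.ne'
    have hr : I.ρ4 ≠ 0 := by linarith
    simp only [← Finset.sum_mul, sum_ind_zero (Nat.succ_pos _)]
    simp [st, time, val, init, ← I.D2_mul, ← I.D1_mul]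
    refine ⟨?_, ?_, ?_, ?_⟩ <;> field_simp <;> ring


/-- The difference is a nonzero integer over `d`. The hash gap therefore applies to rational
quotients as well as to integers. -/
theorem one_div_le_abs_sub {d N : ℕ} (hd : 0 < d) (hdN : d ≤ N) {i j : ℕ}
    (h : ((i : ℝ) - 1) / d ≠ j) : 1 / (N : ℝ) ≤ |((i : ℝ) - 1) / d - j| := by
  have hd' : (0 : ℝ) < d := Nat.cast_pos.2 hd
  have e : ((i : ℝ) - 1) / d - j = (((i : ℤ) - 1 - j * d : ℤ) : ℝ) / d := by
    push_cast
    field_simp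
  have hne : ((i : ℤ) - 1 - j * d : ℤ) ≠ 0 := fun h0 => by
    rw [h0] at e
    simp at e
    exact h (by linarith)
  rw [e, abs_div, abs_of_pos hd']
  have h1 : (1 : ℝ) ≤ |(((i : ℤ) - 1 - j * d : ℤ) : ℝ)| := by
    rw [← Int.cast_abs]
    exact_mod_cast Int.one_le_abs hne
  gcongr

theorem sq_add_one_le {x N : ℝ} (hN : 1 ≤ N) (h0 : -1 ≤ x) (h1 : x ≤ N) :
    x ^ 2 + 1 ≤ (2 * N) ^ 2 := by
  nlinarith

theorem Inst.n_le_sq : I.n ≤ I.n ^ 2 := Nat.le_self_pow two_ne_zero _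

theorem div_sub_one_bounds {d : ℕ} (hd : 0 < d) {i N : ℕ} (hi : i < N) :
    -1 ≤ ((i : ℝ) - 1) / d ∧ ((i : ℝ) - 1) / d ≤ N := by
  have hd' : (1 : ℝ) ≤ d := Nat.one_le_cast.2 hd
  have hiN : (i : ℝ) ≤ N := Nat.cast_le.2 hi.le
  have hi0 : (0 : ℝ) ≤ i := Nat.cast_nonneg i
  have hN : (1 : ℝ) ≤ N := by exact_mod_cast (show 1 ≤ N by omega)
  constructor
  · rw [le_div_iff₀ (by linarith)]
    linarith
  · rw [div_le_iff₀ (by linarith)]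
    nlinarith

theorem exists_eq_div_iff {d : ℕ} (hd : 0 < d) {i N : ℕ} (hi : i < N) :
    (∃ j : ℕ, 0 < j ∧ j < N ∧ ((i : ℝ) - 1) / d = j) ↔ 1 < i ∧ d ∣ i - 1 := by
  have hd' : (0 : ℝ) < d := Nat.cast_pos.2 hd
  constructor
  · rintro ⟨j, h0, -, h⟩
    rw [div_eq_iff hd'.ne', sub_eq_iff_eq_add] at h
    have h2 : i = j * d + 1 := by exact_mod_cast h
    have := Nat.mul_pos h0 hd
    exact ⟨by omega, j, by rw [h2, mul_comm]; simp⟩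
  · rintro ⟨h1, j, hj⟩
    have h2 : i = d * j + 1 := by omega
    have h3 : 0 < j := Nat.pos_of_ne_zero fun h => by subst h; omega
    refine ⟨j, h3, ?_, ?_⟩
    · have := Nat.le_mul_of_pos_left j hd
      omega
    · rw [h2]
      push_cast
      field_simp
      ring

theorem att7_ideal : att7.Ideal 1 I.γ (fun i : Fin I.N => st I 14 i) (fun i => st I 15 i) := by
  have hn : ∀ i : ℕ, nrm att7.mask (st I 14 i) = 3 := fun i =>
    nrm_eq (by norm_num) (by
      have h1 := hash_sq i
      have h2 := hash_sq I.θ2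
      have h3 := hash_sq (((i : ℝ) - 1) / I.n)
      have h4 := hash_sq (((i : ℝ) - 1) / (I.n : ℝ) ^ 2)
      by_cases h : i = 0
      · simp [att7, st, time, val, init, h] at h3 h4 ⊢
        linarith
      · simp [att7, st, time, val, init, h]
        linarith)
  have hN := I.N_real_ge
  have hn2 : 0 < I.n ^ 2 := Nat.pow_pos I.n_pos
  have hle := I.n_le_sq.trans I.sq_lt_N.le
  refine st_att [fl1, fl2]
    [(_, fun i => sgn (∃ j, 0 < j ∧ j < I.N ∧ (((i : ℕ) : ℝ) - 1) / (I.n : ℕ) = j)),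
      (_, fun i => sgn (∃ j, 0 < j ∧ j < I.N ∧ (((i : ℕ) : ℝ) - 1) / ((I.n ^ 2 : ℕ) : ℝ) = j))]
    (by decide) (by decide) rfl (fun i => by rw [hn]; norm_num) ?_ ?_
  · simp only [List.forall_mem_cons]
    refine ⟨fun i => Inst.attends_exists (fun j => (((i : ℕ) : ℝ) - 1) / (I.n : ℕ) = j) 1 rfl rfl
        (by decide) (by decide) (fun j => hn j) (fun j => by simp [st, time, init]) ?_ ?_ ?_,
      fun i => Inst.attends_exists (fun j => (((i : ℕ) : ℝ) - 1) / (I.n ^ 2 : ℕ) = j) 1 rfl rfl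
        (by decide) (by decide) (fun j => hn j) (fun j => by simp [st, time, init]) ?_ ?_ ?_,
      by simp⟩
    · intro j hj
      simp [HeadSpec.score, st, time, val, hj, Inst.thr]
    · intro j hj hP
      have := hash_dot_self j
      simp [HeadSpec.score, st, time, val, hj.ne', hP, this]
    · intro j hj hP
      have hb := div_sub_one_bounds I.n_pos i.2
      have := hash_dot_le (by linarith) (sq_add_one_le (by linarith) hb.1 hb.2)
        (sq_add_one_le (by linarith) (by linarith [(Nat.cast_nonneg j : (0 : ℝ) ≤ j)])
          (Nat.cast_le.2 j.2.le)) (one_div_le_abs_sub I.n_pos hle hP)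
      simpa [HeadSpec.score, st, time, val, init, hj.ne'] using this
    · intro j hj
      simp [HeadSpec.score, st, time, val, hj, Inst.thr]
    · intro j hj hP
      have := hash_dot_self j
      rw [Nat.cast_pow] at hP
      simp [HeadSpec.score, st, time, val, hj.ne', hP, this]
    · intro j hj hP
      have hb := div_sub_one_bounds hn2 i.2
      have := hash_dot_le (by linarith) (sq_add_one_le (by linarith) hb.1 hb.2)
        (sq_add_one_le (by linarith) (by linarith [(Nat.cast_nonneg j : (0 : ℝ) ≤ j)])
          (Nat.cast_le.2 j.2.le)) (one_div_le_abs_sub hn2 I.sq_lt_N.le hP)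
      simpa [HeadSpec.score, st, time, val, init, hj.ne'] using this
  · intro i
    have e1 := exists_eq_div_iff I.n_pos i.2
    have e2 := exists_eq_div_iff hn2 i.2
    simp only [List.map_cons, List.map_nil]
    rw [e1, e2]
    simp [st, time, val, init, Inst.F1, Inst.F2]

theorem relu_and {P Q : Prop} {r : ℝ} (hr : 0 < r) :
    - r⁻¹ + 2 * max 0 ((sgn P + (sgn Q + -1)) / r) = sgn (P ∧ Q) / r := by
  have : 0 < r⁻¹ := inv_pos.2 hr
  by_cases h1 : P <;> by_cases h2 : Q <;> simp [sgn, h1, h2, div_eq_mul_inv, this.le] <;> nlinarith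

theorem relu_sgn {P : Prop} {r : ℝ} (hr : 0 < r) :
    - r⁻¹ + 2 * max 0 (sgn P / r) = sgn P / r := by
  have : 0 < r⁻¹ := inv_pos.2 hr
  by_cases h1 : P <;> simp [sgn, h1, div_eq_mul_inv, this.le] ; nlinarith

theorem sgn_or {P Q : Prop} (h : ¬(P ∧ Q)) : sgn (P ∨ Q) = sgn P + sgn Q + 1 := by
  by_cases h1 : P <;> by_cases h2 : Q <;> simp_all [sgn]

theorem ff7_ideal (i : ℕ) : ∀ c, st I 16 i c = ff7.ideal (st I 15 i) c := by
  have h : 0 < I.ρ7 := by have := I.one_le_ρ7; linarith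
  have hi : 0 < I.ρ7⁻¹ := inv_pos.2 h
  have hn : nrm ff7.mask (st I 15 i) = I.ρ7 := by
    refine nrm_eq h ?_
    simp [ff7, st, time, val, init, I.ρ7_sq]
    ring
  refine st_ff [fp1, fb1, fp2, b8, o8, y1, y2, m1, m2, c1, c2, c3] (by decide) (by decide)
    (by decide) hn ?_
  have e1 := max_eq_right (div_pos I.D1_pos h).le
  have e2 := max_eq_right (div_pos I.D2_pos h).le
  have e3 := max_eq_right (div_pos I.D3_pos h).le
  have h1 := relu_gate (P := i = 0) h I.D1_pos.le I.D1_le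
  have h2 := relu_gate (P := i = 0) h I.D2_pos.le I.D2_le
  have h3 := relu_gate (P := I.F1 i) h I.D3_pos.le I.D3_le
  have h4 := relu_gate (P := I.F2 i) h I.D2_pos.le I.D2_le
  have h5 := relu_and (P := I.F1 i) (Q := I.IsPad i) h
  have h6 := relu_and (P := I.F2 i) (Q := I.IsPad i) h
  have h7 := relu_and (P := I.F1 i) (Q := I.IsBit i) h
  have h8 := relu_sgn (P := i = 0) h
  have h9 := sgn_or (P := I.F1 i ∧ I.IsBit i) (Q := i = 0) fun h => by
    have := h.1.2.1
    omega
  simp [ff7, st, time, val, init, e1, e2, e3, h1, h2, h3, h4, h5, h6, h8, hi.le, mul_div_assoc]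
  rw [h9, add_div, add_div, one_div, ← h7]
  linarith

/-! ### Quotients and remainders -/

/-- The quotient is the number of positive multiples of `d` up to `i - 1`, so a causal average of
divisibility flags amounts to integer division. -/
theorem cnt_dvd (d i : ℕ) : Inst.cnt (fun j => 1 < j ∧ d ∣ j - 1) i = (i - 1) / d := by
  classical
  induction i with
  | zero => simp [Inst.cnt, Finset.filter_singleton]
  | succ i ih =>
    have e : Inst.cnt (fun j => 1 < j ∧ d ∣ j - 1) (i + 1) =
        Inst.cnt (fun j => 1 < j ∧ d ∣ j - 1) i + if 1 < i + 1 ∧ d ∣ i then 1 else 0 := by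
      rw [Inst.cnt, Inst.cnt, Finset.range_add_one, Finset.filter_insert]
      split_ifs with h1 h2 h2
      · rw [Finset.card_insert_of_notMem (by simp)]
      · exact absurd h1 h2
      · exact absurd h2 h1
      · rfl
    rw [e, ih, Nat.add_sub_cancel]
    rcases i with _ | i
    · simp
    · rw [Nat.add_sub_cancel, Nat.succ_div]
      simp

theorem Inst.kn_eq (i : ℕ) : (i : ℝ) - I.n * Inst.cnt I.F1 i = I.kn i := by
  have h : Inst.cnt I.F1 i = (i - 1) / I.n := cnt_dvd _ i
  rw [h, kn]
  split_ifs with h0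
  · simp [h0]
  · have := Nat.div_add_mod (i - 1) I.n
    have h2 : i = I.n * ((i - 1) / I.n) + ((i - 1) % I.n + 1) := by omega
    rw [sub_eq_iff_eq_add']
    exact_mod_cast h2

theorem Inst.e2_eq (i : ℕ) : (i : ℝ) - I.n ^ 2 * Inst.cnt I.F2 i = I.e2 i := by
  have h : Inst.cnt I.F2 i = (i - 1) / I.n ^ 2 := cnt_dvd _ i
  rw [h, e2]
  split_ifs with h0
  · simp [h0]
  · have := Nat.div_add_mod (i - 1) (I.n ^ 2)
    have h2 : i = I.n ^ 2 * ((i - 1) / I.n ^ 2) + ((i - 1) % I.n ^ 2 + 1) := by omega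
    rw [sub_eq_iff_eq_add']
    exact_mod_cast h2

theorem sum_cnt (P : ℕ → Prop) (i : ℕ) :
    ∑ j ∈ Finset.range (i + 1), (sgn (P j) + 1) / 2 = Inst.cnt P i := sum_ind P _

theorem cnt_zero_eq (i : ℕ) : Inst.cnt (fun j => j = 0) i = 1 := by
  have := sum_cnt (fun j => j = 0) i
  rw [sum_ind_zero (Nat.succ_pos _)] at this
  exact_mod_cast this.symm

theorem att8_ideal : att8.Ideal (1 / 3) I.γ (fun i : Fin I.N => st I 16 i)
    (fun i => st I 17 i) := by
  have h7 : 0 < I.ρ7 := by have := I.one_le_ρ7; linarith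
  have h8 := I.ρ8_pos
  have hn : ∀ i : ℕ, nrm att8.mask (st I 16 i) = I.ρ8 := fun i =>
    nrm_eq h8 (by
      rw [I.ρ8_sq]
      simp [att8, st, time, val, init, mul_pow, div_pow]
      field_simp
      ring)
  set r := 1 / (I.ρ7 * I.ρ8) with hr
  refine st_att [e1a, eb, iba, ipa, ra, rb, e2a, e2b]
    [(_, fun i => (∑ j ∈ Finset.range (i + 1), (sgn (I.F1 j ∧ I.IsPad j) + 1) / 2 * r)
        / ((i : ℕ) + 1)),
      (_, fun i => (∑ j ∈ Finset.range (i + 1), (sgn ((I.F1 j ∧ I.IsBit j) ∨ j = 0) + 1) / 2 * r)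
        / ((i : ℕ) + 1)),
      (_, fun i => (∑ j ∈ Finset.range (i + 1), (sgn (I.F2 j ∧ I.IsPad j) + 1) / 2 * r)
        / ((i : ℕ) + 1)),
      (_, fun i => (∑ j ∈ Finset.range (i + 1), (sgn (j = 0) + 1) / 2 * r) / ((i : ℕ) + 1)),
      (_, fun i => (∑ j ∈ Finset.range (i + 1), (I.D2 * r - (sgn (j = 0) + 1) / 2 * (I.D2 * r)
        - (sgn (I.F1 j) + 1) / 2 * (I.D3 * r))) / ((i : ℕ) + 1)),
      (_, fun i => (∑ j ∈ Finset.range (i + 1), (sgn (j = 0) + 1) / 2 * (I.D2 * r))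
        / ((i : ℕ) + 1)),
      (_, fun i => (∑ j ∈ Finset.range (i + 1), (I.D1 * r - (sgn (j = 0) + 1) / 2 * (I.D1 * r)
        - (sgn (I.F2 j) + 1) / 2 * (I.D2 * r))) / ((i : ℕ) + 1)),
      (_, fun i => (∑ j ∈ Finset.range (i + 1), (sgn (j = 0) + 1) / 2 * (I.D1 * r))
        / ((i : ℕ) + 1))]
    (by decide) (by decide) rfl (fun i => by rw [hn]; exact I.ρ8_ge) ?_ ?_
  · simp only [List.forall_mem_cons]
    refine ⟨HeadSpec.attends_causal _ rfl rfl (by decide) fun j => ?_,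
      HeadSpec.attends_causal _ rfl rfl (by decide) fun j => ?_,
      HeadSpec.attends_causal _ rfl rfl (by decide) fun j => ?_,
      HeadSpec.attends_causal _ rfl rfl (by decide) fun j => ?_,
      HeadSpec.attends_causal _ rfl rfl (by decide) fun j => ?_,
      HeadSpec.attends_causal _ rfl rfl (by decide) fun j => ?_,
      HeadSpec.attends_causal _ rfl rfl (by decide) fun j => ?_,
      HeadSpec.attends_causal _ rfl rfl (by decide) fun j => ?_, by simp⟩
    all_goals
      rw [hn, hr]
      simp [st, time, val]
      field_simp
      try ring
  · intro i
    have hi : ((i : ℕ) : ℝ) + 1 ≠ 0 := by positivity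
    have k1 := I.kn_eq i
    have k2 := I.e2_eq i
    simp only [Finset.sum_sub_distrib, ← Finset.sum_mul, sum_cnt, cnt_zero_eq, Finset.sum_const,
      Finset.card_range, nsmul_eq_mul]
    simp only [hr]
    simp [st, time, val, init, Inst.e1, Inst.ib, Inst.ip]
    refine ⟨?_, ?_, ?_, ?_, ?_, ?_, ?_, ?_⟩ <;> field_simp
    · rw [← k1, ← I.D2_mul]; ring
    · rw [← k2, ← I.D1_mul]; ring

end Connectivity

/-! ### The remaining initial sublayers and their composition -/

namespace Connectivity

open Coord

variable {I : Inst}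

/-- The smallest vectors to be normalized are those turned into hashes. Their scale is at least `1 /
(27 N²)`, which exceeds `N⁻⁶` because `N ≥ 5`. -/
theorem Inst.one_div_pow_le {D q : ℝ} (hD : 1 / (3 * (I.N : ℝ)) ≤ D) (hq : 0 < q)
    (hq' : q ≤ 9 * I.N) : 1 / (I.N : ℝ) ^ 6 ≤ D / q := by
  have hN := I.N_real_ge
  refine le_trans ?_ (div_le_div_of_nonneg_right hD hq.le)
  refine le_trans ?_ (div_le_div_of_nonneg_left (by positivity) hq hq')
  rw [div_div]
  refine one_div_le_one_div_of_le (by positivity) ?_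
  have h4 : (5 : ℝ) ^ 4 ≤ (I.N : ℝ) ^ 4 := by gcongr
  have : (I.N : ℝ) ^ 6 = (I.N : ℝ) ^ 4 * (I.N : ℝ) ^ 2 := by ring
  rw [this]
  have h2 : 0 < (I.N : ℝ) ^ 2 := by positivity
  nlinarith

theorem Inst.one_div_pow_le_one : 1 / (I.N : ℝ) ^ 6 ≤ 1 := by
  have := I.N_real_ge
  rw [div_le_one (by positivity)]
  exact one_le_pow₀ (by linarith)

theorem Inst.one_div_pow_le_one_div : 1 / (I.N : ℝ) ^ 6 ≤ 1 / I.N := by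
  have hN := I.N_real_ge
  refine one_div_le_one_div_of_le (by linarith) ?_
  have : 1 ≤ (I.N : ℝ) ^ 5 := one_le_pow₀ (by linarith)
  nlinarith

theorem layer_step {A : AttSpec Coord} {F : FFSpec Coord} {k : ℕ} {ρ ρ' γ : ℝ} (hρ : ρ ≤ ρ')
    (hA : A.Ideal ρ' γ (fun i : Fin I.N => st I k i) (fun i => st I (k + 1) i))
    (hF : ∀ i : Fin I.N, ρ ≤ nrm F.mask (st I (k + 1) i) ∧
      ∀ c, st I (k + 2) i c = F.ideal (st I (k + 1) i) c) :
    LayerSpec.Step ⟨A, F⟩ ρ γ (fun i : Fin I.N => st I k i) (fun i => st I (k + 2) i) :=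
  ⟨_, ⟨fun i => hρ.trans (hA.1 i), hA.2⟩, fun i => (hF i).1, fun i => (hF i).2⟩

theorem idle_step {F : FFSpec Coord} {k : ℕ} {γ : ℝ} (ht : ∀ c, time c ≠ k)
    (hF : ∀ i : Fin I.N, 1 / (I.N : ℝ) ^ 6 ≤ nrm F.mask (st I (k + 1) i) ∧
      ∀ c, st I (k + 2) i c = F.ideal (st I (k + 1) i) c) :
    LayerSpec.Step ⟨idleAtt, F⟩ (1 / (I.N : ℝ) ^ 6) γ (fun i : Fin I.N => st I k i)
      (fun i => st I (k + 2) i) :=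
  layer_step I.one_div_pow_le_one (st_idle ht) hF

theorem hash_ff {a b c d : Coord} {k : ℕ} (x r : ℕ → ℝ)
    (hr : ∀ i : Fin I.N, 1 / (I.N : ℝ) ^ 6 ≤ r i)
    (ht : ∀ c', time c' = k → c' ∈ [c, d]) (hcd : c ≠ d)
    (hv : ∀ i : ℕ, st I k i a = r i * x i ∧ st I k i b = r i ∧
      st I k i c = 0 ∧ st I k i d = 0 ∧ st I (k + 1) i c = hash₁ (x i) ∧
      st I (k + 1) i d = hash₂ (x i)) (i : Fin I.N) :
    1 / (I.N : ℝ) ^ 6 ≤ nrm (hashFF a b c d).mask (st I k i) ∧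
      ∀ c', st I (k + 1) i c' = (hashFF a b c d).ideal (st I k i) c' := by
  have hN := I.N_real_ge
  have h0 : 0 < r i := lt_of_lt_of_le (by positivity) (hr i)
  obtain ⟨va, vb, vc, vd, vc', vd'⟩ := hv i
  obtain ⟨h1, h2⟩ := st_hash h0 ht hcd va vb vc vd vc' vd'
  refine ⟨?_, h2⟩
  refine (hr i).trans ?_
  rw [hashFF, h1]
  exact le_mul_of_one_le_right h0.le (by rw [Real.one_le_sqrt]; nlinarith [sq_nonneg (x i)])

theorem Inst.hash_dot_le {x y : ℕ} (hx : x ≤ I.N) (hy : y ≤ I.N) (hxy : x ≠ y) :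
    hash₁ x * hash₁ y + hash₂ x * hash₂ y ≤ 1 - 1 / (32 * (I.N : ℝ) ^ 6) := by
  have hN := I.N_real_ge
  have hb : ∀ z : ℕ, z ≤ I.N → (z : ℝ) ^ 2 + 1 ≤ (2 * (I.N : ℝ)) ^ 2 := fun z hz =>
    sq_add_one_le (by linarith) (by linarith [(Nat.cast_nonneg z : (0 : ℝ) ≤ z)])
      (Nat.cast_le.2 hz)
  refine LoopedTransformer.hash_dot_le (by linarith) (hb x hx) (hb y hy) ?_
  have h1 : (1 : ℝ) ≤ |(x : ℝ) - y| := by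
    have : (x : ℤ) - y ≠ 0 := by omega
    have := Int.one_le_abs this
    exact_mod_cast this
  refine le_trans ?_ h1
  rw [div_le_one (by linarith)]
  linarith

theorem cnt_le (P : ℕ → Prop) (i : ℕ) : Inst.cnt P i ≤ i + 1 := by
  classical
  exact (Finset.card_filter_le _ _).trans_eq (Finset.card_range _)

theorem Inst.ib_le {i : ℕ} (hi : i < I.N) : I.ib i ≤ I.N := (cnt_le _ i).trans hi

theorem Inst.ip_le {i : ℕ} (hi : i < I.N) : I.ip i ≤ I.N := (cnt_le _ i).trans hi

theorem Inst.e1_le {i : ℕ} (hi : i < I.N) : I.e1 i ≤ I.N := (cnt_le _ i).trans hi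

theorem mod_add_one_le {i d N : ℕ} (hi : i < N) : (if i = 0 then 0 else (i - 1) % d + 1) ≤ N := by
  have := Nat.mod_le (i - 1) d
  split_ifs <;> omega

theorem Inst.kn_le {i : ℕ} (hi : i < I.N) : I.kn i ≤ I.N := mod_add_one_le hi

theorem Inst.e2_le {i : ℕ} (hi : i < I.N) : I.e2 i ≤ I.N := mod_add_one_le hi

theorem att15_ideal : att15.Ideal 1 I.γ (fun i : Fin I.N => st I 30 i) (fun i => st I 31 i) := by
  have hn : ∀ i : ℕ, nrm att15.mask (st I 30 i) = 3 := fun i =>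
    nrm_eq (by norm_num) (by
      have h1 := hash_sq i
      have h2 := hash_sq I.θ2
      have h3 := hash_sq (I.ib i)
      have h4 := hash_sq (I.kn i)
      by_cases h : i = 0
      · simp [att15, st, time, val, init, h] at h3 h4 ⊢
        linarith
      · simp [att15, st, time, val, init, h]
        linarith)
  have hN := I.N_real_ge
  refine st_att [dg]
    [(_, fun i => sgn (I.Dg i))]
    (by decide) (by decide) rfl (fun i => by rw [hn]; norm_num) ?_ ?_
  · simp only [List.forall_mem_cons]
    refine ⟨fun i => Inst.attends_exists (fun j => (i : ℕ) ≠ 0 ∧ I.ib i = j ∧ I.kn i = j) 2 rfl rfl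
        (by decide) (by decide) (fun j => hn j) (fun j => by simp [st, time, init]) ?_ ?_ ?_,
      by simp⟩
    · intro j hj
      simp [HeadSpec.score, st, time, val, init, hj, Inst.thr]
      ring
    · intro j hj hP
      have := hash_dot_self j
      simp [HeadSpec.score, st, time, val, init, hj.ne', hP.2.1, hP.2.2]
      linarith
    · intro j hj hP
      have h1 := hash_dot_le_one (I.ib i) j
      have h2 := hash_dot_le_one (I.kn i) j
      have : hash₁ (I.ib i) * hash₁ j + hash₂ (I.ib i) * hash₂ j +
          (hash₁ (I.kn i) * hash₁ j + hash₂ (I.kn i) * hash₂ j) ≤ 2 - 1 / (32 * (I.N : ℝ) ^ 6) := by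
        by_cases hb : I.ib i = j
        · have hk : I.kn i ≠ j := fun hk => hP ⟨fun h0 => by
            rw [h0] at hk
            simp [Inst.kn] at hk
            omega, hb, hk⟩
          have := I.hash_dot_le (I.kn_le i.2) j.2.le hk
          linarith
        · have := I.hash_dot_le (I.ib_le i.2) j.2.le hb
          linarith
      simp [HeadSpec.score, st, time, val, init, hj.ne']
      simp at this
      linarith
  · intro i
    simp [st, time, val, init]

theorem ff15_ideal (i : ℕ) : ∀ c, st I 32 i c = ff15.ideal (st I 31 i) c := by
  have hn : nrm ff15.mask (st I 31 i) = 2 :=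
    nrm_eq (by norm_num) (by simp [ff15, st, time, val, init]; norm_num)
  refine st_ff [B] (by decide) (by decide) (by decide) hn ?_
  have he : I.IsEdge i → I.IsBit i := fun h => h.1
  simp [ff15, st, time, val, init]
  unfold Inst.B0
  by_cases h1 : I.IsBit i <;> by_cases h2 : I.IsEdge i <;> by_cases h3 : I.Dg i <;>
    simp [sgn, h1, h2, h3] at he ⊢ <;> norm_num

theorem relu_key {P : Prop} [Decidable P] {x : ℝ} (h0 : 0 ≤ x) (h1 : x ≤ 1) :
    (if P then 0 else x) = 3 * max 0 ((x + (-sgn P + -1)) / 3) := by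
  by_cases h : P
  · rw [sgn_true h, if_pos h, max_eq_left (by linarith)]
    simp
  · rw [sgn_false h, if_neg h, max_eq_right (by linarith)]
    ring

theorem ff16_ideal (i : ℕ) : ∀ c, st I 34 i c = ff16.ideal (st I 33 i) c := by
  have hn : nrm ff16.mask (st I 33 i) = 3 :=
    nrm_eq (by norm_num) (by
      have h1 := hash_sq (I.ip i)
      have h3 := hash_sq (I.ib i)
      have h4 := hash_sq (I.kn i)
      simp [ff16, st, time, val, init]
      linarith)
  refine st_ff [IBk1, IBk2, IPk1, IPk2, Rk1, Rk2] (by decide) (by decide) (by decide) hn ?_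
  have h1 := fun x : ℕ => relu_key (P := i = 0) (hash₁_nonneg (Nat.cast_nonneg x))
    (hash₁_le_one x)
  have h2 := fun x : ℕ => relu_key (P := i = 0) (hash₂_pos x).le (hash₂_le_one x)
  simp [ff16, st, time, val, init, h1, h2]

theorem initial_steps : LayerSpec.Steps (1 / (I.N : ℝ) ^ 6) I.γ transformer.initial
    (fun i : Fin I.N => st I 0 i) (fun i => st I 34 i) := by
  have hN := I.N_real_ge
  have h1 := I.one_div_pow_le_one
  have h3 : 1 / (3 * (I.N : ℝ)) ≤ 1 := by
    rw [div_le_one (by positivity)]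
    linarith
  have hi : ∀ i : Fin I.N, (0 : ℝ) < (i : ℕ) + 1 ∧ ((i : ℕ) + 1 : ℝ) ≤ I.N := fun i =>
    ⟨by positivity, by exact_mod_cast i.2⟩
  have h4 : ∀ i : Fin I.N, 0 < ((i : ℕ) + 1 : ℝ) * I.ρ4 ∧ ((i : ℕ) + 1 : ℝ) * I.ρ4 ≤ 9 * I.N := by
    intro i
    have := I.one_le_ρ4
    have := I.ρ4_le
    obtain ⟨ha, hb⟩ := hi i
    exact ⟨by positivity, by nlinarith⟩
  have h8 : ∀ i : Fin I.N, 0 < I.ρ7 * I.ρ8 * ((i : ℕ) + 1 : ℝ) ∧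
      I.ρ7 * I.ρ8 * ((i : ℕ) + 1 : ℝ) ≤ 9 * I.N := by
    intro i
    have a1 := I.one_le_ρ7
    have a2 := I.ρ7_le
    have a3 := I.ρ8_pos
    have a4 := I.ρ8_le
    obtain ⟨ha, hb⟩ := hi i
    have a5 : I.ρ7 * I.ρ8 ≤ 3 * 3 := by gcongr
    exact ⟨by positivity, by nlinarith⟩
  refine ⟨_, layer_step h1 att0_ideal fun i =>
      ⟨h1.trans (one_le_nrm_st I 1 i (by decide)), ff0_ideal i⟩,
    _, idle_step (by decide) fun i => ⟨h1.trans (one_le_nrm_st I 3 i (by decide)), ff1_ideal i⟩,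
    _, idle_step (by decide) fun i => ⟨h1.trans (one_le_nrm_st I 5 i (by decide)), ff2_ideal i⟩,
    _, idle_step (by decide) fun i => ⟨h1.trans (one_le_nrm_st I 7 i (by decide)), ff3_ideal i⟩,
    _, layer_step h1 att4_ideal fun i => ⟨?_, (ff4_ideal i).2⟩,
    _, idle_step (by decide) (hash_ff (fun i => ((i : ℝ) - 1) / I.n)
      (fun i => I.D3 / (((i : ℕ) + 1 : ℝ) * I.ρ4))
      (fun i => I.one_div_pow_le I.D3_ge (h4 i).1 (h4 i).2) (by decide) (by decide) ?_),
    _, idle_step (by decide) (hash_ff (fun i => ((i : ℝ) - 1) / I.n ^ 2)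
      (fun i => I.D2 / (((i : ℕ) + 1 : ℝ) * I.ρ4))
      (fun i => I.one_div_pow_le I.D2_ge (h4 i).1 (h4 i).2) (by decide) (by decide) ?_),
    _, layer_step h1 att7_ideal fun i =>
      ⟨h1.trans (one_le_nrm_st I 15 i (by decide)), ff7_ideal i⟩,
    _, layer_step ?_ att8_ideal (hash_ff (fun i => I.e1 i)
      (fun i => 1 / (I.ρ7 * I.ρ8 * ((i : ℕ) + 1 : ℝ)))
      (fun i => I.one_div_pow_le h3 (h8 i).1 (h8 i).2) (by decide) (by decide) ?_),
    _, idle_step (by decide) (hash_ff (fun i => I.e2 i)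
      (fun i => I.D1 / (I.ρ7 * I.ρ8 * ((i : ℕ) + 1 : ℝ)))
      (fun i => I.one_div_pow_le I.D1_ge (h8 i).1 (h8 i).2) (by decide) (by decide) ?_),
    _, idle_step (by decide) (hash_ff (fun i => I.kn i)
      (fun i => I.D2 / (I.ρ7 * I.ρ8 * ((i : ℕ) + 1 : ℝ)))
      (fun i => I.one_div_pow_le I.D2_ge (h8 i).1 (h8 i).2) (by decide) (by decide) ?_),
    _, idle_step (by decide) (hash_ff (fun i => I.ib i)
      (fun i => 1 / (I.ρ7 * I.ρ8 * ((i : ℕ) + 1 : ℝ)))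
      (fun i => I.one_div_pow_le h3 (h8 i).1 (h8 i).2) (by decide) (by decide) ?_),
    _, idle_step (by decide) (hash_ff (fun i => I.ip i)
      (fun i => 1 / (I.ρ7 * I.ρ8 * ((i : ℕ) + 1 : ℝ)))
      (fun i => I.one_div_pow_le h3 (h8 i).1 (h8 i).2) (by decide) (by decide) ?_),
    _, idle_step (by decide) (hash_ff (fun _ => (I.s + 1 : ℕ)) (fun _ => I.w1)
      (fun i => I.one_div_pow_le_one_div) (by decide) (by decide) ?_),
    _, idle_step (by decide) (hash_ff (fun _ => (I.t + 1 : ℕ)) (fun _ => I.w1)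
      (fun i => I.one_div_pow_le_one_div) (by decide) (by decide) ?_),
    _, layer_step h1 att15_ideal fun i =>
      ⟨h1.trans (one_le_nrm_st I 31 i (by decide)), ff15_ideal i⟩,
    _, idle_step (by decide) fun i => ⟨h1.trans (one_le_nrm_st I 33 i (by decide)), ff16_ideal i⟩,
    rfl⟩
  · refine (I.one_div_pow_le_one_div.trans ?_).trans (ff4_ideal i).1
    exact one_div_le_one_div_of_le (hi i).1 (hi i).2
  case refine_4 =>
    have := I.one_div_pow_le_one_div
    have h5 : 1 / (I.N : ℝ) ≤ 1 / 5 := one_div_le_one_div_of_le (by norm_num) hN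
    linarith
  all_goals
    intro i
    simp [st, time, val, init]

end Connectivity

namespace Connectivity

open Coord

/-! ### The repeated block -/

/-- The values of the variables of the loop. -/
structure Vars where
  B : ℕ → Prop
  u : ℕ → ℝ
  v : ℕ → ℝ
  C : ℕ → ℝ
  e : ℕ → ℝ
  ans : ℕ → ℝ

/-- The values of the coordinates in the loop. -/
def loopVal (I : Inst) (x : Vars) (i : ℕ) : Coord → ℝ
  | B => sgn (x.B i)
  | u => x.u i
  | v => x.v i
  | C => x.C i
  | e => x.e i
  | ans => x.ans i
  | c => val I i c

namespace Inst

variable (I : Inst) (b : ℕ → Prop)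

def U (i : ℕ) : Prop := ∃ j, 0 < j ∧ j < I.N ∧ (b j ∧ I.e1 i = j)

def V (i : ℕ) : Prop := ∃ j, 0 < j ∧ j < I.N ∧ (b j ∧ I.e2 i = j)

def W (i : ℕ) : Prop := (I.U b i ∧ I.V b i) ∧ I.IsPad i

def E (i : ℕ) : Prop := ∃ j, 0 < j ∧ j < I.N ∧ (I.W b j ∧ I.ib i = I.ip j ∧ I.kn i = I.kn j)

/-- The set that the repeated block computes from the set `b`. -/
def next (i : ℕ) : Prop := I.E b i ∧ I.IsBit i

def Ans : Prop := ∃ j, 0 < j ∧ j < I.N ∧ (b j ∧ I.s + 1 = I.ib j ∧ I.t + 1 = I.kn j)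

theorem not_isBit_zero : ¬I.IsBit 0 := fun h => absurd h.1 (by omega)

theorem not_isPad_zero : ¬I.IsPad 0 := fun h => absurd h.1 (by omega)

theorem one_div_le_one : 1 / (32 * (I.N : ℝ) ^ 6) ≤ 1 := by
  have hN := I.N_real_ge
  rw [div_le_one (by positivity)]
  have : 1 ≤ (I.N : ℝ) ^ 6 := one_le_pow₀ (by linarith)
  linarith

end Inst

variable {I : Inst}

theorem st_eq_loopVal (i : ℕ) : st I 34 i = loopVal I ⟨I.B0, 0, 0, 0, 0, 0⟩ i := by
  ext c
  cases c <;> simp [st, time, val, loopVal, init]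

theorem one_le_nrm_loopVal {S : List Coord} (h : one ∈ S) (x : Vars) (i : ℕ) :
    1 ≤ nrm S (loopVal I x i) := by
  refine le_trans ?_ (abs_le_nrm h)
  simp [loopVal, val, init]

/-- That `b` fails at BoS is an invariant of the loop; it fixes the default score at exactly `3 -
thr`. -/
theorem attA_ideal {b : ℕ → Prop} (h0 : ¬b 0) :
    attA.Ideal 1 I.γ (fun i : Fin I.N => loopVal I ⟨b, 0, 0, 0, 0, 0⟩ i)
      (fun i => loopVal I ⟨b, fun i => sgn (I.U b i), fun i => sgn (I.V b i), 0, 0, 0⟩ i) := by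
  have hn : ∀ i : ℕ, nrm attA.mask (loopVal I ⟨b, 0, 0, 0, 0, 0⟩ i) = 3 := fun i =>
    nrm_eq (by norm_num) (by
      have h1 := hash_sq i
      have h2 := hash_sq I.θ2
      have h3 := hash_sq (I.e1 i)
      have h4 := hash_sq (I.e2 i)
      by_cases h : i = 0
      · simp [attA, loopVal, val, init, h] at h3 h4 ⊢
        linarith
      · simp [attA, loopVal, val, init, h]
        linarith)
  have hN := I.N_real_ge
  have key : ∀ {i : Fin I.N} {x : ℕ}, x ≤ I.N → ∀ j : Fin I.N,
      ¬ (b j ∧ x = j) → hash₁ x * hash₁ j + (hash₂ x * hash₂ j + 2 * sgn (b j))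
        ≤ 3 - 1 / (32 * (I.N : ℝ) ^ 6) := by
    intro i x hx j hP
    by_cases hb : b j
    · have := I.hash_dot_le hx j.2.le fun h => hP ⟨hb, h⟩
      rw [sgn_true hb]
      linarith
    · have := hash_dot_le_one x j
      have := I.one_div_le_one
      rw [sgn_false hb]
      linarith
  refine AttSpec.ideal_of_forall [u, v]
    [(_, fun i => sgn (I.U b i)), (_, fun i => sgn (I.V b i))]
    (fun i => by rw [hn]; norm_num) rfl (by decide) ?_ ?_ ?_
  · intro i c hc
    cases c <;> first | rfl | (simp at hc)
  · simp only [List.forall_mem_cons]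
    refine ⟨fun i => Inst.attends_exists (fun j => b j ∧ I.e1 i = j) 3 rfl rfl
        (by decide) (by decide) (fun j => hn j) (fun j => by simp [loopVal, val, init]) ?_ ?_ ?_,
      fun i => Inst.attends_exists (fun j => b j ∧ I.e2 i = j) 3 rfl rfl
        (by decide) (by decide) (fun j => hn j) (fun j => by simp [loopVal, val, init]) ?_ ?_ ?_,
      by simp⟩
    · intro j hj
      simp [HeadSpec.score, loopVal, val, init, hj, Inst.thr, sgn_false h0]
      ring
    · intro j hj hP
      have := hash_dot_self j
      simp [HeadSpec.score, loopVal, val, init, hj.ne', hP.2, sgn_true hP.1]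
      linarith
    · intro j hj hP
      simpa [HeadSpec.score, loopVal, val, init, hj.ne'] using key (i := i) (I.e1_le i.2) j hP
    · intro j hj
      simp [HeadSpec.score, loopVal, val, init, hj, Inst.thr, sgn_false h0]
      ring
    · intro j hj hP
      have := hash_dot_self j
      simp [HeadSpec.score, loopVal, val, init, hj.ne', hP.2, sgn_true hP.1]
      linarith
    · intro j hj hP
      simpa [HeadSpec.score, loopVal, val, init, hj.ne'] using key (i := i) (I.e2_le i.2) j hP
  · intro i
    simp [loopVal]

theorem ffA_ideal (b : ℕ → Prop) (i : ℕ) : ∀ c,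
    loopVal I ⟨b, 0, 0, fun i => sgn (I.W b i), 0, 0⟩ i c =
    ffA.ideal (loopVal I ⟨b, fun i => sgn (I.U b i), fun i => sgn (I.V b i), 0, 0, 0⟩ i) c := by
  have hn : nrm ffA.mask (loopVal I ⟨b, fun i => sgn (I.U b i), fun i => sgn (I.V b i), 0, 0, 0⟩ i)
      = 2 := nrm_eq (by norm_num) (by simp [ffA, loopVal, val, init]; norm_num)
  refine FFSpec.eq_ideal [u, v, C] hn (by decide) (by decide) ?_ ?_
  · intro c hc
    cases c <;> first | rfl | (simp at hc)
  · simp [ffA, copy, loopVal, val, init]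
    unfold Inst.W
    by_cases h1 : I.U b i <;> by_cases h2 : I.V b i <;> by_cases h3 : I.IsPad i <;>
      simp [sgn, h1, h2, h3] <;> norm_num

/-- Two hashed equalities and a flag. -/
theorem Inst.hash_dot_flag_le {x x' y y' : ℕ} {P : Prop} (hx : x ≤ I.N) (hx' : x' ≤ I.N)
    (hy : y ≤ I.N) (hy' : y' ≤ I.N) (h : ¬(P ∧ x = y ∧ x' = y')) :
    hash₁ x * hash₁ y + (hash₂ x * hash₂ y + (hash₁ x' * hash₁ y' + (hash₂ x' * hash₂ y' +
      3 * sgn P))) ≤ 5 - 1 / (32 * (I.N : ℝ) ^ 6) := by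
  have h1 := hash_dot_le_one x y
  have h2 := hash_dot_le_one x' y'
  by_cases hP : P
  · rw [sgn_true hP]
    by_cases hxy : x = y
    · have := I.hash_dot_le hx' hy' fun h' => h ⟨hP, hxy, h'⟩
      linarith
    · have := I.hash_dot_le hx hy hxy
      linarith
  · have := I.one_div_le_one
    rw [sgn_false hP]
    linarith

theorem attB_ideal (b : ℕ → Prop) :
    attB.Ideal 1 I.γ (fun i : Fin I.N => loopVal I ⟨b, 0, 0, fun i => sgn (I.W b i), 0, 0⟩ i)
      (fun i => loopVal I ⟨b, 0, 0, fun i => sgn (I.W b i), fun i => sgn (I.E b i), 0⟩ i) := by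
  have hn : ∀ i : ℕ, nrm attB.mask (loopVal I ⟨b, 0, 0, fun i => sgn (I.W b i), 0, 0⟩ i) = 3 :=
    fun i => nrm_eq (by norm_num) (by
      have h1 := hash_sq (I.ib i)
      have h2 := hash_sq I.θ2
      have h3 := hash_sq (I.kn i)
      have h4 := hash_sq (I.ip i)
      by_cases h : i = 0
      · simp [attB, loopVal, val, init, h] at h1 h3 h4 ⊢
        linarith
      · simp [attB, loopVal, val, init, h]
        linarith)
  have h0 : ¬I.W b 0 := fun h => I.not_isPad_zero h.2
  refine AttSpec.ideal_of_forall [e] [(_, fun i => sgn (I.E b i))]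
    (fun i => by rw [hn]; norm_num) rfl (by decide) ?_ ?_ ?_
  · intro i c hc
    cases c <;> first | rfl | (simp at hc)
  · simp only [List.forall_mem_cons]
    refine ⟨fun i => Inst.attends_exists (fun j => I.W b j ∧ I.ib i = I.ip j ∧ I.kn i = I.kn j) 5
        rfl rfl (by decide) (by decide) (fun j => hn j) (fun j => by simp [loopVal, val, init])
        ?_ ?_ ?_, by simp⟩
    · intro j hj
      simp [HeadSpec.score, loopVal, val, init, hj, Inst.thr, sgn_false h0]
      ring
    · intro j hj hP
      have h1 := hash_dot_self (I.ip j)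
      have h2 := hash_dot_self (I.kn j)
      simp [HeadSpec.score, loopVal, val, init, hj.ne', hP.2, sgn_true hP.1]
      linarith
    · intro j hj hP
      simpa [HeadSpec.score, loopVal, val, init, hj.ne'] using
        I.hash_dot_flag_le (I.ib_le i.2) (I.kn_le i.2) (I.ip_le j.2) (I.kn_le j.2) hP
  · intro i
    simp [loopVal]

theorem ffB_ideal (b : ℕ → Prop) (i : ℕ) : ∀ c,
    loopVal I ⟨I.next b, 0, 0, 0, 0, 0⟩ i c =
    ffB.ideal (loopVal I ⟨b, 0, 0, fun i => sgn (I.W b i), fun i => sgn (I.E b i), 0⟩ i) c := by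
  have hn : nrm ffB.mask (loopVal I ⟨b, 0, 0, fun i => sgn (I.W b i), fun i => sgn (I.E b i), 0⟩ i)
      = 3 := nrm_eq (by norm_num) (by simp [ffB, loopVal, val, init]; norm_num)
  refine FFSpec.eq_ideal [B, C, e] hn (by decide) (by decide) ?_ ?_
  · intro c hc
    cases c <;> first | rfl | (simp at hc)
  · simp [ffB, copy, loopVal, val, init]
    unfold Inst.next
    by_cases h1 : I.W b i <;> by_cases h2 : I.E b i <;> by_cases h3 : I.IsBit i <;>
      by_cases h4 : b i <;> simp [sgn, h1, h2, h3, h4] <;> norm_num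

theorem repeated_steps {b : ℕ → Prop} (h0 : ¬b 0) : LayerSpec.Steps 1 I.γ transformer.repeated
    (fun i : Fin I.N => loopVal I ⟨b, 0, 0, 0, 0, 0⟩ i)
    (fun i => loopVal I ⟨I.next b, 0, 0, 0, 0, 0⟩ i) :=
  ⟨_, ⟨_, attA_ideal h0, fun i => one_le_nrm_loopVal (by decide) _ i, fun i => ffA_ideal b i⟩,
    _, ⟨_, attB_ideal b, fun i => one_le_nrm_loopVal (by decide) _ i, fun i => ffB_ideal b i⟩, rfl⟩

theorem attOut_ideal {b : ℕ → Prop} (h0 : ¬b 0) :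
    attOut.Ideal 1 I.γ (fun i : Fin I.N => loopVal I ⟨b, 0, 0, 0, 0, 0⟩ i)
      (fun i => loopVal I ⟨b, 0, 0, 0, 0, fun _ => sgn (I.Ans b)⟩ i) := by
  have hn : ∀ i : ℕ, nrm attOut.mask (loopVal I ⟨b, 0, 0, 0, 0, 0⟩ i) = 3 :=
    fun i => nrm_eq (by norm_num) (by
      have h1 := hash_sq (I.s + 1 : ℕ)
      have h2 := hash_sq I.θ2
      have h3 := hash_sq (I.t + 1 : ℕ)
      have h4 := hash_sq (I.ib i)
      have h5 := hash_sq (I.kn i)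
      by_cases h : i = 0
      · simp [attOut, loopVal, val, init, h] at h1 h3 h4 ⊢
        linarith
      · simp [attOut, loopVal, val, init, h] at h1 h3 h4 ⊢
        linarith)
  have hs : I.s + 1 ≤ I.N := by unfold Inst.N; omega
  have ht : I.t + 1 ≤ I.N := by unfold Inst.N; omega
  refine AttSpec.ideal_of_forall [ans] [(_, fun i => sgn (I.Ans b))]
    (fun i => by rw [hn]; norm_num) rfl (by decide) ?_ ?_ ?_
  · intro i c hc
    cases c <;> first | rfl | (simp at hc)
  · simp only [List.forall_mem_cons]
    refine ⟨fun i => Inst.attends_exists (fun j => b j ∧ I.s + 1 = I.ib j ∧ I.t + 1 = I.kn j) 5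
        rfl rfl (by decide) (by decide) (fun j => hn j) (fun j => by simp [loopVal, val, init])
        ?_ ?_ ?_, by simp⟩
    · intro j hj
      simp [HeadSpec.score, loopVal, val, init, hj, Inst.thr, sgn_false h0]
      ring
    · intro j hj hP
      have h1 := hash_dot_self (I.ib j)
      have h2 := hash_dot_self (I.kn j)
      simp [HeadSpec.score, loopVal, val, init, hj.ne', sgn_true hP.1, hP.2.1, hP.2.2, -Nat.cast_add]
      linarith
    · intro j hj hP
      simpa [HeadSpec.score, loopVal, val, init, hj.ne'] using
        I.hash_dot_flag_le hs ht (I.ib_le j.2) (I.kn_le j.2) hP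
  · intro i
    simp [loopVal]

theorem final_steps {b : ℕ → Prop} (h0 : ¬b 0) : LayerSpec.Steps 1 I.γ transformer.final
    (fun i : Fin I.N => loopVal I ⟨b, 0, 0, 0, 0, 0⟩ i)
    (fun i => loopVal I ⟨b, 0, 0, 0, 0, fun _ => sgn (I.Ans b)⟩ i) :=
  ⟨_, ⟨_, attOut_ideal h0, fun i => one_le_nrm_loopVal (by decide) _ i, fun i c => by
    simp [FFSpec.ideal, idleFF]⟩, rfl⟩

end Connectivity

/-! ### Reachability by repeated squaring -/

section Within

variable {V : Type} (r : V → V → Prop)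

/-- `Within r k a c` says that there is a path of length at most `k` from `a` to `c`. -/
def Within : ℕ → V → V → Prop
  | 0, a, c => a = c
  | k + 1, a, c => ∃ m, Within k a m ∧ (r m c ∨ m = c)

variable {r}

theorem Within.reflTransGen : ∀ {k : ℕ} {a c : V}, Within r k a c → Relation.ReflTransGen r a c
  | 0, _, _, h => h ▸ .refl
  | _ + 1, _, _, ⟨_, h, .inl h'⟩ => (Within.reflTransGen h).tail h'
  | _ + 1, _, _, ⟨_, h, .inr h'⟩ => h' ▸ Within.reflTransGen h

theorem Within.succ {k : ℕ} {a c : V} (h : Within r k a c) : Within r (k + 1) a c :=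
  ⟨c, h, .inr rfl⟩

theorem Within.mono {k l : ℕ} (hkl : k ≤ l) {a c : V} (h : Within r k a c) : Within r l a c := by
  induction hkl with
  | refl => exact h
  | step _ ih => exact ih.succ

theorem within_one {a c : V} : Within r 1 a c ↔ r a c ∨ a = c := by
  simp [Within]

theorem within_add {j k : ℕ} {a c : V} :
    Within r (j + k) a c ↔ ∃ m, Within r j a m ∧ Within r k m c := by
  induction k generalizing c with
  | zero => simp [Within]
  | succ k ih =>
    constructor
    · rintro ⟨m, h, h'⟩
      obtain ⟨m', h1, h2⟩ := ih.1 h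
      exact ⟨m', h1, m, h2, h'⟩
    · rintro ⟨m, h, m', h1, h2⟩
      exact ⟨m', ih.2 ⟨m, h, h1⟩, h2⟩

/-- The sets reached within `k` steps increase, and once two consecutive ones agree they stay
constant. In a set of `|V|` elements this happens by step `|V|`. -/
theorem within_card_of_reflTransGen [Fintype V] {a c : V} (h : Relation.ReflTransGen r a c) :
    Within r (Fintype.card V) a c := by
  classical
  set S : ℕ → Finset V := fun k => Finset.univ.filter (Within r k a) with hS
  have mem : ∀ {k c}, c ∈ S k ↔ Within r k a c := by simp [hS]
  have mono : Monotone S := fun k l hkl c hc => mem.2 ((mem.1 hc).mono hkl)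
  have step : ∀ m, S m = S (m + 1) → S (m + 1) = S (m + 2) := by
    intro m hm
    ext c
    rw [mem, mem]
    refine ⟨Within.succ, ?_⟩
    rintro ⟨m', h1, h2⟩
    exact ⟨m', mem.1 (hm ▸ mem.2 h1), h2⟩
  have eq_of_card : ∀ {k l}, k ≤ l → (S k).card = (S l).card → S k = S l := fun hkl h =>
    Finset.eq_of_subset_of_card_le (mono hkl) h.ge
  have stab := fun l (hl : Fintype.card V ≤ l) => Nat.stabilises_of_monotone
    (f := fun k => (S k).card) (fun k l hkl => Finset.card_le_card (mono hkl))
    (fun m => Finset.card_le_univ _)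
    (fun m hm => congrArg Finset.card (step m (eq_of_card m.le_succ hm))) hl
  obtain ⟨k, hk⟩ : ∃ k, Within r k a c := by
    induction h with
    | refl => exact ⟨0, rfl⟩
    | tail _ h' ih =>
      obtain ⟨k, hk⟩ := ih
      exact ⟨k + 1, _, hk, .inl h'⟩
  have h1 := mem.2 (hk.mono (le_max_left k (Fintype.card V)))
  rw [← eq_of_card (le_max_right k _) (stab _ (le_max_right k _)).symm] at h1
  exact mem.1 h1

theorem within_iff_reflTransGen [Fintype V] {k : ℕ} (hk : Fintype.card V ≤ k) {a c : V} :
    Within r k a c ↔ Relation.ReflTransGen r a c :=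
  ⟨Within.reflTransGen, fun h => (within_card_of_reflTransGen h).mono hk⟩

end Within

namespace Connectivity

variable {I : Inst}

/-! ### Positions of bits and of padding tokens -/

theorem cnt_succ (P : ℕ → Prop) [DecidablePred P] (i : ℕ) :
    Inst.cnt P (i + 1) = Inst.cnt P i + if P (i + 1) then 1 else 0 := by
  rw [Inst.cnt, Inst.cnt, Finset.range_add_one, Finset.filter_insert]
  split_ifs with h
  · rw [Finset.card_insert_of_notMem (by simp)]
  · rfl

theorem cnt_eq_zero {P : ℕ → Prop} {i : ℕ} (h : ∀ j ≤ i, ¬P j) : Inst.cnt P i = 0 := by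
  classical
  rw [Inst.cnt, Finset.card_eq_zero, Finset.filter_eq_empty_iff]
  intro j hj
  exact h j (Nat.lt_succ_iff.1 (Finset.mem_range.1 hj))

namespace Inst

variable (I)

/-- The position of the bit for the pair `(a, c)`. -/
def bitPos (a c : ℕ) : ℕ := I.n * a + c + 1

/-- The position of the padding token for the triple `(a, m, c)`. -/
def padPos (a m c : ℕ) : ℕ := I.n ^ 2 + 1 + (I.n ^ 2 * a + (I.n * m + c))

variable {I}

theorem pair_lt {a c : ℕ} (ha : a < I.n) (hc : c < I.n) : I.n * a + c < I.n ^ 2 := by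
  have : I.n * (a + 1) ≤ I.n * I.n := Nat.mul_le_mul_left _ ha
  rw [sq]
  linarith

theorem triple_lt {a m c : ℕ} (ha : a < I.n) (hm : m < I.n) (hc : c < I.n) :
    I.n ^ 2 * a + (I.n * m + c) < I.n ^ 3 := by
  have h1 := pair_lt hm hc
  have : I.n ^ 2 * (a + 1) ≤ I.n ^ 2 * I.n := Nat.mul_le_mul_left _ ha
  rw [pow_succ I.n 2]
  linarith

theorem isBit_bitPos {a c : ℕ} (ha : a < I.n) (hc : c < I.n) : I.IsBit (I.bitPos a c) := by
  have := pair_lt ha hc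
  unfold IsBit bitPos
  omega

theorem IsBit.exists_eq {i : ℕ} (h : I.IsBit i) : ∃ a < I.n, ∃ c < I.n, i = I.bitPos a c := by
  obtain ⟨h1, h2⟩ := h
  refine ⟨(i - 1) / I.n, ?_, (i - 1) % I.n, Nat.mod_lt _ I.n_pos, ?_⟩
  · rw [Nat.div_lt_iff_lt_mul I.n_pos, ← sq]
    omega
  · have := Nat.div_add_mod (i - 1) I.n
    unfold bitPos
    omega

theorem isPad_padPos {a m c : ℕ} (ha : a < I.n) (hm : m < I.n) (hc : c < I.n) :
    I.IsPad (I.padPos a m c) := by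
  have := triple_lt ha hm hc
  unfold IsPad padPos
  omega

theorem IsPad.exists_eq {i : ℕ} (h : I.IsPad i) :
    ∃ a < I.n, ∃ m < I.n, ∃ c < I.n, i = I.padPos a m c := by
  obtain ⟨h1, h2⟩ := h
  have hn2 : 0 < I.n ^ 2 := Nat.pow_pos I.n_pos
  set q := i - (I.n ^ 2 + 1) with hq
  have hlt : q % I.n ^ 2 < I.n ^ 2 := Nat.mod_lt _ hn2
  refine ⟨q / I.n ^ 2, ?_, q % I.n ^ 2 / I.n, ?_, q % I.n ^ 2 % I.n, Nat.mod_lt _ I.n_pos, ?_⟩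
  · rw [Nat.div_lt_iff_lt_mul hn2, show I.n * I.n ^ 2 = I.n ^ 3 by ring]
    omega
  · rwa [Nat.div_lt_iff_lt_mul I.n_pos, ← sq]
  · have e1 := Nat.div_add_mod q (I.n ^ 2)
    have e2 := Nat.div_add_mod (q % I.n ^ 2) I.n
    unfold padPos
    omega

theorem kn_bitPos {a c : ℕ} (hc : c < I.n) : I.kn (I.bitPos a c) = c + 1 := by
  simp [kn, bitPos, Nat.mod_eq_of_lt hc]

theorem ib_bitPos {a c : ℕ} (ha : a < I.n) (hc : c < I.n) : I.ib (I.bitPos a c) = a + 1 := by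
  have h := pair_lt ha hc
  have h2 := sum_cnt (fun j => (I.F1 j ∧ I.IsBit j) ∨ j = 0) (I.bitPos a c)
  have h3 : (I.ib (I.bitPos a c) : ℝ) = cnt I.F1 (I.bitPos a c) + cnt (fun j => j = 0) (I.bitPos a c) := by
    rw [← sum_cnt I.F1, ← sum_cnt, ib, ← sum_cnt, ← Finset.sum_add_distrib]
    refine Finset.sum_congr rfl fun j hj => ?_
    have hj' : j ≤ I.bitPos a c := Nat.lt_succ_iff.1 (Finset.mem_range.1 hj)
    rw [sgn_or fun h => by have := h.1.2.1; omega]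
    have : (I.F1 j ∧ I.IsBit j) = I.F1 j := propext ⟨fun h => h.1, fun h' => ⟨h', by
      have := h'.1
      unfold IsBit
      unfold bitPos at hj'
      omega⟩⟩
    rw [this]
    ring
  have h4 : cnt I.F1 (I.bitPos a c) = a := by
    rw [show cnt I.F1 (I.bitPos a c) = (I.bitPos a c - 1) / I.n from cnt_dvd _ _, bitPos,
      Nat.add_sub_cancel, Nat.mul_add_div I.n_pos, Nat.div_eq_of_lt hc, add_zero]
  rw [h4, cnt_zero_eq] at h3
  exact_mod_cast h3

/-- As `d ∣ n ^ 2`, the first padding token, at position `n ^ 2 + 1`, is itself counted, whence the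
`+ 1`. -/
theorem cnt_isPad {d q : ℕ} (hd : d ∣ I.n ^ 2) (hq : q < I.n ^ 3) :
    cnt (fun j => (1 < j ∧ d ∣ j - 1) ∧ I.IsPad j) (I.n ^ 2 + 1 + q) = q / d + 1 := by
  classical
  have hn2 : 0 < I.n ^ 2 := Nat.pow_pos I.n_pos
  induction q with
  | zero =>
    rw [add_zero, cnt_succ, cnt_eq_zero, if_pos]
    · simp
    · refine ⟨⟨by omega, by simpa using hd⟩, ?_⟩
      unfold IsPad
      omega
    · intro j hj h
      have := h.2.1
      omega
  | succ q ih =>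
    rw [← add_assoc, cnt_succ, ih (by omega), Nat.succ_div]
    have e : ((1 < I.n ^ 2 + 1 + q + 1 ∧ d ∣ I.n ^ 2 + 1 + q + 1 - 1) ∧
        I.IsPad (I.n ^ 2 + 1 + q + 1)) ↔ d ∣ q + 1 := by
      rw [Nat.add_sub_cancel, show I.n ^ 2 + 1 + q = I.n ^ 2 + (q + 1) by omega,
        Nat.dvd_add_right hd]
      unfold IsPad
      constructor
      · exact fun h => h.1.2
      · exact fun h => ⟨⟨by omega, h⟩, by omega, by omega⟩
    simp only [e]
    split_ifs <;> omega

theorem e1_padPos {a m c : ℕ} (ha : a < I.n) (hm : m < I.n) (hc : c < I.n) :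
    I.e1 (I.padPos a m c) = I.bitPos a m := by
  refine (cnt_isPad (Dvd.intro_left _ (by rw [sq])) (triple_lt ha hm hc)).trans ?_
  have : I.n ^ 2 * a + (I.n * m + c) = I.n * (I.n * a + m) + c := by ring
  rw [this, Nat.mul_add_div I.n_pos, Nat.div_eq_of_lt hc, bitPos, add_zero]

theorem ip_padPos {a m c : ℕ} (ha : a < I.n) (hm : m < I.n) (hc : c < I.n) :
    I.ip (I.padPos a m c) = a + 1 := by
  refine (cnt_isPad dvd_rfl (triple_lt ha hm hc)).trans ?_
  rw [Nat.mul_add_div (Nat.pow_pos I.n_pos), Nat.div_eq_of_lt (pair_lt hm hc), add_zero]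

theorem kn_padPos {a m c : ℕ} (hc : c < I.n) : I.kn (I.padPos a m c) = c + 1 := by
  have : I.padPos a m c - 1 = I.n * (I.n + I.n * a + m) + c := by
    unfold padPos
    rw [show I.n ^ 2 + 1 + (I.n ^ 2 * a + (I.n * m + c)) = I.n * (I.n + I.n * a + m) + c + 1 by ring]
    rfl
  rw [kn, if_neg (by unfold padPos; omega), this, Nat.mul_add_mod, Nat.mod_eq_of_lt hc]

theorem e2_padPos {a m c : ℕ} (hm : m < I.n) (hc : c < I.n) :
    I.e2 (I.padPos a m c) = I.bitPos m c := by
  have : I.padPos a m c - 1 = I.n ^ 2 * (1 + a) + (I.n * m + c) := by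
    unfold padPos
    rw [show I.n ^ 2 + 1 + (I.n ^ 2 * a + (I.n * m + c)) = I.n ^ 2 * (1 + a) + (I.n * m + c) + 1
      by ring]
    rfl
  rw [e2, if_neg (by unfold padPos; omega), this, Nat.mul_add_mod,
    Nat.mod_eq_of_lt (pair_lt hm hc), bitPos]

theorem exists_pos_and_eq {P : ℕ → Prop} {k : ℕ} (hk : 0 < k) (hkN : k < I.N) :
    (∃ j, 0 < j ∧ j < I.N ∧ (P j ∧ k = j)) ↔ P k :=
  ⟨fun ⟨_, _, _, h, e⟩ => e ▸ h, fun h => ⟨k, hk, hkN, h, rfl⟩⟩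

theorem bitPos_pos (a c : ℕ) : 0 < I.bitPos a c := Nat.succ_pos _

theorem bitPos_lt {a c : ℕ} (ha : a < I.n) (hc : c < I.n) : I.bitPos a c < I.N :=
  (isBit_bitPos ha hc).2.trans_lt I.sq_lt_N

theorem W_padPos (b : ℕ → Prop) {a m c : ℕ} (ha : a < I.n) (hm : m < I.n) (hc : c < I.n) :
    I.W b (I.padPos a m c) ↔ b (I.bitPos a m) ∧ b (I.bitPos m c) := by
  unfold W U V
  rw [e1_padPos ha hm hc, e2_padPos hm hc, exists_pos_and_eq (bitPos_pos _ _) (bitPos_lt ha hm),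
    exists_pos_and_eq (bitPos_pos _ _) (bitPos_lt hm hc), and_iff_left (isPad_padPos ha hm hc)]

/-- The composition step. The padding tokens matching the bit `(a, c)` in first and last vertex are
exactly those for `(a, m, c)`, one for each `m`. -/
theorem next_bitPos (b : ℕ → Prop) {a c : ℕ} (ha : a < I.n) (hc : c < I.n) :
    I.next b (I.bitPos a c) ↔ ∃ m < I.n, b (I.bitPos a m) ∧ b (I.bitPos m c) := by
  unfold next E
  rw [and_iff_left (isBit_bitPos ha hc), ib_bitPos ha hc, kn_bitPos hc]
  constructor
  · rintro ⟨j, -, -, hW, h1, h2⟩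
    obtain ⟨a', ha', m, hm, c', hc', rfl⟩ := hW.2.exists_eq
    rw [ip_padPos ha' hm hc'] at h1
    rw [kn_padPos hc'] at h2
    obtain rfl : a = a' := by omega
    obtain rfl : c = c' := by omega
    exact ⟨m, hm, (W_padPos b ha hm hc).1 hW⟩
  · rintro ⟨m, hm, h⟩
    have hp := isPad_padPos ha hm hc
    refine ⟨I.padPos a m c, by unfold padPos; omega, ?_, (W_padPos b ha hm hc).2 h, ?_, ?_⟩
    · have := hp.2
      unfold N
      omega
    · rw [ip_padPos ha hm hc]
    · rw [kn_padPos hc]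

theorem B0_bitPos {a c : ℕ} (ha : a < I.n) (hc : c < I.n) :
    I.B0 (I.bitPos a c) ↔ I.adj a c ∨ a = c := by
  have hb := isBit_bitPos ha hc
  unfold B0 IsEdge Dg
  rw [and_iff_right hb, and_iff_right hb, ib_bitPos ha hc, kn_bitPos hc]
  have e1 : (I.bitPos a c - 1) / I.n = a := by
    rw [bitPos, Nat.add_sub_cancel, Nat.mul_add_div I.n_pos, Nat.div_eq_of_lt hc, add_zero]
  have e2 : (I.bitPos a c - 1) % I.n = c := by
    rw [bitPos, Nat.add_sub_cancel, Nat.mul_add_mod, Nat.mod_eq_of_lt hc]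
  rw [e1, e2]
  refine or_congr_right ⟨?_, ?_⟩
  · rintro ⟨j, -, -, -, h1, h2⟩
    omega
  · rintro rfl
    refine ⟨a + 1, by omega, ?_, (bitPos_pos _ _).ne', rfl, rfl⟩
    have := I.n_le_sq
    have := I.sq_lt_N
    omega

/-- The set of bits after `l` repetitions. -/
def iter (I : Inst) (l : ℕ) : ℕ → Prop := I.next^[l] I.B0

theorem iter_succ (l : ℕ) : I.iter (l + 1) = I.next (I.iter l) :=
  Function.iterate_succ_apply' _ _ _

theorem isBit_of_iter {l i : ℕ} (h : I.iter l i) : I.IsBit i := by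
  cases l with
  | zero => exact h.1
  | succ l =>
    rw [iter_succ] at h
    exact h.2

/-- The diagonal in `B0` makes the relation reflexive, so squaring covers all lengths up to `2 ^ l`
and not only `2 ^ l` itself. -/
theorem iter_bitPos (l : ℕ) (a c : Fin I.n) : I.iter l (I.bitPos a c) ↔
    Within (fun a c : Fin I.n => I.adj a c) (2 ^ l) a c := by
  induction l generalizing a c with
  | zero =>
    rw [pow_zero, within_one, iter, Function.iterate_zero, id, B0_bitPos a.2 c.2, Fin.ext_iff]
  | succ l ih =>
    rw [iter_succ, next_bitPos _ a.2 c.2, pow_succ, mul_two, within_add]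
    constructor
    · rintro ⟨m, hm, h1, h2⟩
      exact ⟨⟨m, hm⟩, (ih a ⟨m, hm⟩).1 h1, (ih ⟨m, hm⟩ c).1 h2⟩
    · rintro ⟨m, h1, h2⟩
      exact ⟨m, m.2, (ih a m).2 h1, (ih m c).2 h2⟩

theorem ans_iter_clog : I.Ans (I.iter (Nat.clog 2 I.n)) ↔
    Relation.ReflTransGen (fun a c : Fin I.n => I.adj a c) ⟨I.s, I.hs⟩ ⟨I.t, I.ht⟩ := by
  rw [← within_iff_reflTransGen (k := 2 ^ Nat.clog 2 I.n)
    (by rw [Fintype.card_fin]; exact Nat.le_pow_clog one_lt_two _), ← iter_bitPos]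
  constructor
  · rintro ⟨j, -, -, h, h1, h2⟩
    obtain ⟨a, ha, c, hc, rfl⟩ := (isBit_of_iter h).exists_eq
    rw [ib_bitPos ha hc] at h1
    rw [kn_bitPos hc] at h2
    obtain rfl : I.s = a := by omega
    obtain rfl : I.t = c := by omega
    exact h
  · intro h
    exact ⟨_, bitPos_pos _ _, bitPos_lt I.hs I.ht, h, (ib_bitPos I.hs I.ht).symm,
      (kn_bitPos I.ht).symm⟩

end Inst

end Connectivity

namespace Connectivity

/-! ### The encoding -/

theorem flatMap_range (g : ℕ → Token) (n m : ℕ) :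
    ((List.range m).flatMap fun i => (List.range n).map fun j => g (n * i + j)) =
      (List.range (n * m)).map g := by
  induction m with
  | zero => simp
  | succ m ih =>
    rw [List.range_succ, List.flatMap_append, ih, Nat.mul_succ, List.range_add, List.map_append]
    simp

theorem map_range_eq_replicate (g : ℕ → Token) (m : ℕ) (x : Token) (h : ∀ j < m, g j = x) :
    (List.range m).map g = List.replicate m x := by
  rw [List.map_congr_left fun j hj => h j (List.mem_range.1 hj)]
  simp

theorem flatMap_finRange (g : ℕ → ℕ → Token) (n : ℕ) :
    ((List.finRange n).flatMap fun i : Fin n => (List.finRange n).map fun j : Fin n => g i j) =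
    (List.range n).flatMap fun i => (List.range n).map fun j => g i j := by
  rw [← List.map_coe_finRange_eq_range, List.flatMap_map]
  simp only [List.map_map]
  rfl

theorem Inst.encode_eq (I : Inst) {n : ℕ} (hn : n = I.n) (adj : Fin n → Fin n → Prop) (s t : Fin n)
    (hs : I.s = s) (ht : I.t = t) (hadj : ∀ i j : Fin n, adj i j ↔ I.adj i j) :
    encode adj s t = (List.range I.N).map I.tok := by
  classical
  subst hn
  have e : I.N = 1 + (I.n * I.n + I.n ^ 3 + (I.s + 1) + (I.t + 1)) := by
    unfold N
    rw [sq]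
    ring
  rw [e, List.range_add, List.range_add, List.range_add, List.range_add, encode]
  simp only [List.map_append, List.map_map]
  have h0 : (List.range 1).map I.tok = [Token.bos] := by simp [I.tok_zero]
  have h2 : (List.range (I.n ^ 3)).map (I.tok ∘ (1 + ·) ∘ (I.n * I.n + ·)) =
      List.replicate (I.n ^ 3) Token.pad := map_range_eq_replicate _ _ _ fun j hj =>
    I.tok_of_isPad (by unfold IsPad; rw [sq]; dsimp; omega)
  have h3 : (List.range (I.s + 1)).map (I.tok ∘ (1 + ·) ∘ (I.n * I.n + I.n ^ 3 + ·)) =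
      List.replicate (s + 1) Token.a := by
    rw [← hs]
    exact map_range_eq_replicate _ _ _ fun j hj =>
      I.tok_of_isA (by unfold IsA; rw [sq]; dsimp; omega)
  have h4 : (List.range (I.t + 1)).map (I.tok ∘ (1 + ·) ∘ (I.n * I.n + I.n ^ 3 + (I.s + 1) + ·)) =
      List.replicate (t + 1) Token.b := by
    rw [← ht]
    exact map_range_eq_replicate _ _ _ fun j hj =>
      I.tok_of_isB (by unfold IsB; rw [sq]; dsimp; omega)
  have h1 : ((List.finRange I.n).flatMap fun i =>
      (List.finRange I.n).map fun j => if adj i j then Token.one else Token.zero) =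
      (List.range (I.n * I.n)).map (I.tok ∘ (1 + ·)) := by
    simp only [hadj]
    rw [flatMap_finRange fun i j => if I.adj i j then Token.one else Token.zero, ← flatMap_range]
    refine List.flatMap_congr fun i hi => List.map_congr_left fun j hj => ?_
    rw [List.mem_range] at hi hj
    have hb := isBit_bitPos hi hj
    have e1 : (I.bitPos i j - 1) / I.n = i := by
      rw [bitPos, Nat.add_sub_cancel, Nat.mul_add_div I.n_pos, Nat.div_eq_of_lt hj, add_zero]
    have e2 : (I.bitPos i j - 1) % I.n = j := by
      rw [bitPos, Nat.add_sub_cancel, Nat.mul_add_mod, Nat.mod_eq_of_lt hj]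
    have e3 : I.IsEdge (I.bitPos i j) ↔ I.adj i j := by
      unfold IsEdge
      rw [e1, e2, and_iff_right hb]
    have e4 : (I.tok ∘ (1 + ·)) (I.n * i + j) = I.tok (I.bitPos i j) :=
      congrArg I.tok (add_comm _ _)
    rw [e4]
    rcases I.tok_of_isBit hb with ⟨h, h'⟩ | ⟨h, h'⟩
    · rw [h', if_pos (e3.1 h)]
    · rw [h', if_neg fun h'' => h (e3.2 h'')]
  rw [h0, h1, h2, h3, h4]
  rfl

/-! ### Correctness -/

instance : Finite Token :=
  Finite.of_injective (β := Fin 7) (fun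
    | .bos => 0 | .zero => 1 | .one => 2 | .pad => 3 | .a => 4 | .b => 5 | .accept => 6)
    fun x y h => by cases x <;> cases y <;> simp at h ⊢

theorem hasHead (c : Bool) : T.HasHead c := by
  have hmem : (⟨att0, ff0⟩ : LayerSpec Coord).compile 12 ∈ T.layers 1 := by
    have h : T.layers 1 = _ := transformer.layers_compile 12 1
    rw [h]
    simp [transformer]
  refine ⟨_, hmem, ?_⟩
  have hc : headCount Coord = 87 := (Fintype.ofEquiv_card _).trans (Fintype.card_fin 87)
  cases c
  · exact ⟨⟨1, by omega⟩, rfl⟩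
  · exact ⟨⟨0, by omega⟩, rfl⟩

/-- `2 ^ (clog n - 1) < n` for `n > 1`; this is the depth bound that keeps the error of the loop
polynomial. -/
theorem Inst.two_pow_clog_le (I : Inst) : 2 ^ Nat.clog 2 I.n ≤ I.N ^ 2 := by
  have h1 := I.n_le_sq.trans I.sq_lt_N.le
  have h2 := I.N_ge
  rcases Nat.lt_or_ge 1 I.n with h | h
  · have h3 := Nat.pow_pred_clog_lt_self one_lt_two h
    obtain ⟨k, hk⟩ := Nat.exists_eq_succ_of_ne_zero (Nat.clog_pos one_lt_two h).ne'
    rw [hk, Nat.pred_succ] at h3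
    rw [hk, pow_succ]
    nlinarith
  · rw [Nat.clog_of_right_le_one h, pow_zero]
    nlinarith

/-- The residual stream when the repeated block has been executed `l` times. -/
def stream (I : Inst) (l i : ℕ) : Coord → ℝ := loopVal I ⟨I.iter l, 0, 0, 0, 0, 0⟩ i

theorem stream_zero (I : Inst) (i : ℕ) : stream I 0 i = st I 34 i := (st_eq_loopVal i).symm

/-- Between passes all the loop variables are back at `0` except `B`, which is `±1`. -/
theorem abs_stream_le (I : Inst) (l i : ℕ) (c : Coord) :
    |stream I l i c| ≤ max 1 |stream I 0 i c| := by
  by_cases hc : c = .B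
  · subst hc
    refine le_max_of_le_left (le_of_eq ?_)
    simp only [stream, loopVal]
    by_cases h : I.iter l i <;> simp [sgn, h]
  · refine le_max_of_le_right (le_of_eq ?_)
    cases c <;> first | rfl | exact absurd rfl hc

theorem not_iter_zero (I : Inst) (l : ℕ) : ¬I.iter l 0 := fun h =>
  I.not_isBit_zero (Inst.isBit_of_iter h)

open Classical in
/-- The token that the transformer outputs. -/
def answer (I : Inst) : Token :=
  if I.Ans (I.iter (Nat.clog 2 I.n)) then .accept else .bos

theorem exists_outputs : ∃ (a : ℕ) (X₀ : ℝ), ∀ (ν : NormKind) {rnd : ℝ → ℝ} {η X : ℝ},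
    IsRounding rnd η X → X₀ ≤ X → ∀ (I : Inst) (u : List Token), u = (List.range I.N).map I.tok →
      η * (u.length : ℝ) ^ a ≤ 1 → T.Outputs rnd ν (Nat.clog 2 I.n) u (answer I) := by
  -- The exponents `6` and `16` are those of the lower bound for the norms in the initial layers and
  -- of the margin `γ`.
  obtain ⟨a, X₀, H⟩ := transformer.outputs_of_steps (w := 12)
    (fun L h => fits (by simp [h])) (fun L h => fits (by simp [h])) (fun L h => fits (by simp [h]))
    6 16
  refine ⟨a, X₀, fun ν rnd η X h hX I u hu hη => ?_⟩
  have hl : u.length = I.N := by rw [hu]; simp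
  have hget : ∀ i : Fin u.length, u.get i = I.tok i := by subst hu; simp
  have h5 := I.N_ge
  have key : ∀ {L : ℕ}, L = I.N →
      LayerSpec.Steps (1 / (L : ℝ) ^ 6) (1 / (L : ℝ) ^ 16) transformer.initial
        (fun (i : Fin L) c => (embed (I.tok i) c : ℝ)) (fun i => stream I 0 i) ∧
      (∀ l, LayerSpec.Steps 1 (1 / (L : ℝ) ^ 16) transformer.repeated
        (fun i : Fin L => stream I l i) (fun i => stream I (l + 1) i)) ∧
      ∀ l, LayerSpec.Steps 1 (1 / (L : ℝ) ^ 16) transformer.final (fun i : Fin L => stream I l i)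
        (fun i => loopVal I ⟨I.iter l, 0, 0, 0, 0, fun _ => sgn (I.Ans (I.iter l))⟩ i) := by
    rintro L rfl
    refine ⟨?_, fun l => ?_, fun l => final_steps (not_iter_zero I l)⟩
    · have e1 : (fun (i : Fin I.N) c => (embed (I.tok i) c : ℝ)) = fun i : Fin I.N => st I 0 i := by
        ext i c
        rw [embed_tok]
        rfl
      simp only [stream_zero, e1]
      exact initial_steps
    · have := repeated_steps (I := I) (not_iter_zero I l)
      rwa [← Inst.iter_succ] at this
  obtain ⟨k1, k2, k3⟩ := key hl
  have hlast : u.length - 1 < u.length := by omega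
  refine H ν h hX u (by omega) hη (Nat.clog 2 I.n) (hl ▸ I.two_pow_clog_le)
    (fun l i => stream I l i) _ ?_ (fun l _ => k2 l) (fun l i c => abs_stream_le I l i c)
    (k3 _) ⟨u.length - 1, hlast⟩ (answer I) (by simp; omega) ?_
  · simp only [hget]
    exact k1
  · intro y hy
    unfold answer at hy ⊢
    by_cases hA : I.Ans (I.iter (Nat.clog 2 I.n))
    · rw [if_pos hA] at hy ⊢
      cases y <;> simp [transformer, loopVal, val, init, sgn_true hA] at hy ⊢
    · rw [if_neg hA] at hy ⊢
      cases y <;> simp [transformer, loopVal, val, init, sgn_false hA] at hy ⊢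

/-- The instance of a graph with vertices in `Fin n`. -/
def Inst.ofAdj {n : ℕ} (adj : Fin n → Fin n → Prop) (s t : Fin n) : Inst where
  n := n
  s := s
  t := t
  adj i j := ∃ (hi : i < n) (hj : j < n), adj ⟨i, hi⟩ ⟨j, hj⟩
  hs := s.2
  ht := t.2

theorem exists_decides (ν : NormKind) {D : Datatype} (hD : D.IsPrecise) : ∃ c : ℝ, 0 < c ∧
    ∀ (n p : ℕ) (s t : Fin n) (adj : Fin n → Fin n → Prop),
      c * Real.logb 2 (encode adj s t).length ≤ p →
        Decides D p ν T adj s t (Relation.ReflTransGen adj s t) := by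
  obtain ⟨a, X₀, H⟩ := exists_outputs
  obtain ⟨c, hc, hr⟩ := hD.exists_isRounding a X₀
  refine ⟨c, hc, fun n p s t adj hp => ?_⟩
  set I := Inst.ofAdj adj s t with hI
  have hadj : ∀ i j : Fin n, adj i j ↔ I.adj i j := fun i j =>
    ⟨fun h => ⟨i.2, j.2, h⟩, fun ⟨_, _, h⟩ => h⟩
  have he := I.encode_eq rfl adj s t rfl rfl hadj
  have hl : (encode adj s t).length = I.N := (congrArg List.length he).trans (by simp)
  have h5 := I.N_ge
  obtain ⟨η, X, h1, h2, h3⟩ := hr _ p (by omega) hp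
  refine ⟨answer I, H ν h1 h2 I _ he h3, ?_⟩
  have hans := Inst.ans_iter_clog (I := I)
  have e : (fun a c : Fin I.n => I.adj a c) = adj := by
    ext i j
    exact (hadj i j).symm
  rw [e] at hans
  refine Iff.trans ?_ hans
  unfold answer
  split_ifs with h <;> simp [h]

end Connectivity

end LoopedTransformer

end

theorem mainTheorem2 (ν : NormKind) :
    ∃ (h d w : ℕ) (T : UniversalTransformer Token 17 2 1 h d w),
      (∀ i, T.pos i = 0) ∧ T.HasHead true ∧ T.HasHead false ∧
      ∀ D : Datatype, D.IsPrecise → ∃ c : ℝ, 0 < c ∧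
        ∀ (n p : ℕ) (s t : Fin n),
          (∀ G : Digraph (Fin n), c * Real.logb 2 (encode G.Adj s t).length ≤ p →
            Decides D p ν T G.Adj s t (Relation.ReflTransGen G.Adj s t)) ∧
          (∀ G : SimpleGraph (Fin n), c * Real.logb 2 (encode G.Adj s t).length ≤ p →
            Decides D p ν T G.Adj s t (G.Reachable s t)) := by
  refine ⟨_, _, _, Connectivity.T, fun _ => rfl, Connectivity.hasHead true,
    Connectivity.hasHead false, fun D hD => ?_⟩
  obtain ⟨c, hc, H⟩ := Connectivity.exists_decides ν hD
  refine ⟨c, hc, fun n p s t => ⟨fun G => H n p s t G.Adj, fun G => ?_⟩⟩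
  rw [SimpleGraph.reachable_iff_reflTransGen]
  exact H n p s t G.Adj
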